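/- Let $q\in\mathbb C$ be nonzero with $q^m\neq 1$ for all integers $m\ge 1$, and put $m_q=(q^m-q^{-m})/(q-q^{-1})$. Let $V=\mathbb C^n$ with basis $e_1,\dots,e_n$, and let $R$ be an $n^2\times n^2$ complex matrix, with entries $R_{ia}^{\;jb}$ (lower indices number rows), such that: (1) $R_{12}R_{23}R_{12}=R_{23}R_{12}R_{23}$ and $(R-qI)(R+q^{-1}I)=0$. Then $\sigma_i\mapsto R_i:=R_{i,i+1}$ defines the local representation $\rho_R$ of the Hecke algebra $H_k(q)$ in $V^{\otimes k}$. (2) $R$ is skew-invertible: there is $\Psi$ with $\sum_{a,b}R_{ia}^{\;jb}\Psi_{bk}^{\;as}=\delta_i^s\delta_k^j=\sum_{a,b}\Psi_{ia}^{\;jb}R_{bk}^{\;as}$. Put $B_1=\mathrm{Tr}_{(2)}\Psi_{21}$ and $C_1=\mathrm{Tr}_{(2)}\Psi_{12}$. (3) $R$ has symmetry rank $p\ge 1$: the $q$-antisymmetrizers $A^{(m)}\in H_m(q)$ satisfy $\rho_R(A^{(p+1)})=0$ and $\mathrm{rank}\,\rho_R(A^{(p)})=1$. Let $\mathcal L_q$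 be the modified reflection equation algebra: the unital associative $\mathbb C$-algebra generated by the entries $l_i^{\,j}$ of an $n\times n$ matrix $L$ with the relations $$R_{12}L_1R_{12}L_1-L_1R_{12}L_1R_{12}=R_{12}L_1-L_1R_{12},\qquad L_1=L\otimes I,$$ and let $\mathrm{Tr}_qL=\mathrm{Tr}(C\cdot L)\in\mathcal L_q$. Let $\pi(l_i^{\,j})$ be the operator $e_m\mapsto B_m^{\,j}e_i$ on $V$ and, for $k\ge1$, let $$\rho_k^t(l_i^{\,j})=\sum_{s=0}^{k-1}R_s^{-1}\cdots R_1^{-1}\bigl[\pi^t(l_i^{\,j})\otimes I^{\otimes(k-1)}\bigr]R_1^{-1}\cdots R_s^{-1},$$ where $t$ denotes the transposed matrix, i.e. the matrix $X$ corresponding to the operator $e_i\mapsto\sum_jX_i^{\,j}e_j$. For a standard Young tableau $\nu(a)$ with $k$ boxes, let $\mathcal Y_{\nu(a)}\in H_k(q)$ be its primitive $q$-Young idempotent, defined through the Jucys–Murphy elements $\mathcal J_1=1$, $\mathcal J_{i+1}=\sigma_i\mathcal J_i\sigma_i$ by $$\mathcal Y_{\nu(a)}=\prod_{i=1}^k\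 \prod_{\substack{-k<m<k\\ m\ne c_i-r_i}}\frac{\mathcal J_i-q^{2m}}{q^{2(c_i-r_i)}-q^{2m}},$$ where $c_i$ and $r_i$ are the column and the row of the box numbered $i$. Put $Y_{\nu(a)}=\rho_R(\mathcal Y_{\nu(a)})$, and let $V_{\nu(a)}\subseteq V^{\otimes k}$ be the image of the operator $Y_{\nu(a)}$. Then $\mathrm{Tr}_qL$ is central in $\mathcal L_q$. Moreover, let $\nu=(\nu_1\ge\dots\ge\nu_s>0)$ be any partition of $k\ge 1$. For every standard tableau $\nu(a)$ of shape $\nu$ there is a representation $\pi_{\nu(a)}$ of $\mathcal L_q$ in $V_{\nu(a)}$ in which $l_i^{\,j}$ acts by the operator with the (transposed) matrix $\pi^t_{\nu(a)}(l_i^{\,j})=Y_{\nu(a)}\,\rho_k^t(l_i^{\,j})\,Y_{\nu(a)}$, and in this representation $\mathrm{Tr}_qL$ acts as the scalar $$\chi_\nu(\mathrm{Tr}_qL)=q^{-2p}\sum_{r=1}^{s}q^{2r-1-\nu_r}(\nu_r)_q,$$ which depends only on $\nu$ and $p$, and not on the tableau $a$. -/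

import Mathlib

open scoped Kronecker

noncomputable section

namespace ReflectionEq

/-- The `q`-number `m_q = (q ^ m - q ^ (-m)) / (q - q⁻¹)`. -/
def qNum (q : ℂ) (m : ℕ) : ℂ := (q ^ m - (q⁻¹) ^ m) / (q - q⁻¹)

/-! ### Hecke algebras and their distinguished elements -/

/-- Defining relations of the Hecke algebra on `k` strands; the generator with index `i : Fin (k-1)`
is usually written `σ_{i+1}`. -/
inductive HeckeRel (q : ℂ) (k : ℕ) :
    FreeAlgebra ℂ (Fin (k - 1)) → FreeAlgebra ℂ (Fin (k - 1)) → Prop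
  | braid (i j : Fin (k - 1)) (h : (j : ℕ) = i + 1) :
      HeckeRel q k
        (FreeAlgebra.ι ℂ i * FreeAlgebra.ι ℂ j * FreeAlgebra.ι ℂ i)
        (FreeAlgebra.ι ℂ j * FreeAlgebra.ι ℂ i * FreeAlgebra.ι ℂ j)
  | comm (i j : Fin (k - 1)) (h : (i : ℕ) + 2 ≤ j) :
      HeckeRel q k (FreeAlgebra.ι ℂ i * FreeAlgebra.ι ℂ j) (FreeAlgebra.ι ℂ j * FreeAlgebra.ι ℂ i)
  | quad (i : Fin (k - 1)) :
      HeckeRel q k ((FreeAlgebra.ι ℂ i - q • 1) * (FreeAlgebra.ι ℂ i + q⁻¹ • 1)) 0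

/-- The Hecke algebra `H_k(q)` on `k` strands. -/
abbrev HeckeAlgebra (q : ℂ) (k : ℕ) : Type := RingQuot (HeckeRel q k)

/-- The generator of `H_k(q)` exchanging the strands `i` and `i + 1` (strands are numbered
`0, …, k-1`). It is only used for `i + 1 < k`. -/
def heckeGen (q : ℂ) (k i : ℕ) : HeckeAlgebra q k :=
  if h : i < k - 1 then RingQuot.mkAlgHom ℂ (HeckeRel q k) (FreeAlgebra.ι ℂ ⟨i, h⟩) else 0

/-- The `q`-antisymmetrizer on the `m` consecutive strands `j, …, j + m - 1`, as an element of
`H_k(q)`: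
`A_{j,…,j+m} = ((m+1)_q)⁻¹ A_{j+1,…,j+m} (q ^ m - m_q σ) A_{j+1,…,j+m}`, with `σ` the generator
exchanging `j` and `j+1`. -/
def antisymmetrizerOn (q : ℂ) (k : ℕ) : ℕ → ℕ → HeckeAlgebra q k
  | 0, _ => 1
  | 1, _ => 1
  | m + 2, j =>
      (qNum q (m + 2))⁻¹ •
        (antisymmetrizerOn q k (m + 1) (j + 1) *
          (q ^ (m + 1) • (1 : HeckeAlgebra q k) - qNum q (m + 1) • heckeGen q k j) *
          antisymmetrizerOn q k (m + 1) (j + 1))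

/-- The `q`-antisymmetrizer `A^{(k)} ∈ H_k(q)`. -/
def antisymmetrizer (q : ℂ) (k : ℕ) : HeckeAlgebra q k := antisymmetrizerOn q k k 0

/-- The Jucys–Murphy elements of `H_k(q)`: `J = 1` for the strand `0`, and
`J = σ_i ⋯ σ_1 σ_1 ⋯ σ_i` for the strand `i` (that is, `J_{i+1}` in one-based numbering). -/
def jucysMurphy (q : ℂ) (k : ℕ) : ℕ → HeckeAlgebra q k
  | 0 => 1
  | i + 1 => heckeGen q k i * jucysMurphy q k i * heckeGen q k i

/-- A standard Young tableau of shape `ν` with `k` boxes: `box i` is the box `(row, column)`, both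
counted from zero, that carries the number `i + 1`. The numbers increase strictly along rows
and columns. -/
structure StandardTableau (ν : YoungDiagram) (k : ℕ) where
  box : Fin k ≃ ν.cells
  row_lt : ∀ i j : Fin k, (box i).1.1 = (box j).1.1 → (box i).1.2 < (box j).1.2 → i < j
  col_lt : ∀ i j : Fin k, (box i).1.2 = (box j).1.2 → (box i).1.1 < (box j).1.1 → i < j

/-- Column minus row of the box that carries the number `i + 1`. -/
def StandardTableau.content {ν : YoungDiagram} {k : ℕ} (T : StandardTableau ν k) (i : Fin k) : ℤ :=
  ((T.box i).1.2 : ℤ) - ((T.box i).1.1 : ℤ)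

/-- The primitive `q`-Young idempotent of a standard tableau `T`, in Jucys–Murphy form:
`∏_i ∏_{m ≠ c_T(i)} (J_i - q^{2m}) / (q^{2 c_T(i)} - q^{2m})`,
where `-k < m < k` runs through all the possible contents. (`Lagrange.basis` is the polynomial in
one variable in the inner product; the `J_i` commute.) -/
def youngIdempotent (q : ℂ) {ν : YoungDiagram} {k : ℕ} (T : StandardTableau ν k) :
    HeckeAlgebra q k :=
  (List.ofFn fun i : Fin k =>
    Polynomial.aeval (jucysMurphy q k i)
      (Lagrange.basis (Finset.Ioo (-(k : ℤ)) (k : ℤ)) (fun m : ℤ => q ^ (2 * m))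
        (T.content i))).prod

/-! ### Matrices on tensor powers

`V = ℂⁿ`. The basis of `V^{⊗k}` is indexed by `Fin k → Fin n`. A matrix entry `X_i^j` with lower index
`i` and upper index `j` is `X i j` (the lower index numbers the rows), and the matrix product is the
ordinary one. The operator on `V^{⊗k}` with `e_i ↦ ∑_j X_i^j e_j` is `Matrix.toLin' Xᵀ`. -/

variable {n : ℕ}

/-- `X` acting in the tensor factor `a` of `V^{⊗k}`. -/
def onSite {k : ℕ} (X : Matrix (Fin n) (Fin n) ℂ) (a : Fin k) :
    Matrix (Fin k → Fin n) (Fin k → Fin n) ℂ :=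
  Matrix.of fun f g => if ∀ c, c ≠ a → f c = g c then X (f a) (g a) else 0

/-- `X` acting in the tensor factors `a` and `b` of `V^{⊗k}`. -/
def onSites {k : ℕ} (X : Matrix (Fin n × Fin n) (Fin n × Fin n) ℂ) (a b : Fin k) :
    Matrix (Fin k → Fin n) (Fin k → Fin n) ℂ :=
  Matrix.of fun f g => if ∀ c, c ≠ a → c ≠ b → f c = g c then X (f a, f b) (g a, g b) else 0

/-- `X_{i,i+1} = I^{⊗ i} ⊗ X ⊗ I^{⊗ (k-i-2)}`, with factors numbered `0, …, k-1`. It is only used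
for `i + 1 < k`. -/
def neighbour (k : ℕ) (X : Matrix (Fin n × Fin n) (Fin n × Fin n) ℂ) (i : ℕ) :
    Matrix (Fin k → Fin n) (Fin k → Fin n) ℂ :=
  if h : i < k - 1 then onSites X ⟨i, by omega⟩ ⟨i + 1, by omega⟩ else 0

/-- `R` is a Hecke solution of the Yang–Baxter equation. -/
structure IsHeckeRMatrix (q : ℂ) (R : Matrix (Fin n × Fin n) (Fin n × Fin n) ℂ) : Prop where
  yangBaxter :
    neighbour 3 R 0 * neighbour 3 R 1 * neighbour 3 R 0 =
      neighbour 3 R 1 * neighbour 3 R 0 * neighbour 3 R 1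
  hecke : (R - q • 1) * (R + q⁻¹ • 1) = 0

/-! The matrices `R_{i,i+1}` satisfy the relations of the Hecke algebra. -/

/-- A matrix on `V^{⊗m}` acting in the factors `e 0, …, e (m-1)` of `V^{⊗k}`. -/
def spread {m k : ℕ} (e : Fin m → Fin k) (X : Matrix (Fin m → Fin n) (Fin m → Fin n) ℂ) :
    Matrix (Fin k → Fin n) (Fin k → Fin n) ℂ :=
  Matrix.of fun f g => if ∀ c, (∀ i, e i ≠ c) → f c = g c then X (f ∘ e) (g ∘ e) else 0

theorem spread_mul {m k : ℕ} {e : Fin m → Fin k} (he : Function.Injective e)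
    (X Y : Matrix (Fin m → Fin n) (Fin m → Fin n) ℂ) :
    spread e X * spread e Y = spread e (X * Y) := by
  ext f g
  by_cases hfg : ∀ c, (∀ i, e i ≠ c) → f c = g c
  · simp only [spread, Matrix.mul_apply, Matrix.of_apply, if_pos hfg]
    symm
    refine Fintype.sum_of_injective (fun u : Fin m → Fin n => Function.extend e u f) ?_ _ _ ?_ ?_
    · intro u v huv
      funext i
      have := congrFun huv (e i)
      simpa [he.extend_apply] using this
    · intro h hh
      rw [if_neg, zero_mul]
      intro hf
      apply hh
      refine ⟨h ∘ e, ?_⟩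
      funext c
      by_cases hc : ∃ i, e i = c
      · obtain ⟨i, rfl⟩ := hc
        simp [he.extend_apply]
      · simp only [Function.extend_apply' _ _ _ hc]
        exact hf c (fun i hi => hc ⟨i, hi⟩)
    · intro u
      have h1 : ∀ c, (∀ i, e i ≠ c) → f c = Function.extend e u f c := by
        intro c hc
        rw [Function.extend_apply' _ _ _ (fun ⟨i, hi⟩ => hc i hi)]
      have h2 : ∀ c, (∀ i, e i ≠ c) → Function.extend e u f c = g c := by
        intro c hc
        rw [← h1 c hc, hfg c hc]
      have h3 : Function.extend e u f ∘ e = u := by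
        funext i
        exact he.extend_apply u f i
      rw [if_pos h1, if_pos h2, h3]
  · have : spread e (X * Y) f g = 0 := by simp only [spread, Matrix.of_apply, if_neg hfg]
    rw [this, Matrix.mul_apply]
    refine Finset.sum_eq_zero fun h _ => ?_
    simp only [spread, Matrix.of_apply]
    by_cases h1 : ∀ c, (∀ i, e i ≠ c) → f c = h c
    · rw [if_neg (c := ∀ c, (∀ i, e i ≠ c) → h c = g c), mul_zero]
      intro h2
      exact hfg fun c hc => (h1 c hc).trans (h2 c hc)
    · rw [if_neg h1, zero_mul]

theorem spread_one {m k : ℕ} {e : Fin m → Fin k} :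
    spread e (1 : Matrix (Fin m → Fin n) (Fin m → Fin n) ℂ) = 1 := by
  ext f g
  simp only [spread, Matrix.of_apply, Matrix.one_apply]
  by_cases h : f = g
  · simp [h]
  · rw [if_neg h]
    split_ifs with h1 h2
    · refine absurd ?_ h
      funext c
      by_cases hc : ∃ i, e i = c
      · obtain ⟨i, rfl⟩ := hc
        exact congrFun h2 i
      · exact h1 c fun i hi => hc ⟨i, hi⟩
    · rfl
    · rfl

theorem spread_spread {l m k : ℕ} {e : Fin m → Fin k} (he : Function.Injective e)
    (d : Fin l → Fin m) (X : Matrix (Fin l → Fin n) (Fin l → Fin n) ℂ) :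
    spread e (spread d X) = spread (e ∘ d) X := by
  ext f g
  simp only [spread, Matrix.of_apply]
  rw [← ite_and]
  refine if_congr ⟨?_, ?_⟩ rfl rfl
  · rintro ⟨h1, h2⟩ c hc
    by_cases h : ∃ i, e i = c
    · obtain ⟨i, rfl⟩ := h
      exact h2 i fun j hj => hc j (by simp [hj])
    · exact h1 c fun i hi => h ⟨i, hi⟩
  · intro h
    exact ⟨fun c hc => h c fun i => hc _, fun i hi => h _ fun j hj => hi j (he hj)⟩

theorem spread_comm {l m k : ℕ} {d : Fin l → Fin k} {e : Fin m → Fin k}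
    (hd : Function.Injective d) (he : Function.Injective e) (hde : ∀ i j, d i ≠ e j)
    (X : Matrix (Fin l → Fin n) (Fin l → Fin n) ℂ) (Y : Matrix (Fin m → Fin n) (Fin m → Fin n) ℂ) :
    spread d X * spread e Y = spread e Y * spread d X := by
  have key : ∀ {l m : ℕ} {d : Fin l → Fin k} {e : Fin m → Fin k}
      (_ : Function.Injective d) (_ : ∀ i j, d i ≠ e j)
      (X : Matrix (Fin l → Fin n) (Fin l → Fin n) ℂ)
      (Y : Matrix (Fin m → Fin n) (Fin m → Fin n) ℂ) (f g : Fin k → Fin n),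
      (spread d X * spread e Y) f g =
        if ∀ c, (∀ i, d i ≠ c) → (∀ j, e j ≠ c) → f c = g c then
          X (f ∘ d) (g ∘ d) * Y (f ∘ e) (g ∘ e) else 0 := by
    intro l m d e hd hde X Y f g
    rw [Matrix.mul_apply, Finset.sum_eq_single (Function.extend d (g ∘ d) f)]
    · have h1 : ∀ c, (∀ i, d i ≠ c) → f c = Function.extend d (g ∘ d) f c := by
        intro c hc
        rw [Function.extend_apply' _ _ _ (fun ⟨i, hi⟩ => hc i hi)]
      have h3 : Function.extend d (g ∘ d) f ∘ d = g ∘ d := by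
        funext i
        exact hd.extend_apply (g ∘ d) f i
      have h4 : Function.extend d (g ∘ d) f ∘ e = f ∘ e := by
        funext j
        exact (h1 (e j) fun i => hde i j).symm
      simp only [spread, Matrix.of_apply, if_pos h1, h3, h4, mul_ite, mul_zero]
      refine if_congr ⟨fun h c hc hc' => ?_, fun h c hc => ?_⟩ rfl rfl
      · rw [h1 c hc, h c hc']
      · by_cases hcd : ∃ i, d i = c
        · obtain ⟨i, rfl⟩ := hcd
          exact congrFun h3 i
        · rw [← h1 c fun i hi => hcd ⟨i, hi⟩]
          exact h c (fun i hi => hcd ⟨i, hi⟩) hc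
    · intro h _ hne
      simp only [spread, Matrix.of_apply]
      by_cases h1 : ∀ c, (∀ i, d i ≠ c) → f c = h c
      · rw [if_neg (c := ∀ c, (∀ i, e i ≠ c) → h c = g c), mul_zero]
        intro h2
        apply hne
        funext c
        by_cases hcd : ∃ i, d i = c
        · obtain ⟨i, rfl⟩ := hcd
          rw [hd.extend_apply]
          exact h2 _ fun j hj => hde i j hj.symm
        · rw [Function.extend_apply' _ _ _ hcd]
          exact (h1 c fun i hi => hcd ⟨i, hi⟩).symm
      · rw [if_neg h1, zero_mul]
    · intro h
      exact absurd (Finset.mem_univ _) h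
  ext f g
  rw [key hd hde, key he (fun i j => (hde j i).symm)]
  refine if_congr ⟨fun h c h1 h2 => h c h2 h1, fun h c h1 h2 => h c h2 h1⟩ (mul_comm _ _) rfl

/-- A matrix on `V ⊗ V` in the indexing by functions. -/
def asPower (X : Matrix (Fin n × Fin n) (Fin n × Fin n) ℂ) :
    Matrix (Fin 2 → Fin n) (Fin 2 → Fin n) ℂ :=
  Matrix.reindexAlgEquiv ℂ ℂ (finTwoArrowEquiv (Fin n)).symm X

theorem onSites_eq_spread {k : ℕ} (X : Matrix (Fin n × Fin n) (Fin n × Fin n) ℂ) (a b : Fin k) :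
    onSites X a b = spread ![a, b] (asPower X) := by
  ext f g
  simp only [onSites, spread, asPower, Matrix.of_apply, Matrix.coe_reindexAlgEquiv,
    Matrix.reindex_apply, Matrix.submatrix_apply]
  refine if_congr ?_ ?_ rfl
  · refine forall_congr' fun c => ?_
    simp only [Fin.forall_fin_two, Matrix.cons_val_zero, Matrix.cons_val_one, and_imp]
    exact ⟨fun h h1 h2 => h h1.symm h2.symm, fun h h1 h2 => h h1.symm h2.symm⟩
  · simp [finTwoArrowEquiv]

theorem pair_injective {k : ℕ} {a b : Fin k} (h : a ≠ b) :
    Function.Injective ![a, b] := by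
  intro i j hij
  fin_cases i <;> fin_cases j <;> simp_all

theorem onSites_braid {q : ℂ} {R : Matrix (Fin n × Fin n) (Fin n × Fin n) ℂ}
    (hR : IsHeckeRMatrix q R) {k : ℕ} {a b c : Fin k} (hab : a ≠ b) (hac : a ≠ c) (hbc : b ≠ c) :
    onSites R a b * onSites R b c * onSites R a b =
      onSites R b c * onSites R a b * onSites R b c := by
  have he : Function.Injective ![a, b, c] := by
    intro i j hij
    fin_cases i <;> fin_cases j <;> simp_all
  have h := hR.yangBaxter
  have h0 : neighbour 3 R 0 = onSites R (0 : Fin 3) 1 := rfl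
  have h1 : neighbour 3 R 1 = onSites R (1 : Fin 3) 2 := rfl
  rw [h0, h1] at h
  have e0 : spread ![a, b, c] (onSites R (0 : Fin 3) 1) = onSites R a b := by
    rw [onSites_eq_spread, spread_spread he, onSites_eq_spread]
    congr 1
    funext i
    fin_cases i <;> rfl
  have e1 : spread ![a, b, c] (onSites R (1 : Fin 3) 2) = onSites R b c := by
    rw [onSites_eq_spread, spread_spread he, onSites_eq_spread]
    congr 1
    funext i
    fin_cases i <;> rfl
  have := congrArg (spread ![a, b, c]) h
  simpa only [← spread_mul he, e0, e1] using this

theorem onSites_hecke {q : ℂ} {R : Matrix (Fin n × Fin n) (Fin n × Fin n) ℂ}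
    (hR : IsHeckeRMatrix q R) {k : ℕ} {a b : Fin k} (hab : a ≠ b) :
    (onSites R a b - q • 1) * (onSites R a b + q⁻¹ • 1) = 0 := by
  have he := pair_injective hab
  have s1 : onSites R a b - q • 1 = spread ![a, b] (asPower (R - q • 1)) := by
    rw [← spread_one (e := ![a, b]), onSites_eq_spread]
    ext f g
    simp only [spread, asPower, map_sub, map_smul, map_one, Matrix.sub_apply, Matrix.smul_apply,
      Matrix.of_apply]
    split_ifs <;> simp
  have s2 : onSites R a b + q⁻¹ • 1 = spread ![a, b] (asPower (R + q⁻¹ • 1)) := by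
    rw [← spread_one (e := ![a, b]), onSites_eq_spread]
    ext f g
    simp only [spread, asPower, map_add, map_smul, map_one, Matrix.add_apply, Matrix.smul_apply,
      Matrix.of_apply]
    split_ifs <;> simp
  rw [s1, s2, spread_mul he]
  have : asPower (R - q • 1) * asPower (R + q⁻¹ • 1) = 0 := by
    rw [asPower, asPower, ← map_mul, hR.hecke, map_zero]
  rw [this]
  ext f g
  simp [spread]

theorem onSites_comm (X : Matrix (Fin n × Fin n) (Fin n × Fin n) ℂ) {k : ℕ} {a b c d : Fin k}
    (hab : a ≠ b) (hcd : c ≠ d) (hac : a ≠ c) (had : a ≠ d) (hbc : b ≠ c) (hbd : b ≠ d) :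
    onSites X a b * onSites X c d = onSites X c d * onSites X a b := by
  rw [onSites_eq_spread, onSites_eq_spread]
  refine spread_comm (pair_injective hab) (pair_injective hcd) ?_ _ _
  intro i j
  fin_cases i <;> fin_cases j <;> simp_all

theorem neighbour_braid {q : ℂ} {R : Matrix (Fin n × Fin n) (Fin n × Fin n) ℂ}
    (hR : IsHeckeRMatrix q R) {k i : ℕ} (hi : i + 1 < k - 1) :
    neighbour k R i * neighbour k R (i + 1) * neighbour k R i =
      neighbour k R (i + 1) * neighbour k R i * neighbour k R (i + 1) := by
  have hi' : i < k - 1 := by omega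
  rw [neighbour, neighbour, dif_pos hi', dif_pos hi]
  refine onSites_braid hR ?_ ?_ ?_ <;> rw [Ne, Fin.mk.injEq] <;> omega

theorem neighbour_comm (X : Matrix (Fin n × Fin n) (Fin n × Fin n) ℂ) {k i j : ℕ}
    (hij : i + 2 ≤ j) :
    neighbour k X i * neighbour k X j = neighbour k X j * neighbour k X i := by
  by_cases hj : j < k - 1
  · have hi : i < k - 1 := by omega
    rw [neighbour, neighbour, dif_pos hi, dif_pos hj]
    refine onSites_comm X ?_ ?_ ?_ ?_ ?_ ?_ <;> rw [Ne, Fin.mk.injEq] <;> omega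
  · rw [neighbour, neighbour, dif_neg hj, mul_zero, zero_mul]

theorem neighbour_hecke {q : ℂ} {R : Matrix (Fin n × Fin n) (Fin n × Fin n) ℂ}
    (hR : IsHeckeRMatrix q R) {k i : ℕ} (hi : i < k - 1) :
    (neighbour k R i - q • 1) * (neighbour k R i + q⁻¹ • 1) = 0 := by
  rw [neighbour, dif_pos hi]
  refine onSites_hecke hR ?_
  rw [Ne, Fin.mk.injEq]
  omega

theorem lift_heckeRel {q : ℂ} {R : Matrix (Fin n × Fin n) (Fin n × Fin n) ℂ}
    (hR : IsHeckeRMatrix q R) (k : ℕ) ⦃x y : FreeAlgebra ℂ (Fin (k - 1))⦄ (h : HeckeRel q k x y) :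
    FreeAlgebra.lift ℂ (fun i : Fin (k - 1) => neighbour k R i) x =
      FreeAlgebra.lift ℂ (fun i : Fin (k - 1) => neighbour k R i) y := by
  cases h with
  | braid i j h =>
    have hj := j.2
    simp only [map_mul, FreeAlgebra.lift_ι_apply, h]
    exact neighbour_braid hR (by omega)
  | comm i j h =>
    simp only [map_mul, FreeAlgebra.lift_ι_apply]
    exact neighbour_comm R h
  | quad i =>
    simp only [map_mul, map_sub, map_add, map_smul, map_one, map_zero, FreeAlgebra.lift_ι_apply]
    exact neighbour_hecke hR i.2

/-- The local representation `ρ_R : H_k(q) → End(V^{⊗k})`, `σ_i ↦ R_{i,i+1}`. -/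
def localRep {q : ℂ} {R : Matrix (Fin n × Fin n) (Fin n × Fin n) ℂ} (hR : IsHeckeRMatrix q R)
    (k : ℕ) : HeckeAlgebra q k →ₐ[ℂ] Matrix (Fin k → Fin n) (Fin k → Fin n) ℂ :=
  RingQuot.liftAlgHom ℂ
    ⟨FreeAlgebra.lift ℂ fun i : Fin (k - 1) => neighbour k R i, lift_heckeRel hR k⟩

/-- `R` has symmetry rank `p`: the image of `A^{(p+1)}` vanishes and that of `A^{(p)}` has rank
one. -/
structure HasSymmetryRank {q : ℂ} {R : Matrix (Fin n × Fin n) (Fin n × Fin n) ℂ}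
    (hR : IsHeckeRMatrix q R) (p : ℕ) : Prop where
  pos : 0 < p
  vanish : localRep hR (p + 1) (antisymmetrizer q (p + 1)) = 0
  rank_one : (localRep hR p (antisymmetrizer q p)).rank = 1

/-- `Ψ` is the skew inverse of `R`:
`∑_{a,b} R_{ia}^{jb} Ψ_{bk}^{as} = δ_i^s δ_k^j = ∑_{a,b} Ψ_{ia}^{jb} R_{bk}^{as}`. -/
structure IsSkewInverse (R Ψ : Matrix (Fin n × Fin n) (Fin n × Fin n) ℂ) : Prop where
  left : ∀ i j k s : Fin n,
    ∑ a, ∑ b, R (i, a) (j, b) * Ψ (b, k) (a, s) = if i = s ∧ k = j then 1 else 0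
  right : ∀ i j k s : Fin n,
    ∑ a, ∑ b, Ψ (i, a) (j, b) * R (b, k) (a, s) = if i = s ∧ k = j then 1 else 0

/-- `B_1 = Tr_{(2)} Ψ_{21}`. -/
def matB (Ψ : Matrix (Fin n × Fin n) (Fin n × Fin n) ℂ) : Matrix (Fin n) (Fin n) ℂ :=
  Matrix.of fun i j => ∑ a, Ψ (a, i) (a, j)

/-- `C_1 = Tr_{(2)} Ψ_{12}`. -/
def matC (Ψ : Matrix (Fin n × Fin n) (Fin n × Fin n) ℂ) : Matrix (Fin n) (Fin n) ℂ :=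
  Matrix.of fun i j => ∑ a, Ψ (i, a) (j, a)

/-! ### The modified reflection equation algebra -/

/-- The matrix of free generators `l_i^j`. -/
def freeL (n : ℕ) : Matrix (Fin n) (Fin n) (FreeAlgebra ℂ (Fin n × Fin n)) :=
  Matrix.of fun i j => FreeAlgebra.ι ℂ (i, j)

/-- `L_1 = L ⊗ I`. -/
def freeL₁ (n : ℕ) : Matrix (Fin n × Fin n) (Fin n × Fin n) (FreeAlgebra ℂ (Fin n × Fin n)) :=
  freeL n ⊗ₖ 1

/-- `R` with its entries regarded as constants of the free algebra. -/
def freeR (R : Matrix (Fin n × Fin n) (Fin n × Fin n) ℂ) :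
    Matrix (Fin n × Fin n) (Fin n × Fin n) (FreeAlgebra ℂ (Fin n × Fin n)) :=
  R.map (algebraMap ℂ _)

/-- The entries of `R L₁ R L₁ - L₁ R L₁ R = R L₁ - L₁ R`. -/
inductive MREARel (R : Matrix (Fin n × Fin n) (Fin n × Fin n) ℂ) :
    FreeAlgebra ℂ (Fin n × Fin n) → FreeAlgebra ℂ (Fin n × Fin n) → Prop
  | entry (x y : Fin n × Fin n) :
      MREARel R
        ((freeR R * freeL₁ n * freeR R * freeL₁ n - freeL₁ n * freeR R * freeL₁ n * freeR R) x y)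
        ((freeR R * freeL₁ n - freeL₁ n * freeR R) x y)

/-- The modified reflection equation algebra of `R`. -/
abbrev MREA (R : Matrix (Fin n × Fin n) (Fin n × Fin n) ℂ) : Type := RingQuot (MREARel R)

/-- The matrix `L` of generators of the algebra. -/
def genL (R : Matrix (Fin n × Fin n) (Fin n × Fin n) ℂ) : Matrix (Fin n) (Fin n) (MREA R) :=
  Matrix.of fun i j => RingQuot.mkAlgHom ℂ (MREARel R) (FreeAlgebra.ι ℂ (i, j))

/-- The quantum trace `Tr_q X = Tr (C X)`. -/
def qTrace (R Ψ : Matrix (Fin n × Fin n) (Fin n × Fin n) ℂ) (X : Matrix (Fin n) (Fin n) (MREA R)) :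
    MREA R :=
  ((matC Ψ).map (algebraMap ℂ (MREA R)) * X).trace

/-! ### Modules of `B` type -/

/-- The transposed matrix `π^t(l_i^j)` of the operator `π(l_i^j) : e_k ↦ B_k^j e_i` on `V`. -/
def piT (Ψ : Matrix (Fin n × Fin n) (Fin n × Fin n) ℂ) (i j : Fin n) : Matrix (Fin n) (Fin n) ℂ :=
  Matrix.of fun k m => if m = i then matB Ψ k j else 0

/-- `R⁻¹_s ⋯ R⁻¹_1 [π^t(l_i^j) ⊗ I^{⊗(k-1)}] R⁻¹_1 ⋯ R⁻¹_s`. -/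
def rhoTerm (R Ψ : Matrix (Fin n × Fin n) (Fin n × Fin n) ℂ) (k : ℕ) [NeZero k] (i j : Fin n) :
    ℕ → Matrix (Fin k → Fin n) (Fin k → Fin n) ℂ
  | 0 => onSite (piT Ψ i j) (0 : Fin k)
  | s + 1 => neighbour k R⁻¹ s * rhoTerm R Ψ k i j s * neighbour k R⁻¹ s

/-- The transposed matrix `ρ_k^t(l_i^j)` of the operator by which `l_i^j` acts on `V^{⊗k}`. -/
def rhoT (R Ψ : Matrix (Fin n × Fin n) (Fin n × Fin n) ℂ) (k : ℕ) [NeZero k] (i j : Fin n) :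
    Matrix (Fin k → Fin n) (Fin k → Fin n) ℂ :=
  ∑ s ∈ Finset.range k, rhoTerm R Ψ k i j s

/-- The matrix `Y_T(R) = ρ_R(Y_T)`. -/
def youngProjector {q : ℂ} {R : Matrix (Fin n × Fin n) (Fin n × Fin n) ℂ}
    (hR : IsHeckeRMatrix q R) {ν : YoungDiagram} {k : ℕ} (T : StandardTableau ν k) :
    Matrix (Fin k → Fin n) (Fin k → Fin n) ℂ :=
  localRep hR k (youngIdempotent q T)

/-- The subspace `V_T = Y_T(R) ▷ V^{⊗k}` of `V^{⊗k}`. -/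
def youngSubspace {q : ℂ} {R : Matrix (Fin n × Fin n) (Fin n × Fin n) ℂ}
    (hR : IsHeckeRMatrix q R) {ν : YoungDiagram} {k : ℕ} (T : StandardTableau ν k) :
    Submodule ℂ ((Fin k → Fin n) → ℂ) :=
  LinearMap.range (Matrix.toLin' (youngProjector hR T).transpose)

/-- `π` is the representation `π_T` of the algebra in `V_T`: the generator `l_i^j` acts
by the operator with the transposed matrix `Y_T(R) ρ_k^t(l_i^j) Y_T(R)`. -/
def IsTableauRep {q : ℂ} {R : Matrix (Fin n × Fin n) (Fin n × Fin n) ℂ}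
    (hR : IsHeckeRMatrix q R) (Ψ : Matrix (Fin n × Fin n) (Fin n × Fin n) ℂ)
    {ν : YoungDiagram} {k : ℕ} [NeZero k] (T : StandardTableau ν k)
    (π : MREA R →ₐ[ℂ] Module.End ℂ (youngSubspace hR T)) : Prop :=
  ∀ (i j : Fin n) (v : youngSubspace hR T),
    ((π (genL R i j) v : youngSubspace hR T) : (Fin k → Fin n) → ℂ) =
      Matrix.toLin' (youngProjector hR T * rhoT R Ψ k i j * youngProjector hR T).transpose v

end ReflectionEq

end

/-! Centrality. Multiplying the defining relation by R⁻¹ on both sides gives L₁(R L₁ R⁻¹) − (R⁻¹ L₁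
R)L₁ = L₁R⁻¹ − R⁻¹L₁. Under the trace over the second factor weighted by C, both inner conjugates
become Tr_q L · I and R⁻¹ becomes a scalar matrix, so the right side vanishes and every l_i^j
commutes with Tr_q L (`trace_matC_inv_mul`, `trace_matC_mul_inv`, `genL_commute_qTrace`).

Representation. The relation says that R commutes with L₁RL₁ − L₁. In V this difference is zero,
because Tr_(1) B₁R₁₂ = I. For the braided sum over the factors of V^{⊗k}, each new summand changes
the difference by something that again commutes with R (`commute_reflection_defect`). The cross
terms of neighbouring factors are under control because R commutes with B ⊗ B
(`matB_kronecker_commute`). The full sum commutes with every R_s, hence with Y, so it restricts to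
the image of Y, where it agrees with YρY.

Young idempotents. Y is a product of Lagrange polynomials in the Jucys–Murphy elements. Once
∏_{|m|<k}(J_i − q^{2m}) = 0 is known, Y is idempotent and J_i Y = q^{2c}Y with c the content of the
box i. That annihilation (`aeval_jm_nodal`) is proved in the manner of Okounkov and Vershik, by
induction on the strands. Intertwiners exchange two consecutive eigenvalues, the eigenvalue
sequences obey the local rules of content sequences, and these rules forbid two neighbouring values
from extending the same sequence (`IsContentSystem.not_adjacent`). This keeps the annihilating
polynomials squarefree.

The scalar. Summed against C, the operators of the generators on V give BC, so Tr_q L acts on V^{⊗k}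
as BC times the sum of the inverse Jucys–Murphy elements. The skew inverse gives BC = (1 − (q − q⁻¹)
Tr C) I. Taking the B-trace over the first factor in A^{(p+1)} = 0 gives q^p Tr B = p_q, and Tr B =
Tr C, whence BC = q^{-2p} I. On the image of Y the sum becomes the sum of q^{-2c} over the contents,
and each row is a geometric progression. -/

namespace ReflectionEq

/-! ### Families of Hecke generators and their Jucys–Murphy elements -/

/-- A family `σ 0, …, σ (K - 1)` satisfying the relations of the Hecke algebra with parameter
`q`. -/
structure IsHeckeFamily {A : Type*} [Ring A] [Algebra ℂ A] (q : ℂ) (K : ℕ) (σ : ℕ → A) :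
    Prop where
  quad : ∀ i, i < K → σ i * σ i = (q - q⁻¹) • σ i + 1
  braid : ∀ i, i + 1 < K → σ i * σ (i + 1) * σ i = σ (i + 1) * σ i * σ (i + 1)
  comm : ∀ i j, i + 2 ≤ j → j < K → Commute (σ i) (σ j)

/-- The elements `σ (s-1) ⋯ σ 0 * z * σ 0 ⋯ σ (s-1)`. -/
def conjTower {A : Type*} [Ring A] (σ : ℕ → A) (z : A) : ℕ → A
  | 0 => z
  | s + 1 => σ s * conjTower σ z s * σ s

theorem conjTower_succ {A : Type*} [Ring A] (σ : ℕ → A) (z : A) (s : ℕ) :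
    conjTower σ z (s + 1) = σ s * conjTower σ z s * σ s := rfl

namespace IsHeckeFamily

variable {A : Type*} [Ring A] [Algebra ℂ A] {q : ℂ} {K : ℕ} {σ : ℕ → A}

theorem map {A' : Type*} [Ring A'] [Algebra ℂ A'] (h : IsHeckeFamily q K σ) (f : A →ₐ[ℂ] A') :
    IsHeckeFamily q K fun i => f (σ i) where
  quad i hi := by simpa using congrArg f (h.quad i hi)
  braid i hi := by simpa using congrArg f (h.braid i hi)
  comm i j hij hj := (h.comm i j hij hj).map f

theorem inv_mul (h : IsHeckeFamily q K σ) {i : ℕ} (hi : i < K) :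
    (σ i - (q - q⁻¹) • 1) * σ i = 1 := by
  rw [sub_mul, h.quad i hi, smul_mul_assoc, one_mul]
  abel

/-- The inverses of the generators form a Hecke family with parameter `q⁻¹`. -/
theorem inverse (h : IsHeckeFamily q K σ) :
    IsHeckeFamily q⁻¹ K fun i => σ i - (q - q⁻¹) • 1 where
  quad i hi := by
    have := h.quad i hi
    rw [inv_inv]
    simp only [mul_sub, sub_mul, this, mul_smul_comm, smul_mul_assoc, mul_one, one_mul]
    module
  braid i hi := by
    have h1 := h.quad i (by omega)
    have h2 := h.quad (i + 1) hi
    have h3 := h.braid i hi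
    simp only [mul_sub, sub_mul, h1, h2, h3, mul_smul_comm, smul_mul_assoc, mul_one, one_mul]
    module
  comm i j hij hj :=
    ((h.comm i j hij hj).sub_left ((Commute.one_left _).smul_left _)).sub_right
      ((Commute.one_right _).smul_right _)

theorem commute_conjTower_of_lt (h : IsHeckeFamily q K σ) {z : A}
    (hz : ∀ j, 1 ≤ j → j < K → Commute (σ j) z) {i j : ℕ} (hij : i < j) (hj : j < K) :
    Commute (σ j) (conjTower σ z i) := by
  induction i with
  | zero => exact hz j hij hj
  | succ i ih =>
    have hc := (h.comm i j (by omega) hj).symm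
    exact (hc.mul_right (ih (by omega))).mul_right hc

/-- The braid relation enters in the base case: `σ j` passes through `σ (j + 1) * σ j` and becomes
`σ (j + 1)`, which commutes with the tower at height `j` and turns back into `σ j` on the other
side. -/
theorem commute_conjTower_of_gt (h : IsHeckeFamily q K σ) {z : A}
    (hz : ∀ j, 1 ≤ j → j < K → Commute (σ j) z) {i j : ℕ} (hij : j + 2 ≤ i) (hi : i ≤ K) :
    Commute (σ j) (conjTower σ z i) := by
  induction i, hij using Nat.le_induction with
  | base =>
    have hb := h.braid j (by omega)
    have hc := (h.commute_conjTower_of_lt hz (Nat.lt_succ_self j) (by omega)).eq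
    simp only [Nat.succ_eq_add_one] at hc
    simp only [conjTower, Commute, SemiconjBy]
    calc σ j * (σ (j + 1) * (σ j * conjTower σ z j * σ j) * σ (j + 1))
        = (σ j * σ (j + 1) * σ j) * conjTower σ z j * σ j * σ (j + 1) := by noncomm_ring
      _ = σ (j + 1) * σ j * (σ (j + 1) * conjTower σ z j) * σ j * σ (j + 1) := by
          rw [hb]; noncomm_ring
      _ = σ (j + 1) * σ j * conjTower σ z j * (σ (j + 1) * σ j * σ (j + 1)) := by
          rw [hc]; noncomm_ring
      _ = _ := by rw [← hb]; noncomm_ring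
  | succ i hij ih =>
    have hc := h.comm j i hij (by omega)
    exact (hc.mul_right (ih (by omega))).mul_right hc

theorem commute_conjTower_one (h : IsHeckeFamily q K σ) {z : A}
    (hz : ∀ j, 1 ≤ j → j < K → Commute (σ j) z)
    {i j : ℕ} (hij : i < j) (hj : j ≤ K) :
    Commute (conjTower σ 1 i) (conjTower σ z j) := by
  induction i with
  | zero => exact Commute.one_left _
  | succ i ih =>
    have hc := h.commute_conjTower_of_gt hz (show i + 2 ≤ j by omega) hj
    exact (hc.mul_left (ih (by omega))).mul_left hc

theorem commute_jm (h : IsHeckeFamily q K σ) {i j : ℕ} (hi : i ≤ K) (hj : j ≤ K) :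
    Commute (conjTower σ 1 i) (conjTower σ 1 j) := by
  have hz : ∀ j, 1 ≤ j → j < K → Commute (σ j) 1 := fun j _ _ => Commute.one_right _
  rcases lt_trichotomy i j with hij | rfl | hij
  · exact h.commute_conjTower_one hz hij hj
  · exact Commute.refl _
  · exact (h.commute_conjTower_one hz hij hi).symm

/-- The generators commute with the sum of the whole tower. -/
theorem commute_sum_conjTower (h : IsHeckeFamily q K σ) {z : A}
    (hz : ∀ j, 1 ≤ j → j < K → Commute (σ j) z) {j : ℕ} (hj : j < K) :
    Commute (σ j) (∑ s ∈ Finset.range (K + 1), conjTower σ z s) := by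
  -- Neither of these two levels commutes with `σ j` alone. By the quadratic relation their
  -- commutators with `σ j` cancel. All remaining levels commute with `σ j` individually.
  have hpair : Commute (σ j) (conjTower σ z j + conjTower σ z (j + 1)) := by
    have hq := h.quad j hj
    simp only [conjTower, Commute, SemiconjBy, mul_add, add_mul]
    have e1 : σ j * (σ j * conjTower σ z j * σ j) = (σ j * σ j) * conjTower σ z j * σ j := by
      noncomm_ring
    have e2 : σ j * conjTower σ z j * σ j * σ j = σ j * conjTower σ z j * (σ j * σ j) := by
      noncomm_ring
    rw [e1, e2, hq]
    simp only [add_mul, mul_add, smul_mul_assoc, mul_smul_comm, one_mul, mul_one]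
    abel
  have hsplit : ∑ s ∈ Finset.range (K + 1), conjTower σ z s =
      (conjTower σ z j + conjTower σ z (j + 1)) +
        ∑ s ∈ ((Finset.range (K + 1)).erase j).erase (j + 1), conjTower σ z s := by
    rw [add_assoc, Finset.add_sum_erase _ _ (by simp; omega),
      Finset.add_sum_erase _ _ (by simp; omega)]
  rw [hsplit]
  refine hpair.add_right (Commute.sum_right _ _ _ fun s hs => ?_)
  simp only [Finset.mem_erase, Finset.mem_range] at hs
  rcases lt_or_gt_of_ne hs.2.1 with hlt | hgt
  · exact h.commute_conjTower_of_lt hz hlt hj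
  · exact h.commute_conjTower_of_gt hz (by omega) (by omega)

end IsHeckeFamily

theorem conjTower_map {A A' : Type*} [Ring A] [Ring A'] (f : A →+* A') (σ : ℕ → A) (z : A)
    (s : ℕ) : f (conjTower σ z s) = conjTower (fun i => f (σ i)) (f z) s := by
  induction s with
  | zero => rfl
  | succ s ih => simp [conjTower, ih]

end ReflectionEq

namespace ReflectionEq

open Polynomial

/-! ### The joint spectrum of the Jucys–Murphy elements -/

section Polynomials

variable {A : Type*} [Ring A] [Algebra ℂ A]

theorem semiconj_aeval {a b φ : A} (h : a * φ = φ * b) (f : ℂ[X]) :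
    aeval a f * φ = φ * aeval b f := by
  induction f using Polynomial.induction_on' with
  | add f g hf hg => simp [add_mul, mul_add, hf, hg]
  | monomial m c =>
    have hm : a ^ m * φ = φ * b ^ m :=
      (SemiconjBy.pow_right (show SemiconjBy φ b a from h.symm) m).eq.symm
    rw [aeval_monomial, aeval_monomial, mul_assoc, hm, ← mul_assoc, ← mul_assoc,
      Algebra.commutes]

variable {M : Type*} [AddCommGroup M] [Module ℂ M]

theorem aeval_apply_of_eigen {f : Module.End ℂ M} {α : ℂ} {v : M} (h : f v = α • v)
    (P : ℂ[X]) : aeval f P v = P.eval α • v := by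
  induction P using Polynomial.induction_on' with
  | add P Q hP hQ => simp [hP, hQ, add_smul]
  | monomial m c =>
    have hm : (f ^ m) v = α ^ m • v := by
      induction m with
      | zero => simp
      | succ m ih => rw [pow_succ', Module.End.mul_apply, ih, map_smul, h, smul_smul, pow_succ]
    simp [aeval_monomial, hm, smul_smul, Module.algebraMap_end_apply, mul_comm]

theorem aeval_mem {f : Module.End ℂ M} {W : Submodule ℂ M} (hW : ∀ v ∈ W, f v ∈ W) (P : ℂ[X])
    {v : M} (hv : v ∈ W) : aeval f P v ∈ W := by
  induction P using Polynomial.induction_on' with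
  | add P Q hP hQ => simpa using W.add_mem hP hQ
  | monomial m c =>
    have hm : (f ^ m) v ∈ W := by
      induction m with
      | zero => simpa
      | succ m ih => rw [pow_succ', Module.End.mul_apply]; exact hW _ ih
    simpa [aeval_monomial, Module.algebraMap_end_apply] using W.smul_mem c hm

/-- Roots without eigenvectors can be dropped from an annihilating product. -/
theorem aeval_nodal_filter {f : Module.End ℂ M} {W : Submodule ℂ M} (hW : ∀ v ∈ W, f v ∈ W)
    {ι : Type*} [DecidableEq ι] (β : ι → ℂ) (p : ι → Prop) [DecidablePred p]
    (hp : ∀ c, ¬ p c → ∀ w ∈ W, f w = β c • w → w = 0) (Y : Finset ι) :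
    ∀ v ∈ W, aeval f (Lagrange.nodal Y β) v = 0 →
      aeval f (Lagrange.nodal (Y.filter p) β) v = 0 := by
  induction Y using Finset.induction_on with
  | empty => intro v _ h; simpa using h
  | insert c Y hc ih =>
    intro v hv h
    rw [Lagrange.nodal_insert_eq_nodal hc] at h
    by_cases hpc : p c
    · rw [Finset.filter_insert, if_pos hpc, Lagrange.nodal_insert_eq_nodal (by simp [hc])]
      rw [mul_comm, map_mul, Module.End.mul_apply] at h ⊢
      exact ih _ (aeval_mem hW _ hv) h
    · rw [Finset.filter_insert, if_neg hpc]
      refine ih v hv (hp c hpc _ (aeval_mem hW _ hv) ?_)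
      rw [map_mul, Module.End.mul_apply] at h
      simpa [sub_eq_zero, Module.algebraMap_end_apply] using h

/-- Up to a scalar, the Lagrange basis polynomial is the nodal polynomial without its factor at `c`.
Hence, wherever the nodal polynomial annihilates, the basis polynomial takes values in the
eigenspace of `β c`. -/
theorem sub_mul_basis {ι : Type*} [DecidableEq ι] {S : Finset ι} {β : ι → ℂ} {c : ι} (hc : c ∈ S) :
    ∃ t : ℂ, (X - C (β c)) * Lagrange.basis S β c = C t * Lagrange.nodal S β := by
  refine ⟨∏ j ∈ S.erase c, (β c - β j)⁻¹, ?_⟩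
  rw [Lagrange.nodal_eq_mul_nodal_erase hc, Lagrange.basis, Lagrange.nodal, map_prod]
  simp only [Lagrange.basisDivisor, Finset.prod_mul_distrib]
  ring

end Polynomials

/-! ### Joint eigenspaces and intertwiners. -/

section Spectrum

variable {M : Type*} [AddCommGroup M] [Module ℂ M]

/-- The joint eigenspace of the first `m` Jucys–Murphy elements with eigenvalues `q ^ (2 s_i)`. -/
def jmSpace (q : ℂ) (σ : ℕ → Module.End ℂ M) (s : ℕ → ℤ) (m : ℕ) : Submodule ℂ M where
  carrier := {v | ∀ i < m, conjTower σ 1 i v = q ^ (2 * s i) • v}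
  add_mem' hv hw i hi := by rw [map_add, hv i hi, hw i hi, smul_add]
  zero_mem' i _ := by simp
  smul_mem' c v hv i hi := by rw [map_smul, hv i hi, smul_comm]

theorem jmSpace_mono {q : ℂ} {σ : ℕ → Module.End ℂ M} {s : ℕ → ℤ} {m m' : ℕ} (h : m ≤ m') :
    jmSpace q σ s m' ≤ jmSpace q σ s m := fun _ hv i hi => hv i (hi.trans_le h)

theorem apply_mem_jmSpace {q : ℂ} {σ : ℕ → Module.End ℂ M} {s : ℕ → ℤ} {m : ℕ}
    {g : Module.End ℂ M} (hg : ∀ i < m, Commute (conjTower σ 1 i) g) {v : M}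
    (hv : v ∈ jmSpace q σ s m) : g v ∈ jmSpace q σ s m := by
  intro i hi
  rw [← Module.End.mul_apply, (hg i hi).eq, Module.End.mul_apply, hv i hi, map_smul]

/-- The sequence `s` of length `m` is realised by a joint eigenvector. -/
def Realised (q : ℂ) (σ : ℕ → Module.End ℂ M) (s : ℕ → ℤ) (m : ℕ) : Prop :=
  ∃ v ∈ jmSpace q σ s m, v ≠ 0

/-- The `m`-th Jucys–Murphy element is semisimple on all joint eigenspaces of the previous ones,
with eigenvalues `q ^ (2 c)`, `|c| ≤ m`. -/
def Splits (q : ℂ) (σ : ℕ → Module.End ℂ M) (m : ℕ) : Prop :=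
  ∀ s : ℕ → ℤ, ∃ Y : Finset ℤ, Y ⊆ Finset.Icc (-(m : ℤ)) m ∧
    (∀ c ∈ Y, Realised q σ (Function.update s m c) (m + 1)) ∧
    ∀ v ∈ jmSpace q σ s m,
      aeval (conjTower σ 1 m) (Lagrange.nodal Y fun c : ℤ => q ^ (2 * c)) v = 0

theorem zpow_two_mul_injective {q : ℂ} (hq0 : q ≠ 0) (hq : ∀ m : ℕ, 0 < m → q ^ m ≠ 1) :
    Function.Injective fun c : ℤ => q ^ (2 * c) := by
  have key : ∀ a b : ℤ, a < b → q ^ (2 * a) ≠ q ^ (2 * b) := by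
    intro a b hab h
    have h1 : q ^ (2 * b - 2 * a) = 1 := by
      rw [zpow_sub₀ hq0, ← h, div_self (zpow_ne_zero _ hq0)]
    obtain ⟨m, hm⟩ : ∃ m : ℕ, 2 * b - 2 * a = m := ⟨(2 * b - 2 * a).toNat, by omega⟩
    rw [hm, zpow_natCast] at h1
    exact hq m (by omega) h1
  intro a b h
  rcases lt_trichotomy a b with hab | hab | hab
  · exact absurd h (key a b hab)
  · exact hab
  · exact absurd h.symm (key b a hab)

/-- The intertwiner `σ (a - b) + (q - q⁻¹) b` exchanging two consecutive Jucys–Murphy elements. -/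
noncomputable def intertwiner (q : ℂ) {A : Type*} [Ring A] [Algebra ℂ A] (σ a b : A) : A :=
  σ * (a - b) + (q - q⁻¹) • b

section Intertwiner

variable {A : Type*} [Ring A] [Algebra ℂ A] {q : ℂ} {σ a b : A}

theorem mul_gen_of_hecke (hσ : σ * σ = (q - q⁻¹) • σ + 1) (hb : b = σ * a * σ) :
    σ * b = a * σ + (q - q⁻¹) • b := by
  have : σ * b = (σ * σ) * a * σ := by rw [hb]; noncomm_ring
  rw [this, hσ, hb]
  simp only [add_mul, smul_mul_assoc, one_mul]
  abel

theorem gen_mul_of_hecke (hσ : σ * σ = (q - q⁻¹) • σ + 1) (hb : b = σ * a * σ) :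
    b * σ = σ * a + (q - q⁻¹) • b := by
  have : b * σ = σ * a * (σ * σ) := by rw [hb]; noncomm_ring
  rw [this, hσ, hb]
  simp only [mul_add, mul_smul_comm, mul_one]
  abel

theorem mul_intertwiner (hσ : σ * σ = (q - q⁻¹) • σ + 1) (hb : b = σ * a * σ)
    (hab : Commute a b) : a * intertwiner q σ a b = intertwiner q σ a b * b := by
  have h1 : a * σ = σ * b - (q - q⁻¹) • b := by rw [mul_gen_of_hecke hσ hb]; abel
  have hba : b * a = a * b := hab.eq.symm
  rw [intertwiner, mul_add, ← mul_assoc, h1]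
  simp only [mul_sub, sub_mul, add_mul, smul_mul_assoc, mul_smul_comm, mul_assoc, hba]
  abel

theorem mul_intertwiner' (hσ : σ * σ = (q - q⁻¹) • σ + 1) (hb : b = σ * a * σ)
    (hab : Commute a b) : b * intertwiner q σ a b = intertwiner q σ a b * a := by
  rw [intertwiner, mul_add, ← mul_assoc, gen_mul_of_hecke hσ hb]
  simp only [mul_sub, sub_mul, add_mul, smul_mul_assoc, mul_smul_comm, mul_assoc, hab.eq]
  abel

/-- Since `a` and `b` are exchanged by the intertwiner, its square commutes with both and is a
quadratic form in them. It degenerates on joint eigenvectors only for a = q^{±2} b, that is for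
contents differing by one, so the intertwiner kills no joint eigenvector with contents further
apart. -/
theorem intertwiner_mul_self (hq0 : q ≠ 0) (hσ : σ * σ = (q - q⁻¹) • σ + 1) (hb : b = σ * a * σ)
    (hab : Commute a b) : intertwiner q σ a b * intertwiner q σ a b =
      -((a - q ^ 2 • b) * (a - (q⁻¹) ^ 2 • b)) := by
  have h1 := mul_gen_of_hecke hσ hb
  have h2 : intertwiner q σ a b * intertwiner q σ a b =
      σ * (σ * (a - b)) * (b - a) + (q - q⁻¹) • (σ * b * (b - a)) +
        (q - q⁻¹) • (intertwiner q σ a b * a) := by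
    have e : intertwiner q σ a b * intertwiner q σ a b =
        σ * (a * intertwiner q σ a b - b * intertwiner q σ a b) +
          (q - q⁻¹) • (b * intertwiner q σ a b) := by
      nth_rewrite 1 [intertwiner]
      simp only [add_mul, mul_assoc, sub_mul, smul_mul_assoc]
    rw [e, mul_intertwiner hσ hb hab, mul_intertwiner' hσ hb hab, ← mul_sub]
    congr 1
    rw [intertwiner]
    simp only [add_mul, mul_add, mul_assoc, smul_mul_assoc, mul_smul_comm]
  have h3 : (q - q⁻¹) * (q - q⁻¹) = q ^ 2 + (q⁻¹) ^ 2 - 2 := by field_simp; ring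
  rw [h2, intertwiner]
  have e2 : σ * (σ * (a - b)) = (q - q⁻¹) • (σ * (a - b)) + (a - b) := by
    rw [← mul_assoc, hσ, add_mul, smul_mul_assoc, one_mul]
  rw [e2]
  have hba : b * a = a * b := hab.eq.symm
  simp only [mul_sub, sub_mul, add_mul, smul_mul_assoc, mul_smul_comm, mul_assoc, hba,
    smul_sub, smul_add, smul_smul, h3, neg_sub]
  match_scalars <;> field_simp <;> ring

end Intertwiner

end Spectrum

end ReflectionEq

/-! ### Combinatorics of content sequences. -/

namespace ReflectionEq

/-- The local rules obeyed by the content sequences of length `m + 1` of standard tableaux. -/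
structure IsContentSystem (m : ℕ) (Val : (ℕ → ℤ) → Prop) : Prop where
  zero : ∀ s, Val s → s 0 = 0
  ne : ∀ s i, Val s → i + 1 ≤ m → s i ≠ s (i + 1)
  braid : ∀ s i, Val s → i + 2 ≤ m → s i = s (i + 2) → s (i + 1) ≠ s i + 1 ∧ s (i + 1) ≠ s i - 1
  swap : ∀ s i, Val s → i + 1 ≤ m → 2 ≤ |s i - s (i + 1)| → Val (s ∘ Equiv.swap i (i + 1))

namespace IsContentSystem

variable {m : ℕ} {Val : (ℕ → ℤ) → Prop}

theorem swap_apply_of_ne {s : ℕ → ℤ} {i j : ℕ} (h1 : j ≠ i) (h2 : j ≠ i + 1) :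
    (s ∘ Equiv.swap i (i + 1)) j = s j := by
  rw [Function.comp_apply, Equiv.swap_apply_of_ne_of_ne h1 h2]

/-- Between two equal entries both neighbouring values occur. -/
theorem exists_between (h : IsContentSystem m Val) {ε : ℤ} (hε : ε = 1 ∨ ε = -1) (d : ℕ) :
    ∀ (s : ℕ → ℤ) (p r : ℕ), Val s → r ≤ m → p < r → r - p = d → s p = s r →
      ∃ j, p < j ∧ j < r ∧ s j = s p + ε := by
  induction d using Nat.strong_induction_on with
  | _ d ih =>
    intro s p r hs hr hpr hd heq
    by_contra hno
    push Not at hno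
    obtain ⟨r, rfl⟩ : ∃ r', r = r' + 1 := ⟨r - 1, by omega⟩
    have hpr1 : p < r := by
      rcases Nat.lt_succ_iff_lt_or_eq.mp hpr with hlt | rfl
      · exact hlt
      · exact absurd heq (h.ne s p hs hr)
    have hr0 := h.ne s r hs hr
    have hp0 := h.ne s p hs (by omega)
    have hsr := hno r hpr1 (Nat.lt_succ_self r)
    have hsp := hno (p + 1) (by omega) (by omega)
    -- If the value before the right end is not a neighbour of the common value, a swap moves the
    -- right end one step left and the induction hypothesis applies. The value `s p + ε` is excluded
    -- by assumption, so `s p - ε` remains. The left end is treated symmetrically.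
    have hr1 : s r = s p - ε := by
      by_contra hne
      have hab : 2 ≤ |s r - s (r + 1)| := by
        rw [le_abs]; omega
      obtain ⟨j, h1, h2, h3⟩ := ih (r - p) (by omega) _ p r (h.swap s r hs hr hab) (by omega)
        hpr1 rfl (by
          rw [swap_apply_of_ne (by omega) (by omega), Function.comp_apply,
            Equiv.swap_apply_left, heq])
      rw [swap_apply_of_ne (by omega) (by omega), swap_apply_of_ne (by omega) (by omega)] at h3
      exact hno j h1 (by omega) h3
    have hp1 : s (p + 1) = s p - ε := by
      by_contra hne
      have hab : 2 ≤ |s p - s (p + 1)| := by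
        rw [le_abs]; omega
      rcases Nat.lt_or_ge (p + 1) r with hlt | hge
      · obtain ⟨j, h1, h2, h3⟩ := ih (r - p) (by omega) _ (p + 1) (r + 1)
          (h.swap s p hs (by omega) hab) (by omega) (by omega) (by omega) (by
            rw [swap_apply_of_ne (j := r + 1) (by omega) (by omega), Function.comp_apply,
              Equiv.swap_apply_right, heq])
        rw [swap_apply_of_ne (by omega) (by omega), Function.comp_apply,
          Equiv.swap_apply_right] at h3
        exact hno j (by omega) h2 h3
      · obtain rfl : r = p + 1 := by omega
        exact hne hr1
    -- Both inner neighbours now equal `s p - ε`. If they are distinct positions, induction finds `s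
    -- p` strictly between them, and a second use on the shorter interval from `p` finds `s p + ε`.
    -- If they coincide, the pattern c, c − ε, c contradicts the rule `braid`.
    rcases Nat.lt_or_ge (p + 1) r with hlt | hge
    · obtain ⟨j, h1, h2, h3⟩ := ih (r - (p + 1)) (by omega) s (p + 1) r hs (by omega) hlt rfl
        (by rw [hp1, hr1])
      obtain ⟨j', h1', h2', h3'⟩ := ih (j - p) (by omega) s p j hs (by omega) (by omega) rfl
        (by omega)
      exact hno j' h1' (by omega) h3'
    · obtain rfl : r = p + 1 := by omega
      have := h.braid s p hs hr heq
      omega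

/-- An entry is preceded by its neighbour in the direction of zero. -/
theorem exists_before (h : IsContentSystem m Val) {ε : ℤ} (hε : ε = 1 ∨ ε = -1) (r : ℕ) :
    ∀ s : ℕ → ℤ, Val s → r ≤ m → 0 < ε * s r → ∃ j < r, s j = s r - ε := by
  induction r using Nat.strong_induction_on with
  | _ r ih =>
    intro s hs hr hpos
    obtain _ | r := r
    · rw [h.zero s hs] at hpos
      omega
    have hr0 := h.ne s r hs hr
    by_cases h1 : s r = s (r + 1) - ε
    · exact ⟨r, Nat.lt_succ_self r, h1⟩
    by_cases h2 : s r = s (r + 1) + ε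
    · obtain ⟨j, hj, hj'⟩ := ih r (Nat.lt_succ_self r) s hs (by omega) (by
        rcases hε with rfl | rfl <;> omega)
      obtain ⟨i, hi, hi'⟩ := ih j (by omega) s hs (by omega) (by
        rcases hε with rfl | rfl <;> omega)
      exact ⟨i, by omega, by omega⟩
    · have hab : 2 ≤ |s r - s (r + 1)| := by
        rw [le_abs]; omega
      have e : (s ∘ Equiv.swap r (r + 1)) r = s (r + 1) := by
        rw [Function.comp_apply, Equiv.swap_apply_left]
      obtain ⟨j, hj, hj'⟩ := ih r (Nat.lt_succ_self r) _ (h.swap s r hs hr hab) (by omega)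
        (by rwa [e])
      rw [e, swap_apply_of_ne (by omega) (by omega)] at hj'
      exact ⟨j, by omega, hj'⟩

/-- A sequence does not extend by two neighbouring values. -/
theorem not_adjacent (h : IsContentSystem m Val) {s s' : ℕ → ℤ} (hs : Val s) (hs' : Val s')
    (hss : ∀ i < m, s i = s' i) : s' m ≠ s m + 1 := by
  intro hadj
  -- Of the two competing last values, the one further from zero has its neighbour towards zero
  -- earlier in the common part, and that neighbour is the other value.
  have hex : ∃ j < m, s j = s m ∨ s j = s m + 1 := by
    rcases lt_or_ge (s m) 0 with hneg | hpos
    · obtain ⟨j, hj, hj'⟩ := h.exists_before (Or.inr rfl) m s hs le_rfl (by omega)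
      exact ⟨j, hj, Or.inr (by omega)⟩
    · obtain ⟨j, hj, hj'⟩ := h.exists_before (Or.inl rfl) m s' hs' le_rfl (by omega)
      exact ⟨j, hj, Or.inl (by have := hss j hj; omega)⟩
  classical
  -- Let `j` be the last earlier position carrying one of the two values. Ending the sequence with
  -- the same value as at `j` gives a pair of equal entries, between which the other value must
  -- occur. This contradicts the choice of `j`.
  obtain ⟨j, hj, hmax⟩ := ((Finset.range m).filter
    fun j => s j = s m ∨ s j = s m + 1).exists_max_image id (by
      obtain ⟨j, hj, hj'⟩ := hex
      exact ⟨j, by simp [hj, hj']⟩)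
  simp only [Finset.mem_filter, Finset.mem_range, id, and_imp] at hj hmax
  obtain ⟨hjm, hj | hj⟩ := hj
  · obtain ⟨i, h1, h2, h3⟩ := h.exists_between (Or.inl rfl) _ s j m hs le_rfl hjm rfl hj
    have := hmax i h2 (Or.inr (by omega))
    omega
  · have := hss j hjm
    obtain ⟨i, h1, h2, h3⟩ := h.exists_between (Or.inr rfl) _ s' j m hs' le_rfl hjm rfl (by omega)
    have := hss i h2
    have := hmax i h2 (Or.inl (by omega))
    omega

end IsContentSystem

theorem zpow_two_mul_add_one {q : ℂ} (hq0 : q ≠ 0) (c : ℤ) :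
    q ^ (2 * (c + 1)) = q ^ 2 * q ^ (2 * c) := by
  rw [mul_add, zpow_add₀ hq0, mul_comm]; norm_cast

theorem zpow_two_mul_sub_one {q : ℂ} (hq0 : q ≠ 0) (c : ℤ) :
    q ^ (2 * (c - 1)) = (q⁻¹) ^ 2 * q ^ (2 * c) := by
  rw [mul_sub, zpow_sub₀ hq0, div_eq_mul_inv, mul_comm, inv_pow]; norm_cast

/-! ### Local rules for the realised eigenvalue sequences. -/

section Spectrum

open Polynomial

variable {M : Type*} [AddCommGroup M] [Module ℂ M] {q : ℂ} {K : ℕ} {σ : ℕ → Module.End ℂ M}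

theorem eq_smul_of_smul_add_smul_eq_zero {c d : ℂ} {w v : M} (hc : c ≠ 0)
    (h : c • w + d • v = 0) : w = (-d / c) • v := by
  have h1 : c • w = (-d) • v := by rw [neg_smul]; exact eq_neg_of_add_eq_zero_left h
  rw [div_eq_inv_mul, mul_smul, ← h1, smul_smul, inv_mul_cancel₀ hc, one_smul]

theorem intertwiner_apply {g a b : Module.End ℂ M} {α β : ℂ} {v : M} (ha : a v = α • v)
    (hb : b v = β • v) :
    intertwiner q g a b v = (α - β) • g v + ((q - q⁻¹) * β) • v := by
  simp only [intertwiner, LinearMap.add_apply, Module.End.mul_apply, LinearMap.sub_apply,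
    LinearMap.smul_apply, ha, hb, map_sub, map_smul, smul_smul]
  module

theorem commute_one_hyp (σ : ℕ → Module.End ℂ M) (K : ℕ) :
    ∀ j, 1 ≤ j → j < K → Commute (σ j) (1 : Module.End ℂ M) := fun _ _ _ => Commute.one_right _

theorem intertwiner_mem (hσ : IsHeckeFamily q K σ) {s : ℕ → ℤ} {m i : ℕ} (hm : m ≤ K + 1)
    (hi : i + 1 < m) {v : M} (hv : v ∈ jmSpace q σ s m) :
    intertwiner q (σ i) (conjTower σ 1 i) (conjTower σ 1 (i + 1)) v ∈
      jmSpace q σ (s ∘ Equiv.swap i (i + 1)) m := by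
  have hab := hσ.commute_jm (show i ≤ K by omega) (show i + 1 ≤ K by omega)
  intro j hj
  by_cases h1 : j = i
  · subst h1
    rw [← Module.End.mul_apply, mul_intertwiner (hσ.quad j (by omega)) (conjTower_succ _ _ _) hab,
      Module.End.mul_apply, hv _ hi, map_smul, Function.comp_apply, Equiv.swap_apply_left]
  by_cases h2 : j = i + 1
  · subst h2
    rw [← Module.End.mul_apply, mul_intertwiner' (hσ.quad i (by omega)) (conjTower_succ _ _ _) hab,
      Module.End.mul_apply, hv i (by omega), map_smul, Function.comp_apply,
      Equiv.swap_apply_right]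
  · rw [IsContentSystem.swap_apply_of_ne h1 h2]
    have c1 : Commute (conjTower σ 1 j) (σ i) := by
      rcases lt_or_gt_of_ne h1 with hlt | hgt
      · exact (hσ.commute_conjTower_of_lt (commute_one_hyp σ K) hlt (by omega)).symm
      · exact (hσ.commute_conjTower_of_gt (commute_one_hyp σ K) (by omega) (by omega)).symm
    have ca := hσ.commute_jm (show j ≤ K by omega) (show i ≤ K by omega)
    have cb := hσ.commute_jm (show j ≤ K by omega) (show i + 1 ≤ K by omega)
    have c : Commute (conjTower σ 1 j)
        (intertwiner q (σ i) (conjTower σ 1 i) (conjTower σ 1 (i + 1))) :=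
      (c1.mul_right (ca.sub_right cb)).add_right (cb.smul_right _)
    rw [← Module.End.mul_apply, c.eq, Module.End.mul_apply, hv j hj, map_smul]

/-- With equal eigenvalues α, the Hecke relation makes `v` and `σ i v` a Jordan block: the
Jucys–Murphy element minus α sends `σ i v` to a nonzero multiple of `v`. This contradicts the
squarefree annihilating polynomial supplied by `Splits` at level `i`. -/
theorem Realised.ne (hq0 : q ≠ 0) (hq : ∀ m : ℕ, 0 < m → q ^ m ≠ 1) (hσ : IsHeckeFamily q K σ)
    {s : ℕ → ℤ} {m i : ℕ} (hm : m ≤ K + 1)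
    (hi : i + 1 < m) (hS : Splits q σ i) (hs : Realised q σ s m) : s i ≠ s (i + 1) := by
  intro heq
  obtain ⟨v, hv, hv0⟩ := hs
  obtain ⟨Y, -, -, hY⟩ := hS s
  have hvi := jmSpace_mono (show i ≤ m by omega) hv
  have hmem : s i ∈ Y := by
    have h := hY v hvi
    rw [aeval_apply_of_eigen (hv i (by omega)), smul_eq_zero, or_iff_left hv0,
      Lagrange.eval_nodal, Finset.prod_eq_zero_iff] at h
    obtain ⟨c, hc, hc'⟩ := h
    rwa [zpow_two_mul_injective hq0 hq (sub_eq_zero.mp hc')]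
  have hσv : σ i v ∈ jmSpace q σ s i := apply_mem_jmSpace (fun j hj =>
    (hσ.commute_conjTower_of_lt (commute_one_hyp σ K) hj (by omega)).symm) hvi
  have h0 := hY _ hσv
  rw [Lagrange.nodal_eq_mul_nodal_erase hmem, mul_comm, map_mul, Module.End.mul_apply] at h0
  have h1 : aeval (conjTower σ 1 i) (X - C (q ^ (2 * s i))) (σ i v) =
      (-((q - q⁻¹) * q ^ (2 * s i))) • v := by
    have h2 : conjTower σ 1 i * σ i = σ i * conjTower σ 1 (i + 1) -
        (q - q⁻¹) • conjTower σ 1 (i + 1) := by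
      rw [mul_gen_of_hecke (hσ.quad i (by omega)) (b := conjTower σ 1 (i + 1)) rfl]
      abel
    rw [map_sub, aeval_X, aeval_C, LinearMap.sub_apply, Module.algebraMap_end_apply,
      ← Module.End.mul_apply, h2, LinearMap.sub_apply, Module.End.mul_apply, LinearMap.smul_apply,
      hv _ hi, ← heq, map_smul, smul_smul, neg_smul]
    abel
  rw [h1, map_smul, aeval_apply_of_eigen (hv i (by omega)), smul_smul, smul_eq_zero,
    or_iff_left hv0, mul_eq_zero, neg_eq_zero, mul_eq_zero, Lagrange.eval_nodal,
    Finset.prod_eq_zero_iff] at h0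
  rcases h0 with (h0 | h0) | ⟨c, hc, h0⟩
  · have : q ^ 2 = 1 := by
      rw [sub_eq_zero] at h0
      rw [pow_two]
      nth_rewrite 1 [h0]
      exact inv_mul_cancel₀ hq0
    exact hq 2 (by omega) this
  · exact zpow_ne_zero _ hq0 h0
  · rw [Finset.mem_erase] at hc
    exact hc.1 (zpow_two_mul_injective hq0 hq (sub_eq_zero.mp h0)).symm

/-- The intertwiner transports `v` to the swapped sequence. The image is nonzero because the square
of the intertwiner multiplies `v` by a scalar that vanishes only for contents differing by one. -/
theorem Realised.swap (hq0 : q ≠ 0) (hq : ∀ m : ℕ, 0 < m → q ^ m ≠ 1) (hσ : IsHeckeFamily q K σ)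
    {s : ℕ → ℤ} {m i : ℕ} (hm : m ≤ K + 1) (hi : i + 1 < m) (hs : Realised q σ s m)
    (h2 : 2 ≤ |s i - s (i + 1)|) : Realised q σ (s ∘ Equiv.swap i (i + 1)) m := by
  obtain ⟨v, hv, hv0⟩ := hs
  refine ⟨_, intertwiner_mem hσ hm hi hv, fun h0 => ?_⟩
  have hab := hσ.commute_jm (show i ≤ K by omega) (show i + 1 ≤ K by omega)
  have h3 := congrArg (fun w =>
    intertwiner q (σ i) (conjTower σ 1 i) (conjTower σ 1 (i + 1)) w) h0
  rw [map_zero, ← Module.End.mul_apply,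
    intertwiner_mul_self hq0 (hσ.quad i (by omega)) (conjTower_succ _ _ _) hab] at h3
  simp only [LinearMap.neg_apply, Module.End.mul_apply, LinearMap.sub_apply, LinearMap.smul_apply,
    hv i (by omega), hv _ hi, map_sub, map_smul, neg_eq_zero] at h3
  have h4 : ((q ^ (2 * s i) - q ^ 2 * q ^ (2 * s (i + 1))) *
      (q ^ (2 * s i) - (q⁻¹) ^ 2 * q ^ (2 * s (i + 1)))) • v = 0 := by
    rw [← h3]
    module
  rw [smul_eq_zero, or_iff_left hv0, mul_eq_zero] at h4
  have e1 : q ^ 2 * q ^ (2 * s (i + 1)) = q ^ (2 * (s (i + 1) + 1)) :=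
    (zpow_two_mul_add_one hq0 _).symm
  have e2 : (q⁻¹) ^ 2 * q ^ (2 * s (i + 1)) = q ^ (2 * (s (i + 1) - 1)) :=
    (zpow_two_mul_sub_one hq0 _).symm
  rw [e1, e2, sub_eq_zero, sub_eq_zero] at h4
  rw [le_abs] at h2
  rcases h4 with h4 | h4
  · have := zpow_two_mul_injective hq0 hq h4
    omega
  · have := zpow_two_mul_injective hq0 hq h4
    omega

/-- Either intertwiner applied to `v` would produce a joint eigenvector with two equal consecutive
values, which `Realised.ne` forbids, so both kill `v`. Then `v` is a common eigenvector of `σ i` and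
`σ (i + 1)`, and the braid relation forces their eigenvalues to agree. -/
theorem Realised.braid (hq0 : q ≠ 0) (hq : ∀ m : ℕ, 0 < m → q ^ m ≠ 1)
    (hσ : IsHeckeFamily q K σ) {s : ℕ → ℤ} {m i : ℕ} (hm : m ≤ K + 1) (hi : i + 2 < m)
    (hS : ∀ j ≤ i + 1, Splits q σ j) (hs : Realised q σ s m) (heq : s i = s (i + 2)) :
    s (i + 1) ≠ s i + 1 ∧ s (i + 1) ≠ s i - 1 := by
  have key : s (i + 1) = s i + 1 ∨ s (i + 1) = s i - 1 → False := by
    intro hor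
    obtain ⟨v, hv, hv0⟩ := hs
    have hne := Realised.ne hq0 hq hσ hm (i := i) (by omega) (hS i (by omega)) ⟨v, hv, hv0⟩
    set α := q ^ (2 * s i) with hα
    set β := q ^ (2 * s (i + 1)) with hβ
    have hαβ : α - β ≠ 0 := fun h =>
      hne (zpow_two_mul_injective hq0 hq (sub_eq_zero.mp h))
    have hβα : β - α ≠ 0 := fun h => hαβ (by rw [← neg_sub, h, neg_zero])
    have ha : conjTower σ 1 i v = α • v := hv i (by omega)
    have hb : conjTower σ 1 (i + 1) v = β • v := hv (i + 1) (by omega)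
    have hc : conjTower σ 1 (i + 2) v = α • v := by rw [hα, heq]; exact hv (i + 2) hi
    have h1 : intertwiner q (σ i) (conjTower σ 1 i) (conjTower σ 1 (i + 1)) v = 0 := by
      by_contra hne0
      refine Realised.ne hq0 hq hσ hm (i := i + 1) (by omega) (hS _ le_rfl)
        ⟨_, intertwiner_mem hσ hm (by omega) hv, hne0⟩ ?_
      rw [IsContentSystem.swap_apply_of_ne (j := i + 1 + 1) (by omega) (by omega),
        Function.comp_apply, Equiv.swap_apply_right]
      exact heq
    have h2 : intertwiner q (σ (i + 1)) (conjTower σ 1 (i + 1)) (conjTower σ 1 (i + 2)) v = 0 := by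
      by_contra hne0
      refine Realised.ne hq0 hq hσ hm (i := i) (by omega) (hS _ (by omega))
        ⟨_, intertwiner_mem hσ hm (by omega) hv, hne0⟩ ?_
      rw [IsContentSystem.swap_apply_of_ne (j := i) (by omega) (by omega),
        Function.comp_apply, Equiv.swap_apply_left]
      exact heq
    rw [intertwiner_apply ha hb] at h1
    rw [intertwiner_apply hb hc] at h2
    set lam := q - q⁻¹ with hlam
    have hlam0 : lam ≠ 0 := by
      intro h0
      rw [hlam, sub_eq_zero] at h0
      refine hq 2 (by omega) ?_
      rw [pow_two]
      nth_rewrite 1 [h0]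
      exact inv_mul_cancel₀ hq0
    have hα0 : α ≠ 0 := zpow_ne_zero _ hq0
    have hβ0 : β ≠ 0 := zpow_ne_zero _ hq0
    have g1 : σ i v = (-(lam * β) / (α - β)) • v :=
      eq_smul_of_smul_add_smul_eq_zero hαβ h1
    have g2 : σ (i + 1) v = (-(lam * α) / (β - α)) • v :=
      eq_smul_of_smul_add_smul_eq_zero hβα h2
    have hbr := congrArg (fun g : Module.End ℂ M => g v) (hσ.braid i (by omega))
    simp only [Module.End.mul_apply, g1, g2, map_smul, smul_smul] at hbr
    have hbr' := sub_eq_zero.mpr hbr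
    rw [← sub_smul, smul_eq_zero, or_iff_left hv0] at hbr'
    -- For nonzero eigenvalues x, y of the two generators the braid relation xyx = yxy means x = y.
    -- With x = λβ/(β − α) and y = −λα/(β − α), this is α + β = 0. Together with β = q^{±2}α it
    -- yields q⁴ = 1.
    have hsum : β = -α := by
      rw [← neg_sub β α] at hbr'
      field_simp at hbr'
      have h5 : lam ^ 3 * α * β * (α + β) = 0 := by linear_combination -hbr'
      simp only [mul_eq_zero, pow_eq_zero_iff, hlam0, hα0, hβ0, ne_eq, OfNat.ofNat_ne_zero,
        not_false_eq_true, false_or] at h5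
      linear_combination h5
    have h4 : q ^ 4 = 1 := by
      rcases hor with h | h
      · have e : β = α * q ^ 2 := by
          rw [hβ, hα, h, mul_add, zpow_add₀ hq0]; norm_cast
        have : q ^ 2 = -1 := mul_left_cancel₀ hα0 (by rw [← e, hsum]; ring)
        linear_combination (q ^ 2 - 1) * this
      · have e : α = β * q ^ 2 := by
          rw [hβ, hα, h, mul_sub, zpow_sub₀ hq0, mul_one]
          field_simp
        have : q ^ 2 = -1 := mul_left_cancel₀ hβ0 (by rw [← e, hsum]; ring)
        linear_combination (q ^ 2 - 1) * this
    exact hq 4 (by omega) h4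
  exact ⟨fun h => key (Or.inl h), fun h => key (Or.inr h)⟩

end Spectrum

end ReflectionEq

namespace ReflectionEq

/-! ### Semisimplicity of the Jucys–Murphy elements. -/

section Spectrum

open Polynomial

variable {M : Type*} [AddCommGroup M] [Module ℂ M] {q : ℂ} {K : ℕ} {σ : ℕ → Module.End ℂ M}

theorem isContentSystem_realised (hq0 : q ≠ 0) (hq : ∀ m : ℕ, 0 < m → q ^ m ≠ 1)
    (hσ : IsHeckeFamily q K σ) {m : ℕ} (hm : m ≤ K) (hS : ∀ j < m, Splits q σ j) :
    IsContentSystem m fun s => Realised q σ s (m + 1) where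
  zero s hs := by
    obtain ⟨v, hv, hv0⟩ := hs
    have h : (1 : Module.End ℂ M) v = q ^ (2 * s 0) • v := hv 0 (by omega)
    rw [Module.End.one_apply, eq_comm, ← sub_eq_zero] at h
    nth_rewrite 2 [← one_smul ℂ v] at h
    rw [← sub_smul, smul_eq_zero, or_iff_left hv0, sub_eq_zero] at h
    exact zpow_two_mul_injective hq0 hq (by simpa using h)
  ne s i hs hi := hs.ne hq0 hq hσ (by omega) (by omega) (hS i (by omega))
  braid s i hs hi heq :=
    hs.braid hq0 hq hσ (by omega) (by omega) (fun j hj => hS j (by omega)) heq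
  swap s i hs hi h2 := hs.swap hq0 hq hσ (by omega) (by omega) h2

theorem splits_zero (q : ℂ) (σ : ℕ → Module.End ℂ M) : Splits q σ 0 := by
  intro s
  by_cases hM : ∃ v : M, v ≠ 0
  · obtain ⟨w, hw⟩ := hM
    refine ⟨{0}, by simp, fun c hc => ?_, fun v _ => ?_⟩
    · rw [Finset.mem_singleton] at hc
      subst hc
      refine ⟨w, fun i hi => ?_, hw⟩
      obtain rfl : i = 0 := by omega
      simp [conjTower]
    · simp [Lagrange.nodal, conjTower]
  · push Not at hM
    exact ⟨∅, by simp, by simp, fun v _ => hM _⟩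

/-- Let P be the annihilating polynomial of a = J_m, on the joint eigenspace of the elements before
it, and let b = J_{m+1} (counting from zero). Since aφ = φb, the vector w = P(b)v satisfies φw =
P(a)φv = 0, and φ²w = 0 becomes a quadratic equation for b on w whose roots are the neighbours
q^{±2} of the eigenvalue of a. So b is annihilated by P times two linear factors. The point is that
these are not already factors of P, by `not_adjacent`. -/
theorem Splits.succ (hq0 : q ≠ 0) (hq : ∀ m : ℕ, 0 < m → q ^ m ≠ 1)
    (hσ : IsHeckeFamily q K σ) {m : ℕ} (hm : m + 1 ≤ K) (hS : ∀ j ≤ m, Splits q σ j) :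
    Splits q σ (m + 1) := by
  classical
  intro s
  by_cases htriv : ∀ v ∈ jmSpace q σ s (m + 1), v = 0
  · exact ⟨∅, by simp, by simp, fun v hv => by rw [htriv v hv, map_zero]⟩
  push Not at htriv
  obtain ⟨u, hu, hu0⟩ := htriv
  obtain ⟨Y, hYsub, hYreal, hY⟩ := hS m le_rfl s
  have hmem : s m ∈ Y := by
    have h := hY u (jmSpace_mono (Nat.le_succ m) hu)
    rw [aeval_apply_of_eigen (hu m (Nat.lt_succ_self m)), smul_eq_zero, or_iff_left hu0,
      Lagrange.eval_nodal, Finset.prod_eq_zero_iff] at h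
    obtain ⟨c, hc, hc'⟩ := h
    rwa [zpow_two_mul_injective hq0 hq (sub_eq_zero.mp hc')]
  have hsys := isContentSystem_realised hq0 hq hσ (show m ≤ K by omega) fun j hj => hS j hj.le
  have hs : Realised q σ s (m + 1) := ⟨u, hu, hu0⟩
  have hupd : ∀ c : ℤ, ∀ i < m, s i = Function.update s m c i := fun c i hi => by
    rw [Function.update_of_ne (by omega)]
  have hplus : s m + 1 ∉ Y := fun h =>
    hsys.not_adjacent hs (hYreal _ h) (hupd _) (by rw [Function.update_self])
  have hminus : s m - 1 ∉ Y := fun h =>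
    hsys.not_adjacent (hYreal _ h) hs (fun i hi => (hupd _ i hi).symm) (by
      rw [Function.update_self]; ring)
  set a := conjTower σ 1 m with ha
  set b := conjTower σ 1 (m + 1) with hb
  have hab : Commute a b := hσ.commute_jm (by omega) hm
  set φ := intertwiner q (σ m) a b with hφ
  set β : ℤ → ℂ := fun c => q ^ (2 * c) with hβ
  have hint : a * φ = φ * b := mul_intertwiner (hσ.quad m (by omega)) (conjTower_succ σ 1 m) hab
  have hsq : φ * φ = -((a - q ^ 2 • b) * (a - (q⁻¹) ^ 2 • b)) :=
    intertwiner_mul_self hq0 (hσ.quad m (by omega)) (conjTower_succ σ 1 m) hab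
  have hstab : ∀ v ∈ jmSpace q σ s (m + 1), b v ∈ jmSpace q σ s (m + 1) := fun v hv =>
    apply_mem_jmSpace (fun i hi => hσ.commute_jm (by omega) hm) hv
  have hkill : ∀ v ∈ jmSpace q σ s (m + 1),
      aeval b (Lagrange.nodal (insert (s m + 1) (insert (s m - 1) Y)) β) v = 0 := by
    intro v hv
    have hφv : φ v ∈ jmSpace q σ s m := by
      refine apply_mem_jmSpace (fun i hi => ?_) (jmSpace_mono (Nat.le_succ m) hv)
      have c1 : Commute (conjTower σ 1 i) (σ m) :=
        (hσ.commute_conjTower_of_lt (commute_one_hyp σ K) hi (by omega)).symm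
      have ca : Commute (conjTower σ 1 i) a := hσ.commute_jm (by omega) (by omega)
      have cb : Commute (conjTower σ 1 i) b := hσ.commute_jm (by omega) hm
      exact (c1.mul_right (ca.sub_right cb)).add_right (cb.smul_right _)
    have h1 := hY _ hφv
    rw [← Module.End.mul_apply, semiconj_aeval hint, Module.End.mul_apply] at h1
    set w := aeval b (Lagrange.nodal Y β) v with hw
    have hwmem : w ∈ jmSpace q σ s (m + 1) := aeval_mem hstab _ hv
    have h2 : (φ * φ) w = 0 := by rw [Module.End.mul_apply, h1, map_zero]
    have haw : a w = q ^ (2 * s m) • w := hwmem m (Nat.lt_succ_self m)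
    have habw : a (b w) = q ^ (2 * s m) • b w := (hstab w hwmem) m (Nat.lt_succ_self m)
    rw [hsq] at h2
    simp only [LinearMap.neg_apply, Module.End.mul_apply, LinearMap.sub_apply,
      LinearMap.smul_apply, map_sub, map_smul, haw, habw, neg_eq_zero] at h2
    rw [Lagrange.nodal_insert_eq_nodal (by simp [hplus]; omega),
      Lagrange.nodal_insert_eq_nodal hminus, map_mul, map_mul, Module.End.mul_apply,
      Module.End.mul_apply, ← hw]
    have e1 : β (s m + 1) = q ^ 2 * q ^ (2 * s m) :=
      zpow_two_mul_add_one hq0 _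
    have e2 : β (s m - 1) = (q⁻¹) ^ 2 * q ^ (2 * s m) :=
      zpow_two_mul_sub_one hq0 _
    have h4 : q ^ 2 * (q⁻¹) ^ 2 = 1 := by field_simp
    rw [e1, e2]
    simp only [map_sub, aeval_X, aeval_C, LinearMap.sub_apply, Module.algebraMap_end_apply,
      map_smul]
    rw [← h2]
    match_scalars <;> field_simp
  -- Roots without an eigenvector are discarded: the next stage needs every root to be realised in
  -- order to apply the rules of content sequences.
  refine ⟨(insert (s m + 1) (insert (s m - 1) Y)).filter
    fun c => Realised q σ (Function.update s (m + 1) c) (m + 1 + 1), ?_, ?_, ?_⟩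
  · refine (Finset.filter_subset _ _).trans ?_
    have h1 := Finset.mem_Icc.mp (hYsub hmem)
    intro c hc
    rw [Finset.mem_insert, Finset.mem_insert] at hc
    rw [Finset.mem_Icc]
    push_cast
    rcases hc with rfl | rfl | hc
    · omega
    · omega
    · have h2 := Finset.mem_Icc.mp (hYsub hc)
      omega
  · intro c hc
    exact (Finset.mem_filter.mp hc).2
  · intro v hv
    refine aeval_nodal_filter hstab β _ (fun c hc w hw hwc => ?_) _ v hv (hkill v hv)
    by_contra hw0
    refine hc ⟨w, fun i hi => ?_, hw0⟩
    by_cases h : i = m + 1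
    · subst h
      rw [Function.update_self]
      exact hwc
    · rw [Function.update_of_ne h]
      exact hw i (by omega)

theorem splits (hq0 : q ≠ 0) (hq : ∀ m : ℕ, 0 < m → q ^ m ≠ 1) (hσ : IsHeckeFamily q K σ)
    {m : ℕ} (hm : m ≤ K) : Splits q σ m := by
  induction m using Nat.strong_induction_on with
  | _ m ih =>
    obtain _ | m := m
    · exact splits_zero q σ
    · exact Splits.succ hq0 hq hσ hm fun j hj => ih j (by omega) (by omega)

/-- A submodule containing the joint eigenspaces of one level contains those of the previous
level. -/
theorem jmSpace_le_of_succ (hq0 : q ≠ 0) (hq : ∀ m : ℕ, 0 < m → q ^ m ≠ 1)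
    (hσ : IsHeckeFamily q K σ) {m : ℕ} (hm : m ≤ K) {N : Submodule ℂ M}
    (hN : ∀ s, jmSpace q σ s (m + 1) ≤ N) (s : ℕ → ℤ) : jmSpace q σ s m ≤ N := by
  intro v hv
  obtain ⟨Y, -, -, hY⟩ := splits hq0 hq hσ hm s
  have hstab : ∀ v ∈ jmSpace q σ s m, conjTower σ 1 m v ∈ jmSpace q σ s m := fun v hv =>
    apply_mem_jmSpace (fun i hi => hσ.commute_jm (by omega) hm) hv
  rcases Y.eq_empty_or_nonempty with rfl | hne
  · have := hY v hv
    simp only [Lagrange.nodal_empty, map_one, Module.End.one_apply] at this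
    rw [this]
    exact N.zero_mem
  -- The Lagrange basis polynomials sum to 1, so they decompose `v` into eigenvectors of the next
  -- Jucys–Murphy element.
  have hsum := Lagrange.sum_basis ((zpow_two_mul_injective hq0 hq).injOn (s := Y)) hne
  have hv' : v = ∑ c ∈ Y, aeval (conjTower σ 1 m)
      (Lagrange.basis Y (fun c : ℤ => q ^ (2 * c)) c) v := by
    rw [← LinearMap.sum_apply, ← map_sum, hsum, map_one, Module.End.one_apply]
  rw [hv']
  refine N.sum_mem fun c hc => hN (Function.update s m c) fun i hi => ?_
  by_cases h : i = m
  · subst h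
    rw [Function.update_self, ← sub_eq_zero]
    obtain ⟨t, ht⟩ := sub_mul_basis (β := fun c : ℤ => q ^ (2 * c)) hc
    have := congrArg (fun P => aeval (conjTower σ 1 i) P v) ht
    simpa [hY v hv, Module.algebraMap_end_apply] using this
  · rw [Function.update_of_ne h]
    exact aeval_mem hstab _ hv i (by omega)

/-- The Jucys–Murphy elements are annihilated by the squarefree polynomials with the possible
contents as roots. -/
theorem aeval_jm_nodal (hq0 : q ≠ 0) (hq : ∀ m : ℕ, 0 < m → q ^ m ≠ 1)
    (hσ : IsHeckeFamily q K σ) {m : ℕ} (hm : m ≤ K) {S : Finset ℤ}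
    (hmS : Finset.Icc (-(m : ℤ)) m ⊆ S) :
    aeval (conjTower σ 1 m) (Lagrange.nodal S fun c : ℤ => q ^ (2 * c)) = 0 := by
  set N := LinearMap.ker (aeval (conjTower σ 1 m) (Lagrange.nodal S fun c : ℤ => q ^ (2 * c)))
  -- The descent runs from level `m`, where `Splits` applies because its roots lie in `S`, to level
  -- 0, whose joint eigenspace carries no condition and is the whole module.
  have htop : ∀ j ≤ m, ∀ s, jmSpace q σ s j ≤ N := by
    intro j hj
    induction hj using Nat.decreasingInduction with
    | self =>
      intro s v hv
      obtain ⟨Y, hYsub, -, hY⟩ := splits hq0 hq hσ hm s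
      rw [LinearMap.mem_ker]
      have hprod : Lagrange.nodal S (fun c : ℤ => q ^ (2 * c)) =
          Lagrange.nodal (S \ Y) (fun c : ℤ => q ^ (2 * c)) *
            Lagrange.nodal Y fun c : ℤ => q ^ (2 * c) := by
        simp only [Lagrange.nodal]
        rw [Finset.prod_sdiff (hYsub.trans hmS)]
      rw [hprod, map_mul, Module.End.mul_apply, hY v hv, map_zero]
    | of_succ j hj ih => exact jmSpace_le_of_succ hq0 hq hσ (by omega) ih
  ext v
  exact htop 0 (Nat.zero_le m) (fun _ => 0) (fun i hi => absurd hi (Nat.not_lt_zero i))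

end Spectrum

end ReflectionEq

namespace ReflectionEq

variable {n : ℕ}

/-! ### Matrices acting in some of the tensor factors -/

/-- `spread` as a homomorphism of algebras. -/
def spreadHom {m k : ℕ} {e : Fin m → Fin k} (he : Function.Injective e) :
    Matrix (Fin m → Fin n) (Fin m → Fin n) ℂ →ₐ[ℂ] Matrix (Fin k → Fin n) (Fin k → Fin n) ℂ where
  toFun := spread e
  map_one' := spread_one
  map_mul' X Y := (spread_mul he X Y).symm
  map_zero' := by ext; simp [spread]
  map_add' X Y := by ext f g; simp only [spread, Matrix.of_apply, Matrix.add_apply]; split_ifs <;> simp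
  commutes' r := by
    rw [Algebra.algebraMap_eq_smul_one, Algebra.algebraMap_eq_smul_one, ← spread_one (e := e)]
    ext f g
    simp only [spread, Matrix.of_apply, Matrix.smul_apply]
    split_ifs <;> simp

/-- `onSites` as a homomorphism of algebras. -/
def sitesHom {k : ℕ} {a b : Fin k} (h : a ≠ b) :
    Matrix (Fin n × Fin n) (Fin n × Fin n) ℂ →ₐ[ℂ] Matrix (Fin k → Fin n) (Fin k → Fin n) ℂ :=
  (spreadHom (pair_injective h)).comp
    (Matrix.reindexAlgEquiv ℂ ℂ (finTwoArrowEquiv (Fin n)).symm).toAlgHom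

theorem sitesHom_apply {k : ℕ} {a b : Fin k} (h : a ≠ b)
    (X : Matrix (Fin n × Fin n) (Fin n × Fin n) ℂ) : sitesHom h X = onSites X a b :=
  (onSites_eq_spread X a b).symm

/-- The homomorphism `X ↦ X_{i,i+1}`. -/
def neighbourHom {k i : ℕ} (h : i < k - 1) :
    Matrix (Fin n × Fin n) (Fin n × Fin n) ℂ →ₐ[ℂ] Matrix (Fin k → Fin n) (Fin k → Fin n) ℂ :=
  sitesHom (a := (⟨i, by omega⟩ : Fin k)) (b := ⟨i + 1, by omega⟩) (by simp)

theorem neighbourHom_apply {k i : ℕ} (h : i < k - 1)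
    (X : Matrix (Fin n × Fin n) (Fin n × Fin n) ℂ) : neighbourHom h X = neighbour k X i := by
  rw [neighbourHom, sitesHom_apply, neighbour, dif_pos h]

/-! ### The skew inverse -/

variable {q : ℂ} {R Ψ : Matrix (Fin n × Fin n) (Fin n × Fin n) ℂ}

theorem IsHeckeRMatrix.mul_self (hR : IsHeckeRMatrix q R) (hq0 : q ≠ 0) :
    R * R = (q - q⁻¹) • R + 1 := by
  have h := hR.hecke
  simp only [sub_mul, mul_add, smul_mul_assoc, mul_smul_comm, mul_one, one_mul, smul_sub,
    smul_smul, inv_mul_cancel₀ hq0, one_smul] at h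
  rw [← sub_eq_zero, ← h]
  module

theorem IsHeckeRMatrix.inv_eq (hR : IsHeckeRMatrix q R) (hq0 : q ≠ 0) :
    R⁻¹ = R - (q - q⁻¹) • 1 := by
  refine Matrix.inv_eq_right_inv ?_
  rw [mul_sub, hR.mul_self hq0, mul_smul_comm, mul_one]
  abel

theorem IsHeckeRMatrix.mul_inv (hR : IsHeckeRMatrix q R) (hq0 : q ≠ 0) : R * R⁻¹ = 1 := by
  rw [hR.inv_eq hq0, mul_sub, hR.mul_self hq0, mul_smul_comm, mul_one]
  abel

theorem IsHeckeRMatrix.inv_mul (hR : IsHeckeRMatrix q R) (hq0 : q ≠ 0) : R⁻¹ * R = 1 := by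
  rw [hR.inv_eq hq0, sub_mul, hR.mul_self hq0, smul_mul_assoc, one_mul]
  abel

/-- The blocks of a matrix on `V ⊗ V`, acting in the second factor. -/
def block (X : Matrix (Fin n × Fin n) (Fin n × Fin n) ℂ) (a b : Fin n) :
    Matrix (Fin n) (Fin n) ℂ :=
  Matrix.of fun d i => X (a, d) (b, i)

theorem block_apply (X : Matrix (Fin n × Fin n) (Fin n × Fin n) ℂ) (a b d i : Fin n) :
    block X a b d i = X (a, d) (b, i) := rfl

theorem block_sub_smul_one (X : Matrix (Fin n × Fin n) (Fin n × Fin n) ℂ) (c : ℂ) (a b : Fin n) :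
    block (X - c • 1) a b = block X a b - (if a = b then c else 0) • 1 := by
  ext d i
  simp only [block_apply, Matrix.sub_apply, Matrix.smul_apply, Matrix.one_apply, Prod.mk.injEq]
  by_cases h : a = b <;> by_cases h' : d = i <;> simp [h, h']

theorem onSites_apply {k : ℕ} (X : Matrix (Fin n × Fin n) (Fin n × Fin n) ℂ) (a b : Fin k)
    (f g : Fin k → Fin n) : onSites X a b f g =
      if ∀ c, c ≠ a → c ≠ b → f c = g c then X (f a, f b) (g a, g b) else 0 := rfl

theorem neighbour_three_zero (X : Matrix (Fin n × Fin n) (Fin n × Fin n) ℂ) :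
    neighbour 3 X 0 = onSites X (0 : Fin 3) 1 := rfl

theorem neighbour_three_one (X : Matrix (Fin n × Fin n) (Fin n × Fin n) ℂ) :
    neighbour 3 X 1 = onSites X (1 : Fin 3) 2 := rfl

theorem neighbour_zero_mul_apply (X : Matrix (Fin n × Fin n) (Fin n × Fin n) ℂ)
    (N : Matrix (Fin 3 → Fin n) (Fin 3 → Fin n) ℂ) (x a d : Fin n) (g : Fin 3 → Fin n) :
    (neighbour 3 X 0 * N) ![x, a, d] g = ∑ u, ∑ v, X (x, a) (u, v) * N ![u, v, d] g := by
  rw [Matrix.mul_apply, ← Fintype.sum_prod_type']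
  symm
  refine Fintype.sum_of_injective (fun w : Fin n × Fin n => ![w.1, w.2, d]) ?_ _ _ ?_ ?_
  · intro w w' h
    exact Prod.ext (congrFun h 0) (congrFun h 1)
  · intro h hh
    rw [neighbour_three_zero, onSites_apply, if_neg, zero_mul]
    intro hc
    have h2 := hc 2 (by decide) (by decide)
    exact hh ⟨(h 0, h 1), by funext c; fin_cases c <;> [rfl; rfl; exact h2]⟩
  · intro w
    congr 1
    rw [neighbour_three_zero, onSites_apply, if_pos]
    · rfl
    · intro c h0 h1
      fin_cases c <;> simp_all

theorem neighbour_one_mul_apply (X : Matrix (Fin n × Fin n) (Fin n × Fin n) ℂ)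
    (N : Matrix (Fin 3 → Fin n) (Fin 3 → Fin n) ℂ) (x a d : Fin n) (g : Fin 3 → Fin n) :
    (neighbour 3 X 1 * N) ![x, a, d] g = ∑ u, ∑ v, X (a, d) (u, v) * N ![x, u, v] g := by
  rw [Matrix.mul_apply, ← Fintype.sum_prod_type']
  symm
  refine Fintype.sum_of_injective (fun w : Fin n × Fin n => ![x, w.1, w.2]) ?_ _ _ ?_ ?_
  · intro w w' h
    exact Prod.ext (congrFun h 1) (congrFun h 2)
  · intro h hh
    rw [neighbour_three_one, onSites_apply, if_neg, zero_mul]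
    intro hc
    have h2 := hc 0 (by decide) (by decide)
    exact hh ⟨(h 1, h 2), by funext c; fin_cases c <;> [exact h2; rfl; rfl]⟩
  · intro w
    congr 1
    rw [neighbour_three_one, onSites_apply, if_pos]
    · rfl
    · intro c h0 h1
      fin_cases c <;> simp_all

theorem neighbour_zero_apply (X : Matrix (Fin n × Fin n) (Fin n × Fin n) ℂ)
    (x a d x' a' d' : Fin n) :
    neighbour 3 X 0 ![x, a, d] ![x', a', d'] = if d = d' then X (x, a) (x', a') else 0 := by
  rw [neighbour_three_zero, onSites_apply]
  refine if_congr ⟨fun h => h 2 (by decide) (by decide), fun h c h0 h1 => ?_⟩ rfl rfl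
  fin_cases c <;> simp_all

theorem neighbour_one_apply (X : Matrix (Fin n × Fin n) (Fin n × Fin n) ℂ)
    (x a d x' a' d' : Fin n) :
    neighbour 3 X 1 ![x, a, d] ![x', a', d'] = if x = x' then X (a, d) (a', d') else 0 := by
  rw [neighbour_three_one, onSites_apply]
  refine if_congr ⟨fun h => h 0 (by decide) (by decide), fun h c h0 h1 => ?_⟩ rfl rfl
  fin_cases c <;> simp_all

/-- The Yang–Baxter equation `R₂₃⁻¹ R₁₂ R₂₃ = R₁₂ R₂₃ R₁₂⁻¹`, read as an equation between matrices
in the third factor. -/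
theorem IsHeckeRMatrix.yangBaxter_block (hR : IsHeckeRMatrix q R) (hq0 : q ≠ 0)
    (x a y m : Fin n) :
    ∑ b, ∑ v, R (x, b) (y, v) • (block R⁻¹ a b * block R v m) =
      ∑ u, ∑ v, ∑ w, (R (x, a) (u, v) * R⁻¹ (u, w) (y, m)) • block R v w := by
  have h0 : (0 : ℕ) < 3 - 1 := by norm_num
  have h1 : (1 : ℕ) < 3 - 1 := by norm_num
  have e0 : neighbour 3 R 0 * neighbour 3 R⁻¹ 0 = 1 := by
    rw [← neighbourHom_apply h0, ← neighbourHom_apply h0, ← map_mul, hR.mul_inv hq0, map_one]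
  have e1 : neighbour 3 R⁻¹ 1 * neighbour 3 R 1 = 1 := by
    rw [← neighbourHom_apply h1, ← neighbourHom_apply h1, ← map_mul, hR.inv_mul hq0, map_one]
  have key : neighbour 3 R⁻¹ 1 * (neighbour 3 R 0 * neighbour 3 R 1) =
      neighbour 3 R 0 * (neighbour 3 R 1 * neighbour 3 R⁻¹ 0) := by
    calc neighbour 3 R⁻¹ 1 * (neighbour 3 R 0 * neighbour 3 R 1)
        = neighbour 3 R⁻¹ 1 * (neighbour 3 R 0 * neighbour 3 R 1 * neighbour 3 R 0) *
            neighbour 3 R⁻¹ 0 := by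
          simp only [mul_assoc, e0, mul_one]
      _ = (neighbour 3 R⁻¹ 1 * neighbour 3 R 1) * neighbour 3 R 0 * neighbour 3 R 1 *
            neighbour 3 R⁻¹ 0 := by rw [hR.yangBaxter]; simp only [mul_assoc]
      _ = _ := by rw [e1, one_mul, mul_assoc]
  ext d i
  have h := congrFun (congrFun key ![x, a, d]) ![y, m, i]
  simp only [neighbour_zero_mul_apply, neighbour_one_mul_apply, neighbour_zero_apply,
    neighbour_one_apply, mul_ite, mul_zero, Finset.mem_univ, if_true,
    Finset.sum_ite_eq', Finset.sum_ite_irrel, Finset.sum_const_zero] at h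
  simp only [Matrix.sum_apply, Matrix.smul_apply, Matrix.mul_apply, block_apply, smul_eq_mul]
  have hl : ∑ b, ∑ v, R (x, b) (y, v) * ∑ j, R⁻¹ (a, d) (b, j) * R (v, j) (m, i) =
      ∑ b, ∑ j, R⁻¹ (a, d) (b, j) * ∑ v, R (x, b) (y, v) * R (v, j) (m, i) := by
    refine Finset.sum_congr rfl fun b _ => ?_
    simp only [Finset.mul_sum]
    rw [Finset.sum_comm]
    exact Finset.sum_congr rfl fun _ _ => Finset.sum_congr rfl fun _ _ => by ring
  rw [hl, h]
  simp only [Finset.mul_sum]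
  exact Finset.sum_congr rfl fun _ _ => Finset.sum_congr rfl fun _ _ =>
    Finset.sum_congr rfl fun _ _ => by ring

/-- This is Tr_(2) C₂R₁₂ = I: in the left skew-inverse relation, closing the second leg of Ψ turns
it into C. -/
theorem trace_matC_mul_block (hΨ : IsSkewInverse R Ψ) (v w : Fin n) :
    (matC Ψ * block R v w).trace = if v = w then 1 else 0 := by
  have h1 : (matC Ψ * block R v w).trace =
      ∑ k, ∑ a, ∑ b, R (v, a) (w, b) * Ψ (b, k) (a, k) := by
    simp only [Matrix.trace, Matrix.diag_apply, Matrix.mul_apply, block_apply, matC,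
      Matrix.of_apply, Finset.sum_mul]
    rw [Finset.sum_comm]
    conv_rhs => rw [Finset.sum_comm]
    refine Finset.sum_congr rfl fun a _ => ?_
    rw [Finset.sum_comm]
    exact Finset.sum_congr rfl fun _ _ => Finset.sum_congr rfl fun _ _ => mul_comm _ _
  rw [h1]
  simp only [hΨ.left, ite_and]
  split_ifs with h2 <;> simp [h2]

/-- Contracting with the skew inverse turns the blocks of `R` into matrix units. -/
theorem sum_smul_block (hΨ : IsSkewInverse R Ψ) (i j : Fin n) :
    ∑ m, ∑ l, Ψ (i, l) (j, m) • block R m l = Matrix.single j i (1 : ℂ) := by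
  ext c d
  have h := hΨ.right i j c d
  rw [Finset.sum_comm] at h
  simp only [Matrix.sum_apply, Matrix.smul_apply, block_apply, smul_eq_mul, h, Matrix.single,
    Matrix.of_apply]
  exact if_congr ⟨fun h => ⟨h.2.symm, h.1⟩, fun h => ⟨h.2, h.1.symm⟩⟩ rfl rfl

/-- Equivalently, Tr_(2) C₂R⁻¹X₁R = Tr(CX) I for every matrix X. The C-trace over the third factor
of the Yang–Baxter equation replaces the right side by RR⁻¹ = 1. The factor R₁₂ left on the other
side is then stripped off by contracting with Ψ. -/
theorem trace_matC_inv_mul (hR : IsHeckeRMatrix q R) (hq0 : q ≠ 0) (hΨ : IsSkewInverse R Ψ)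
    (a b m l : Fin n) :
    (matC Ψ * (block R⁻¹ a b * block R m l)).trace = if a = l then matC Ψ m b else 0 := by
  have h1 : ∀ x y : Fin n,
      ∑ b, ∑ v, R (x, b) (y, v) * (matC Ψ * (block R⁻¹ a b * block R v l)).trace =
        if x = y ∧ a = l then 1 else 0 := by
    intro x y
    have h := congrArg (fun X => (matC Ψ * X).trace) (hR.yangBaxter_block hq0 x a y l)
    simp only [Matrix.mul_sum, Matrix.trace_sum, Matrix.mul_smul, Matrix.trace_smul, smul_eq_mul,
      trace_matC_mul_block hΨ, mul_ite, mul_one, mul_zero, Finset.sum_ite_eq, Finset.mem_univ,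
      if_true] at h
    rw [h]
    have h2 := congrFun (congrFun (hR.mul_inv hq0) (x, a)) (y, l)
    rw [Matrix.mul_apply, Fintype.sum_prod_type, Matrix.one_apply] at h2
    exact h2.trans (if_congr Prod.mk_inj rfl rfl)
  have h3 : ∀ c d : Fin n, ∑ x, ∑ y, Ψ (m, y) (b, x) * R (x, c) (y, d) =
      if m = d ∧ c = b then 1 else 0 := by
    intro c d
    rw [Finset.sum_comm]
    exact hΨ.right m b c d
  have h4 : (matC Ψ * (block R⁻¹ a b * block R m l)).trace =
      ∑ x, ∑ y, Ψ (m, y) (b, x) *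
        ∑ c, ∑ v, R (x, c) (y, v) * (matC Ψ * (block R⁻¹ a c * block R v l)).trace := by
    have h5 : ∑ x, ∑ y, Ψ (m, y) (b, x) *
        ∑ c, ∑ v, R (x, c) (y, v) * (matC Ψ * (block R⁻¹ a c * block R v l)).trace =
        ∑ c, ∑ v, (∑ x, ∑ y, Ψ (m, y) (b, x) * R (x, c) (y, v)) *
          (matC Ψ * (block R⁻¹ a c * block R v l)).trace := by
      simp only [Finset.mul_sum, Finset.sum_mul]
      have e1 : ∀ F : Fin n → Fin n → Fin n → Fin n → ℂ,
          ∑ x, ∑ y, ∑ c, ∑ v, F x y c v = ∑ c, ∑ v, ∑ x, ∑ y, F x y c v := by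
        intro F
        simp only [← Fintype.sum_prod_type']
        exact Fintype.sum_equiv ⟨fun p => (p.2.2.1, p.2.2.2, p.1, p.2.1),
          fun p => (p.2.2.1, p.2.2.2, p.1, p.2.1), fun _ => rfl, fun _ => rfl⟩ _ _ fun _ => rfl
      rw [e1]
      simp only [mul_assoc]
    rw [h5]
    simp [h3, ite_and]
  rw [h4]
  simp only [h1]
  by_cases hal : a = l
  · simp [hal, matC]
  · simp [hal]

theorem trace_matC_inv (hR : IsHeckeRMatrix q R) (hq0 : q ≠ 0) (hΨ : IsSkewInverse R Ψ)
    (a b : Fin n) : (matC Ψ * block R⁻¹ a b).trace =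
      if a = b then 1 - (q - q⁻¹) * (matC Ψ).trace else 0 := by
  rw [hR.inv_eq hq0, block_sub_smul_one, mul_sub, Matrix.trace_sub, trace_matC_mul_block hΨ,
    mul_smul_comm, mul_one, Matrix.trace_smul]
  split_ifs <;> simp

/-- R and R⁻¹ differ by a scalar, so this reduces to the opposite order. The three correction terms,
all proportional to δ_a^b δ_m^l, cancel. -/
theorem trace_matC_mul_inv (hR : IsHeckeRMatrix q R) (hq0 : q ≠ 0) (hΨ : IsSkewInverse R Ψ)
    (a b m l : Fin n) :
    (matC Ψ * (block R a b * block R⁻¹ m l)).trace = if a = l then matC Ψ m b else 0 := by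
  have e1 : block R a b = block R⁻¹ a b + (if a = b then q - q⁻¹ else 0) • 1 := by
    rw [hR.inv_eq hq0, block_sub_smul_one, sub_add_cancel]
  have e2 : block R⁻¹ m l = block R m l - (if m = l then q - q⁻¹ else 0) • 1 := by
    rw [hR.inv_eq hq0, block_sub_smul_one]
  have e3 : block R a b * block R⁻¹ m l = block R⁻¹ a b * block R m l +
      (if a = b then q - q⁻¹ else 0) • block R m l -
      (if m = l then q - q⁻¹ else 0) • block R⁻¹ a b -
      ((if a = b then q - q⁻¹ else 0) * (if m = l then q - q⁻¹ else 0)) • 1 := by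
    rw [e1, e2]
    simp only [add_mul, mul_sub, smul_mul_assoc, mul_smul_comm, one_mul, mul_one]
    module
  rw [e3]
  simp only [mul_add, mul_sub, Matrix.trace_add, Matrix.trace_sub, mul_smul_comm, mul_one,
    Matrix.trace_smul, trace_matC_inv_mul hR hq0 hΨ, trace_matC_mul_block hΨ,
    trace_matC_inv hR hq0 hΨ, smul_eq_mul]
  split_ifs <;> ring

/-- Contraction with Ψ turns the blocks of R into matrix units, so the traces in
`trace_matC_inv_mul` determine every entry. -/
theorem matC_mul_block_inv (hR : IsHeckeRMatrix q R) (hq0 : q ≠ 0) (hΨ : IsSkewInverse R Ψ)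
    (a b i j : Fin n) :
    (matC Ψ * block R⁻¹ a b) i j = ∑ m, Ψ (i, a) (j, m) * matC Ψ m b := by
  have h : (matC Ψ * (block R⁻¹ a b * ∑ m, ∑ l, Ψ (i, l) (j, m) • block R m l)).trace =
      ∑ m, Ψ (i, a) (j, m) * matC Ψ m b := by
    simp only [Matrix.mul_sum, Matrix.trace_sum, Matrix.mul_smul, Matrix.trace_smul, smul_eq_mul,
      trace_matC_inv_mul hR hq0 hΨ, mul_ite, mul_zero, Finset.sum_ite_eq, Finset.mem_univ, if_true]
  rw [← h, sum_smul_block hΨ, ← mul_assoc, Matrix.trace_mul_single]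
  simp

theorem block_inv_mul_matC (hR : IsHeckeRMatrix q R) (hq0 : q ≠ 0) (hΨ : IsSkewInverse R Ψ)
    (a b i j : Fin n) :
    (block R⁻¹ a b * matC Ψ) i j = ∑ l, Ψ (i, l) (j, b) * matC Ψ a l := by
  have h : (matC Ψ * ((∑ m, ∑ l, Ψ (i, l) (j, m) • block R m l) * block R⁻¹ a b)).trace =
      ∑ l, Ψ (i, l) (j, b) * matC Ψ a l := by
    simp only [Matrix.mul_sum, Matrix.sum_mul, Matrix.trace_sum, Matrix.mul_smul, Matrix.smul_mul,
      Matrix.trace_smul, smul_eq_mul,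
      trace_matC_mul_inv hR hq0 hΨ, mul_ite, mul_zero]
    rw [Finset.sum_comm]
    simp
  rw [← h, sum_smul_block hΨ, Matrix.trace_mul_comm, mul_assoc, Matrix.trace_single_mul]
  simp

/-- The trace of `C * block R⁻¹ a b` is evaluated in two ways: directly from R⁻¹ = R − (q − q⁻¹),
and by closing Ψ into B in `matC_mul_block_inv`. -/
theorem matB_mul_matC (hR : IsHeckeRMatrix q R) (hq0 : q ≠ 0) (hΨ : IsSkewInverse R Ψ) :
    matB Ψ * matC Ψ = (1 - (q - q⁻¹) * (matC Ψ).trace) • 1 := by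
  ext a b
  have h := trace_matC_inv hR hq0 hΨ a b
  rw [Matrix.trace] at h
  simp only [Matrix.diag_apply, matC_mul_block_inv hR hq0 hΨ] at h
  rw [Matrix.mul_apply, Matrix.smul_apply, Matrix.one_apply, smul_eq_mul, mul_ite, mul_one,
    mul_zero, ← h, Finset.sum_comm]
  simp only [matB, Matrix.of_apply, Finset.sum_mul]

/-- Both products reduce to the same contraction of Ψ with two copies of C, by the formulas for C
multiplying a block of R⁻¹ on the left and on the right. -/
theorem matC_kronecker_commute_inv (hR : IsHeckeRMatrix q R) (hq0 : q ≠ 0)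
    (hΨ : IsSkewInverse R Ψ) :
    Commute (matC Ψ ⊗ₖ matC Ψ) R⁻¹ := by
  ext ⟨c, i⟩ ⟨b, j⟩
  have h1 : ((matC Ψ ⊗ₖ matC Ψ) * R⁻¹) (c, i) (b, j) =
      ∑ a, matC Ψ c a * (matC Ψ * block R⁻¹ a b) i j := by
    simp only [Matrix.mul_apply, Fintype.sum_prod_type, Matrix.kroneckerMap_apply, block_apply,
      Finset.mul_sum, mul_assoc]
  have h2 : (R⁻¹ * (matC Ψ ⊗ₖ matC Ψ)) (c, i) (b, j) =
      ∑ m, (block R⁻¹ c m * matC Ψ) i j * matC Ψ m b := by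
    simp only [Matrix.mul_apply, Fintype.sum_prod_type, Matrix.kroneckerMap_apply, block_apply,
      Finset.sum_mul]
    exact Finset.sum_congr rfl fun _ _ => Finset.sum_congr rfl fun _ _ => by ring
  rw [h1, h2]
  simp only [matC_mul_block_inv hR hq0 hΨ, block_inv_mul_matC hR hq0 hΨ, Finset.mul_sum,
    Finset.sum_mul]
  rw [Finset.sum_comm]
  exact Finset.sum_congr rfl fun _ _ => Finset.sum_congr rfl fun _ _ => by ring

/-! ### Exchanging the two factors -/

/-- The matrix `X_{21}`. -/
def flip (X : Matrix (Fin n × Fin n) (Fin n × Fin n) ℂ) : Matrix (Fin n × Fin n) (Fin n × Fin n) ℂ :=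
  X.submatrix Prod.swap Prod.swap

theorem onSites_flip {k : ℕ} (X : Matrix (Fin n × Fin n) (Fin n × Fin n) ℂ) (a b : Fin k) :
    onSites (flip X) a b = onSites X b a := by
  ext f g
  rw [onSites_apply, onSites_apply]
  exact if_congr ⟨fun h c h1 h2 => h c h2 h1, fun h c h1 h2 => h c h2 h1⟩ rfl rfl

theorem flip_mul (X Y : Matrix (Fin n × Fin n) (Fin n × Fin n) ℂ) :
    flip (X * Y) = flip X * flip Y :=
  (Matrix.submatrix_mul_equiv X Y Prod.swap (Equiv.prodComm _ _) Prod.swap).symm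

theorem flip_one : flip (1 : Matrix (Fin n × Fin n) (Fin n × Fin n) ℂ) = 1 :=
  Matrix.submatrix_one_equiv (Equiv.prodComm _ _)

theorem IsHeckeRMatrix.flip (hR : IsHeckeRMatrix q R) : IsHeckeRMatrix q (flip R) where
  yangBaxter := by
    rw [neighbour_three_zero, neighbour_three_one, onSites_flip, onSites_flip]
    exact (onSites_braid hR (a := (2 : Fin 3)) (b := 1) (c := 0) (by decide) (by decide)
      (by decide)).symm
  hecke := by
    have h := congrArg ReflectionEq.flip hR.hecke
    rw [flip_mul] at h
    have e1 : ReflectionEq.flip (R - q • 1) = ReflectionEq.flip R - q • 1 := by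
      nth_rewrite 2 [← flip_one]; rfl
    have e2 : ReflectionEq.flip (R + q⁻¹ • 1) = ReflectionEq.flip R + q⁻¹ • 1 := by
      nth_rewrite 2 [← flip_one]; rfl
    rw [e1, e2] at h
    exact h

theorem IsSkewInverse.flip (hΨ : IsSkewInverse R Ψ) : IsSkewInverse (flip R) (flip Ψ) where
  left i j k s := by
    have h := hΨ.right k s i j
    rw [Finset.sum_comm] at h
    simp only [ReflectionEq.flip, Matrix.submatrix_apply, Prod.swap_prod_mk]
    rw [show (if i = s ∧ k = j then (1 : ℂ) else 0) = if k = j ∧ i = s then 1 else 0 from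
      if_congr and_comm rfl rfl, ← h]
    exact Finset.sum_congr rfl fun _ _ => Finset.sum_congr rfl fun _ _ => by ring
  right i j k s := by
    have h := hΨ.left k s i j
    rw [Finset.sum_comm] at h
    simp only [ReflectionEq.flip, Matrix.submatrix_apply, Prod.swap_prod_mk]
    rw [show (if i = s ∧ k = j then (1 : ℂ) else 0) = if k = j ∧ i = s then 1 else 0 from
      if_congr and_comm rfl rfl, ← h]
    exact Finset.sum_congr rfl fun _ _ => Finset.sum_congr rfl fun _ _ => by ring

/-- The matrix R₂₁ satisfies the same hypotheses with skew inverse Ψ₂₁, and the flip exchanges B and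
C. Every identity for C therefore has a counterpart for B. -/
theorem matC_flip (Ψ : Matrix (Fin n × Fin n) (Fin n × Fin n) ℂ) : matC (flip Ψ) = matB Ψ := rfl

theorem flip_inv (hR : IsHeckeRMatrix q R) (hq0 : q ≠ 0) : (flip R)⁻¹ = flip R⁻¹ := by
  refine Matrix.inv_eq_right_inv ?_
  rw [← flip_mul, hR.mul_inv hq0, flip_one]

theorem trace_matB (Ψ : Matrix (Fin n × Fin n) (Fin n × Fin n) ℂ) :
    (matB Ψ).trace = (matC Ψ).trace := by
  simp only [Matrix.trace, Matrix.diag_apply, matB, matC, Matrix.of_apply]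
  exact Finset.sum_comm

theorem matB_kronecker_commute_inv (hR : IsHeckeRMatrix q R) (hq0 : q ≠ 0)
    (hΨ : IsSkewInverse R Ψ) : Commute (matB Ψ ⊗ₖ matB Ψ) R⁻¹ := by
  have h := (matC_kronecker_commute_inv hR.flip hq0 hΨ.flip).eq
  rw [flip_inv hR hq0, matC_flip] at h
  have h1 := congrArg flip h
  rw [flip_mul, flip_mul] at h1
  have e1 : flip (matB Ψ ⊗ₖ matB Ψ) = matB Ψ ⊗ₖ matB Ψ := by
    ext ⟨a, b⟩ ⟨c, d⟩
    simp [flip, mul_comm]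
  rwa [e1] at h1

theorem matB_kronecker_commute (hR : IsHeckeRMatrix q R) (hq0 : q ≠ 0)
    (hΨ : IsSkewInverse R Ψ) : Commute (matB Ψ ⊗ₖ matB Ψ) R := by
  have h : R = R⁻¹ + (q - q⁻¹) • 1 := by rw [hR.inv_eq hq0, sub_add_cancel]
  rw [h]
  exact (matB_kronecker_commute_inv hR hq0 hΨ).add_right ((Commute.one_right _).smul_right _)

end ReflectionEq

namespace ReflectionEq

variable {n : ℕ} {q : ℂ} {R Ψ : Matrix (Fin n × Fin n) (Fin n × Fin n) ℂ}

/-! ### The local representation -/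

theorem IsHeckeRMatrix.isHeckeFamily (hR : IsHeckeRMatrix q R) (hq0 : q ≠ 0) (k : ℕ) :
    IsHeckeFamily q (k - 1) (neighbour k R) where
  quad i hi := by
    rw [← neighbourHom_apply hi, ← map_mul, hR.mul_self hq0, map_add, map_smul, map_one]
  braid i hi := neighbour_braid hR hi
  comm i j hij _ := neighbour_comm R hij

theorem neighbour_inv (hR : IsHeckeRMatrix q R) (hq0 : q ≠ 0) {k i : ℕ} (hi : i < k - 1) :
    neighbour k R⁻¹ i = neighbour k R i - (q - q⁻¹) • 1 := by
  rw [← neighbourHom_apply hi, ← neighbourHom_apply hi, hR.inv_eq hq0, map_sub, map_smul, map_one]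

theorem IsHeckeFamily.congr {A : Type*} [Ring A] [Algebra ℂ A] {K : ℕ} {σ τ : ℕ → A}
    (h : IsHeckeFamily q K σ) (hst : ∀ i < K, τ i = σ i) : IsHeckeFamily q K τ where
  quad i hi := by rw [hst i hi, h.quad i hi]
  braid i hi := by rw [hst i (by omega), hst (i + 1) hi, h.braid i hi]
  comm i j hij hj := by rw [hst i (by omega), hst j hj]; exact h.comm i j hij hj

theorem isHeckeFamily_inv (hR : IsHeckeRMatrix q R) (hq0 : q ≠ 0) (k : ℕ) :
    IsHeckeFamily q⁻¹ (k - 1) (neighbour k R⁻¹) :=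
  (hR.isHeckeFamily hq0 k).inverse.congr fun _ hi => neighbour_inv hR hq0 hi

theorem localRep_heckeGen (hR : IsHeckeRMatrix q R) (k i : ℕ) :
    localRep hR k (heckeGen q k i) = neighbour k R i := by
  rw [heckeGen]
  split_ifs with h
  · rw [localRep, RingQuot.liftAlgHom_mkAlgHom_apply, FreeAlgebra.lift_ι_apply]
  · rw [map_zero, neighbour, dif_neg h]

theorem localRep_jucysMurphy (hR : IsHeckeRMatrix q R) (k i : ℕ) :
    localRep hR k (jucysMurphy q k i) = conjTower (neighbour k R) 1 i := by
  induction i with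
  | zero => exact map_one _
  | succ i ih => rw [jucysMurphy, map_mul, map_mul, ih, localRep_heckeGen, conjTower]

/-! ### Antisymmetrizers -/

/-- The `q`-antisymmetrizers of a family of generators. -/
noncomputable def antisym {A : Type*} [Ring A] [Algebra ℂ A] (q : ℂ) (σ : ℕ → A) : ℕ → ℕ → A
  | 0, _ => 1
  | 1, _ => 1
  | m + 2, j =>
      (qNum q (m + 2))⁻¹ •
        (antisym q σ (m + 1) (j + 1) *
          (q ^ (m + 1) • (1 : A) - qNum q (m + 1) • σ j) * antisym q σ (m + 1) (j + 1))

theorem localRep_antisymmetrizerOn (hR : IsHeckeRMatrix q R) (k : ℕ) : ∀ m j : ℕ,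
    localRep hR k (antisymmetrizerOn q k m j) = antisym q (neighbour k R) m j
  | 0, _ => map_one _
  | 1, _ => map_one _
  | m + 2, j => by
    simp only [antisymmetrizerOn, antisym, map_smul, map_mul, map_sub, map_one,
      localRep_antisymmetrizerOn hR k (m + 1), localRep_heckeGen]

section QNum

theorem sub_inv_ne_zero (hq0 : q ≠ 0) (hq : ∀ m : ℕ, 0 < m → q ^ m ≠ 1) : q - q⁻¹ ≠ 0 := by
  intro h
  refine hq 2 (by omega) ?_
  rw [pow_two]
  nth_rewrite 1 [sub_eq_zero.mp h]
  exact inv_mul_cancel₀ hq0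

theorem qNum_ne_zero (hq0 : q ≠ 0) (hq : ∀ m : ℕ, 0 < m → q ^ m ≠ 1) {m : ℕ} (hm : 0 < m) :
    qNum q m ≠ 0 := by
  refine div_ne_zero (fun h => hq (2 * m) (by omega) ?_) (sub_inv_ne_zero hq0 hq)
  rw [two_mul, pow_add]
  nth_rewrite 1 [sub_eq_zero.mp h]
  rw [← mul_pow, inv_mul_cancel₀ hq0, one_pow]

theorem qNum_succ (hq0 : q ≠ 0) (hq : ∀ m : ℕ, 0 < m → q ^ m ≠ 1) (m : ℕ) :
    qNum q (m + 1) = q ^ m + q⁻¹ * qNum q m := by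
  have h := sub_inv_ne_zero hq0 hq
  rw [qNum, qNum, div_eq_iff h, add_mul, mul_assoc, div_mul_cancel₀ _ h, pow_succ, pow_succ]
  ring

theorem qNum_one (hq0 : q ≠ 0) (hq : ∀ m : ℕ, 0 < m → q ^ m ≠ 1) : qNum q 1 = 1 := by
  rw [qNum, pow_one, pow_one, div_self (sub_inv_ne_zero hq0 hq)]

end QNum

section Antisym

variable {A : Type*} [Ring A] [Algebra ℂ A] {K : ℕ} {σ : ℕ → A}

/-- Here P and Q stand for the antisymmetrizers starting at the second and the third strand, s and t
for the first two generators. Expanding the first P in sPsP by its recursion over Q lets the braid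
relation carry s past t, and t is then absorbed by P with eigenvalue −q⁻¹. What remains is linear in
P, sP and PsP. -/
theorem gen_mul_antisym_aux {s t P Q : A} {a b w : ℂ} (hq0 : q ≠ 0)
    (hs : s * s = (q - q⁻¹) • s + 1) (hst : s * t * s = t * s * t) (hsQ : Commute s Q)
    (hQP : Q * P = P) (hPP : P * P = P) (htP : t * P = (-q⁻¹) • P)
    (hP : a • P = w • Q - b • (Q * t * Q)) :
    s * (P * ((q * w) • 1 - a • s) * P) = (-q⁻¹) • (P * ((q * w) • 1 - a • s) * P) := by
  have h1 : Q * (s * P) = s * P := by rw [← mul_assoc, ← hsQ.eq, mul_assoc, hQP]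
  have h2 : b • (Q * (t * (s * P))) = w • (s * P) - a • (P * (s * P)) := by
    have : Q * (t * (s * P)) = Q * t * Q * (s * P) := by
      rw [mul_assoc, mul_assoc, h1]
    rw [this, ← smul_mul_assoc, show b • (Q * t * Q) = w • Q - a • P by rw [hP]; abel, sub_mul,
      smul_mul_assoc, smul_mul_assoc, h1]
  have h3 : a • (s * (P * (s * P))) =
      w • P + (q * w) • (s * P) - (q⁻¹ * a) • (P * (s * P)) := by
    have e1 : a • (s * (P * (s * P))) = s * ((a • P) * (s * P)) := by
      rw [smul_mul_assoc, mul_smul_comm]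
    have e2 : s * ((Q * t * Q) * (s * P)) = (-q⁻¹) • (Q * (t * (s * P))) := by
      calc s * ((Q * t * Q) * (s * P)) = (s * Q) * t * (Q * (s * P)) := by noncomm_ring
        _ = Q * (s * t * s) * P := by rw [h1, hsQ.eq]; noncomm_ring
        _ = Q * (t * (s * (t * P))) := by rw [hst]; noncomm_ring
        _ = _ := by rw [htP]; simp only [mul_smul_comm]
    have e3 : s * (s * P) = (q - q⁻¹) • (s * P) + P := by
      rw [← mul_assoc, hs, add_mul, smul_mul_assoc, one_mul]
    have e4 : b • ((-q⁻¹) • (Q * (t * (s * P)))) =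
        (-q⁻¹) • (w • (s * P) - a • (P * (s * P))) := by rw [← h2, smul_comm]
    rw [e1, hP, sub_mul, mul_sub, smul_mul_assoc, mul_smul_comm, h1, smul_mul_assoc,
      mul_smul_comm, e2, e3, e4]
    module
  have h5 : P * ((q * w) • 1 - a • s) * P = (q * w) • P - a • (P * (s * P)) := by
    rw [mul_sub, sub_mul, mul_smul_comm, mul_one, smul_mul_assoc, hPP, mul_smul_comm,
      smul_mul_assoc, mul_assoc]
  rw [h5, mul_sub, mul_smul_comm, mul_smul_comm, h3]
  match_scalars <;> field_simp <;> ring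

theorem commute_antisym (hσ : IsHeckeFamily q K σ) {i : ℕ} : ∀ m j : ℕ, i + 2 ≤ j →
    j + m ≤ K + 1 → Commute (σ i) (antisym q σ m j)
  | 0, _, _, _ => Commute.one_right _
  | 1, _, _, _ => Commute.one_right _
  | m + 2, j, hij, hj => by
    have ih := commute_antisym hσ (i := i) (m + 1) (j + 1) (by omega) (by omega)
    rw [antisym]
    exact ((ih.mul_right (((Commute.one_right _).smul_right _).sub_right
      ((hσ.comm i j hij (by omega)).smul_right _))).mul_right ih).smul_right _

/-- Idempotency and the eigenvalue −q⁻¹ are proved together. The generators beyond the first are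
absorbed by the outer factor P. The first one needs the idempotency of the antisymmetrizers one and
two strands shorter. -/
theorem antisym_props (hq0 : q ≠ 0) (hq : ∀ m : ℕ, 0 < m → q ^ m ≠ 1)
    (hσ : IsHeckeFamily q K σ) (m j : ℕ) (hj : j + m ≤ K + 1) :
      antisym q σ m j * antisym q σ m j = antisym q σ m j ∧
        ∀ i, j ≤ i → i + 1 < j + m → σ i * antisym q σ m j = (-q⁻¹) • antisym q σ m j := by
  induction m using Nat.strong_induction_on generalizing j with
  | _ m ih =>
    obtain _ | _ | m := m
    · exact ⟨mul_one _, fun i h1 h2 => by omega⟩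
    · exact ⟨mul_one _, fun i h1 h2 => by omega⟩
    obtain ⟨hP, hPσ⟩ := ih (m + 1) (by omega) (j + 1) (by omega)
    set P := antisym q σ (m + 1) (j + 1) with hPdef
    have hdef : antisym q σ (m + 2) j = (qNum q (m + 2))⁻¹ •
        (P * (q ^ (m + 1) • (1 : A) - qNum q (m + 1) • σ j) * P) := rfl
    have hN : qNum q (m + 2) ≠ 0 := qNum_ne_zero hq0 hq (by omega)
    have hfirst : σ j * antisym q σ (m + 2) j = (-q⁻¹) • antisym q σ (m + 2) j := by
      rw [hdef, mul_smul_comm, smul_comm (-q⁻¹)]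
      congr 1
      have hs := hσ.quad j (by omega)
      obtain _ | m := m
      · have hP1 : P = 1 := rfl
        rw [hP1, qNum_one hq0 hq]
        simp only [one_mul, mul_one, mul_sub, mul_smul_comm, hs]
        match_scalars <;> field_simp <;> ring
      · obtain ⟨hQ, -⟩ := ih (m + 1) (by omega) (j + 2) (by omega)
        have hPQ : P = (qNum q (m + 2))⁻¹ • (antisym q σ (m + 1) (j + 2) *
          (q ^ (m + 1) • (1 : A) - qNum q (m + 1) • σ (j + 1)) *
            antisym q σ (m + 1) (j + 2)) := rfl
        have hcomm := commute_antisym hσ (i := j) (m + 1) (j + 2) le_rfl (by omega)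
        have hQP : antisym q σ (m + 1) (j + 2) * P = P := by
          rw [hPQ, mul_smul_comm, ← mul_assoc, ← mul_assoc, hQ]
        rw [pow_succ' q (m + 1)]
        refine gen_mul_antisym_aux (t := σ (j + 1)) (Q := antisym q σ (m + 1) (j + 2))
          (b := qNum q (m + 1)) hq0 hs (hσ.braid j (by omega)) hcomm hQP hP
          (hPσ (j + 1) le_rfl (by omega)) ?_
        have hN' : qNum q (m + 1 + 1) ≠ 0 := qNum_ne_zero hq0 hq (by omega)
        rw [hPQ, smul_smul, mul_inv_cancel₀ hN', one_smul, mul_sub, sub_mul, mul_smul_comm,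
          mul_one, smul_mul_assoc, hQ, mul_smul_comm, smul_mul_assoc]
    have hall : ∀ i, j ≤ i → i + 1 < j + (m + 2) →
        σ i * antisym q σ (m + 2) j = (-q⁻¹) • antisym q σ (m + 2) j := by
      intro i h1 h2
      rcases Nat.eq_or_lt_of_le h1 with rfl | hlt
      · exact hfirst
      · rw [hdef, mul_smul_comm, smul_comm (-q⁻¹), ← mul_assoc, ← mul_assoc,
          hPσ i hlt (by omega), smul_mul_assoc, smul_mul_assoc]
    refine ⟨?_, hall⟩
    have hPA : P * antisym q σ (m + 2) j = antisym q σ (m + 2) j := by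
      rw [hdef, mul_smul_comm, ← mul_assoc, ← mul_assoc, hP]
    nth_rewrite 1 [hdef]
    rw [smul_mul_assoc, mul_assoc, hPA, mul_assoc, sub_mul, smul_mul_assoc, one_mul,
      smul_mul_assoc, hfirst, smul_smul, ← sub_smul, mul_smul_comm, hPA, smul_smul]
    -- Replacing the first generator by its eigenvalue −q⁻¹ leaves q^{m+1} + q⁻¹(m+1)_q, which is
    -- (m+2)_q: this is what fixes the normalisation in the recursion.
    have : (qNum q (m + 2))⁻¹ * (q ^ (m + 1) - qNum q (m + 1) * -q⁻¹) = 1 := by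
      rw [inv_mul_eq_one₀ hN, qNum_succ hq0 hq (m + 1)]
      ring
    rw [this, one_smul]

end Antisym

/-! ### The partial trace over the first factor -/

theorem neighbour_succ (k j : ℕ) (X : Matrix (Fin n × Fin n) (Fin n × Fin n) ℂ) :
    neighbour (k + 1) X (j + 1) = spread Fin.succ (neighbour k X j) := by
  by_cases h : j < k - 1
  · rw [neighbour, neighbour, dif_pos h, dif_pos (by omega), onSites_eq_spread,
      onSites_eq_spread, spread_spread (Fin.succ_injective k)]
    congr 1
    funext i
    fin_cases i <;> rfl
  · rw [neighbour, neighbour, dif_neg h, dif_neg (by omega)]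
    ext f g
    simp [spread]

theorem antisym_neighbour_succ (k : ℕ) (X : Matrix (Fin n × Fin n) (Fin n × Fin n) ℂ) :
    ∀ m j : ℕ, antisym q (neighbour (k + 1) X) m (j + 1) =
      spreadHom (Fin.succ_injective k) (antisym q (neighbour k X) m j)
  | 0, _ => (map_one _).symm
  | 1, _ => (map_one _).symm
  | m + 2, j => by
    simp only [antisym, map_smul, map_mul, map_sub, map_one,
      antisym_neighbour_succ k X (m + 1) (j + 1), neighbour_succ]
    rfl

/-- The partial trace over the first tensor factor, weighted by `W`. -/
def firstTrace (W : Matrix (Fin n) (Fin n) ℂ) {k : ℕ}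
    (M : Matrix (Fin (k + 1) → Fin n) (Fin (k + 1) → Fin n) ℂ) :
    Matrix (Fin k → Fin n) (Fin k → Fin n) ℂ :=
  Matrix.of fun f g => ∑ x, ∑ y, W y x * M (Fin.cons x f) (Fin.cons y g)

section FirstTrace

variable {k : ℕ} (W : Matrix (Fin n) (Fin n) ℂ)

theorem spread_succ_cons (N : Matrix (Fin k → Fin n) (Fin k → Fin n) ℂ) (x y : Fin n)
    (f g : Fin k → Fin n) :
    spread Fin.succ N (Fin.cons x f : Fin (k + 1) → Fin n) (Fin.cons y g) =
      if x = y then N f g else 0 := by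
  simp only [spread, Matrix.of_apply]
  refine if_congr ⟨fun h => h 0 fun i => Fin.succ_ne_zero i, fun h c hc => ?_⟩ ?_ rfl
  · induction c using Fin.cases with
    | zero => exact h
    | succ c => exact absurd rfl (hc c)
  · rfl

theorem sum_cons (F : (Fin (k + 1) → Fin n) → ℂ) :
    ∑ h, F h = ∑ x : Fin n, ∑ h : Fin k → Fin n, F (Fin.cons x h) := by
  rw [← Fintype.sum_prod_type']
  exact (Fintype.sum_equiv (Fin.consEquiv fun _ : Fin (k + 1) => Fin n) _ _ fun _ => rfl).symm

theorem firstTrace_mul_left (N : Matrix (Fin k → Fin n) (Fin k → Fin n) ℂ)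
    (M : Matrix (Fin (k + 1) → Fin n) (Fin (k + 1) → Fin n) ℂ) :
    firstTrace W (spread Fin.succ N * M) = N * firstTrace W M := by
  ext f g
  simp only [firstTrace, Matrix.of_apply, Matrix.mul_apply, sum_cons, spread_succ_cons, ite_mul,
    zero_mul, Finset.sum_ite_irrel, Finset.sum_const_zero, Finset.sum_ite_eq, Finset.mem_univ,
    if_true, Finset.mul_sum]
  conv_rhs => rw [Finset.sum_comm]
  refine Finset.sum_congr rfl fun x _ => ?_
  conv_rhs => rw [Finset.sum_comm]
  exact Finset.sum_congr rfl fun _ _ => Finset.sum_congr rfl fun _ _ => by ring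

theorem firstTrace_mul_right (N : Matrix (Fin k → Fin n) (Fin k → Fin n) ℂ)
    (M : Matrix (Fin (k + 1) → Fin n) (Fin (k + 1) → Fin n) ℂ) :
    firstTrace W (M * spread Fin.succ N) = firstTrace W M * N := by
  ext f g
  simp only [firstTrace, Matrix.of_apply, Matrix.mul_apply, sum_cons, spread_succ_cons, mul_ite,
    mul_zero, Finset.sum_ite_irrel, Finset.sum_const_zero, Finset.sum_ite_eq', Finset.mem_univ,
    if_true, Finset.mul_sum, Finset.sum_mul]
  conv_rhs => rw [Finset.sum_comm]
  refine Finset.sum_congr rfl fun x _ => ?_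
  conv_rhs => rw [Finset.sum_comm]
  exact Finset.sum_congr rfl fun _ _ => Finset.sum_congr rfl fun _ _ => by ring

theorem firstTrace_sub_smul (a b : ℂ)
    (M N : Matrix (Fin (k + 1) → Fin n) (Fin (k + 1) → Fin n) ℂ) :
    firstTrace W (a • M - b • N) = a • firstTrace W M - b • firstTrace W N := by
  ext f g
  simp only [firstTrace, Matrix.of_apply, Matrix.sub_apply, Matrix.smul_apply, smul_eq_mul,
    mul_sub, Finset.sum_sub_distrib, Finset.mul_sum]
  congr 1 <;> exact Finset.sum_congr rfl fun _ _ => Finset.sum_congr rfl fun _ _ => by ring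

theorem firstTrace_one : firstTrace (k := k) W 1 = W.trace • 1 := by
  ext f g
  rw [← spread_one (e := Fin.succ (n := k))]
  simp only [firstTrace, Matrix.of_apply, spread_succ_cons, mul_ite, mul_zero, Finset.sum_ite_eq,
    Finset.mem_univ, if_true, Matrix.trace, Matrix.diag_apply, Matrix.smul_apply, smul_eq_mul,
    Finset.sum_mul]

end FirstTrace

/-- This is Tr_(1) B₁R₁₂ = I, the flipped form of `trace_matC_mul_block`. -/
theorem firstTrace_neighbour_zero (hΨ : IsSkewInverse R Ψ) (k : ℕ) :
    firstTrace (matB Ψ) (neighbour (k + 1 + 1) R 0) = 1 := by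
  have h0 : neighbour (k + 1 + 1) R 0 = onSites R 0 1 := by
    rw [neighbour, dif_pos (by omega)]; rfl
  ext f g
  rw [h0]
  simp only [firstTrace, Matrix.of_apply]
  have h1 : ∀ x y : Fin n, onSites R (0 : Fin (k + 1 + 1)) 1 (Fin.cons x f) (Fin.cons y g) =
      if ∀ c : Fin k, f c.succ = g c.succ then R (x, f 0) (y, g 0) else 0 := by
    intro x y
    rw [onSites_apply]
    refine if_congr ⟨fun h c => ?_, fun h c hc0 hc1 => ?_⟩ rfl rfl
    · exact h c.succ.succ (Fin.succ_ne_zero _) (by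
        rw [← Fin.succ_zero_eq_one]
        exact fun h => Fin.succ_ne_zero _ (Fin.succ_injective _ h))
    · induction c using Fin.cases with
      | zero => exact absurd rfl hc0
      | succ c =>
        induction c using Fin.cases with
        | zero => exact absurd rfl hc1
        | succ c => exact h c
  have h2 : ∑ x, ∑ y, matB Ψ y x * R (x, f 0) (y, g 0) = if f 0 = g 0 then 1 else 0 := by
    have h3 := trace_matC_mul_block hΨ.flip (f 0) (g 0)
    rw [matC_flip] at h3
    rw [← h3, Finset.sum_comm]
    rfl
  simp only [h1, mul_ite, mul_zero, Finset.sum_ite_irrel, Finset.sum_const_zero, h2]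
  rw [← ite_and, Matrix.one_apply]
  refine if_congr ⟨fun h => ?_, fun h => by simp [h]⟩ rfl rfl
  funext c
  induction c using Fin.cases with
  | zero => exact h.2
  | succ c => exact h.1 c

/-- The trace of `B` is determined by the symmetry rank. -/
theorem HasSymmetryRank.pow_mul_trace_matB {p : ℕ} {hR : IsHeckeRMatrix q R}
    (hp : HasSymmetryRank hR p) (hq0 : q ≠ 0) (hq : ∀ m : ℕ, 0 < m → q ^ m ≠ 1)
    (hΨ : IsSkewInverse R Ψ) : q ^ p * (matB Ψ).trace = qNum q p := by
  obtain ⟨m, rfl⟩ : ∃ m, p = m + 1 := ⟨p - 1, by have := hp.pos; omega⟩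
  set P := antisym q (neighbour (m + 1) R) (m + 1) 0 with hP
  have hPP : P * P = P := (antisym_props hq0 hq (hR.isHeckeFamily hq0 (m + 1)) (m + 1) 0
    (by omega)).1
  have hP0 : P ≠ 0 := by
    intro h
    have h1 := hp.rank_one
    rw [antisymmetrizer, localRep_antisymmetrizerOn, ← hP, h, Matrix.rank_zero] at h1
    exact zero_ne_one h1
  -- A^{(p+1)} is built from A^{(p)} on the last p strands, and the first strand occurs only in the
  -- inner factor. The B-trace over it yields (q^p Tr B − p_q) A^{(p)} = 0, and A^{(p)} ≠ 0 because
  -- its rank is one.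
  have hv := hp.vanish
  rw [antisymmetrizer, localRep_antisymmetrizerOn, antisym, antisym_neighbour_succ, ← hP,
    smul_eq_zero, or_iff_right (inv_ne_zero (qNum_ne_zero hq0 hq (by omega)))] at hv
  have ht := congrArg (firstTrace (matB Ψ)) hv
  have hs : spreadHom (Fin.succ_injective (m + 1)) P = spread Fin.succ P := rfl
  have hz : firstTrace (matB Ψ)
      (0 : Matrix (Fin (m + 1 + 1) → Fin n) (Fin (m + 1 + 1) → Fin n) ℂ) = 0 := by
    ext f g; simp [firstTrace]
  rw [hs, firstTrace_mul_right, firstTrace_mul_left, firstTrace_sub_smul, firstTrace_one,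
    firstTrace_neighbour_zero hΨ, smul_smul, ← sub_smul, mul_smul_comm, mul_one, smul_mul_assoc,
    hPP, hz, smul_eq_zero, or_iff_left hP0] at ht
  exact sub_eq_zero.mp ht

/-- Inserting Tr C = Tr B = q^{-p} p_q gives 1 − q^{-p}(q^p − q^{-p}) = q^{-2p}. -/
theorem HasSymmetryRank.matB_mul_matC {p : ℕ} {hR : IsHeckeRMatrix q R}
    (hp : HasSymmetryRank hR p) (hq0 : q ≠ 0) (hq : ∀ m : ℕ, 0 < m → q ^ m ≠ 1)
    (hΨ : IsSkewInverse R Ψ) : matB Ψ * matC Ψ = q ^ (-2 * (p : ℤ)) • 1 := by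
  rw [ReflectionEq.matB_mul_matC hR hq0 hΨ, ← trace_matB]
  congr 1
  have h := hp.pow_mul_trace_matB hq0 hq hΨ
  rw [qNum, eq_div_iff (sub_inv_ne_zero hq0 hq)] at h
  have hqp : q ^ p ≠ 0 := pow_ne_zero _ hq0
  have h1 : q ^ (-2 * (p : ℤ)) = (q ^ p)⁻¹ * (q ^ p)⁻¹ := by
    rw [neg_mul, two_mul, zpow_neg, zpow_add₀ hq0, mul_inv, zpow_natCast]
  rw [h1]
  rw [inv_pow] at h
  refine mul_left_cancel₀ hqp ?_
  rw [← mul_assoc, mul_inv_cancel₀ hqp, one_mul]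
  linear_combination -h

end ReflectionEq

namespace ReflectionEq

/-! ### The reflection equation for braided sums -/

section Reflection

variable {A : Type*} [Ring A] [Algebra ℂ A] {q : ℂ} {K : ℕ} {r : ℕ → A} {L₀ R : A}

/-- The hypotheses say that R acts on X, from either side, as r⁻¹ does. Consequently both products
with R collapse to rXr + X. -/
theorem commute_reflection_cross {r X R : A} {c : ℂ} (hr : r * (r + c • 1) = 1)
    (hRr : Commute R r) (h1 : R * X = (r + c • 1) * X) (h2 : X * R = X * (r + c • 1)) :
    Commute R (X * r + r * X - c • (r * X * r)) := by
  have hr' : (r + c • 1) * r = 1 := by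
    refine Eq.trans ?_ hr
    simp only [add_mul, mul_add, smul_mul_assoc, one_mul, mul_smul_comm, mul_one]
  have e1 : R * (r * X) = X := by
    rw [← mul_assoc, hRr.eq, mul_assoc, h1, ← mul_assoc, hr, one_mul]
  have e2 : X * r * R = X := by
    rw [mul_assoc, ← hRr.eq, ← mul_assoc, h2, mul_assoc, hr', mul_one]
  have l : R * (X * r + r * X - c • (r * X * r)) = r * X * r + X := by
    rw [mul_sub, mul_add, e1, ← mul_assoc, h1, mul_smul_comm, ← mul_assoc R, e1, add_mul, add_mul,
      smul_mul_assoc, one_mul, smul_mul_assoc]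
    abel
  have l' : (X * r + r * X - c • (r * X * r)) * R = r * X * r + X := by
    rw [sub_mul, add_mul, e2, mul_assoc r X R, h2, smul_mul_assoc, mul_assoc r X r,
      mul_assoc r (X * r) R, e2, mul_add, mul_add, mul_smul_comm, mul_smul_comm, mul_one,
      ← mul_assoc]
    abel
  rw [Commute, SemiconjBy, l, l']

/-- Conjugation by two braid generators shifts the cross term by one tensor factor, which reduces
its properties to the first pair of factors. -/
theorem reflection_cross_step (hr : IsHeckeFamily q⁻¹ K r) (hRr : ∀ i < K, Commute R (r i))
    (hL : ∀ j, 1 ≤ j → j < K → Commute (r j) L₀) {s : ℕ} (hs : s + 1 < K) :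
    conjTower r L₀ (s + 1) * R * r (s + 1) * conjTower r L₀ (s + 1) =
      r s * r (s + 1) * (conjTower r L₀ s * R * r s * conjTower r L₀ s) * (r (s + 1) * r s) := by
  have hc := (hr.commute_conjTower_of_lt hL (Nat.lt_succ_self s) hs).eq
  have hb := hr.braid s hs
  have hR0 := (hRr s (by omega)).eq
  have hR1 := (hRr (s + 1) hs).eq
  simp only [Nat.succ_eq_add_one] at hc
  rw [conjTower_succ]
  calc r s * conjTower r L₀ s * r s * R * r (s + 1) * (r s * conjTower r L₀ s * r s)
      = r s * conjTower r L₀ s * (r s * R) * r (s + 1) * r s * conjTower r L₀ s * r s := by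
        noncomm_ring
    _ = r s * conjTower r L₀ s * R * (r s * r (s + 1) * r s) * conjTower r L₀ s * r s := by
        rw [← hR0]; noncomm_ring
    _ = r s * conjTower r L₀ s * (R * r (s + 1)) * r s * (r (s + 1) * conjTower r L₀ s) * r s := by
        rw [hb]; noncomm_ring
    _ = r s * (r (s + 1) * conjTower r L₀ s) * R * r s * conjTower r L₀ s * r (s + 1) * r s := by
        rw [hR1, hc]; noncomm_ring
    _ = _ := by noncomm_ring

/-- The product `r s * r (s + 1)` carries `r s` to `r (s + 1)` by the braid relation and commutes
with R. The property that R acts on the cross term as r⁻¹ is thereby transported along the tower. -/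
theorem reflection_cross (hr : IsHeckeFamily q⁻¹ K r) (hRr : ∀ i < K, Commute R (r i))
    (hL : ∀ j, 1 ≤ j → j < K → Commute (r j) L₀)
    (h1 : 0 < K → R * (L₀ * R * r 0 * L₀) = (r 0 + (q - q⁻¹) • 1) * (L₀ * R * r 0 * L₀))
    (h2 : 0 < K → (L₀ * R * r 0 * L₀) * R = (L₀ * R * r 0 * L₀) * (r 0 + (q - q⁻¹) • 1))
    {s : ℕ} (hs : s < K) :
    R * (conjTower r L₀ s * R * r s * conjTower r L₀ s) =
        (r s + (q - q⁻¹) • 1) * (conjTower r L₀ s * R * r s * conjTower r L₀ s) ∧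
      (conjTower r L₀ s * R * r s * conjTower r L₀ s) * R =
        (conjTower r L₀ s * R * r s * conjTower r L₀ s) * (r s + (q - q⁻¹) • 1) := by
  induction s with
  | zero => exact ⟨h1 hs, h2 hs⟩
  | succ s ih =>
    obtain ⟨i1, i2⟩ := ih (by omega)
    rw [reflection_cross_step hr hRr hL hs]
    set X := conjTower r L₀ s * R * r s * conjTower r L₀ s
    have hb := hr.braid s hs
    have hR : Commute R (r s * r (s + 1)) := (hRr s (by omega)).mul_right (hRr (s + 1) hs)
    have hR' : Commute R (r (s + 1) * r s) := (hRr (s + 1) hs).mul_right (hRr s (by omega))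
    have b1 : r s * r (s + 1) * (r s + (q - q⁻¹) • 1) =
        (r (s + 1) + (q - q⁻¹) • 1) * (r s * r (s + 1)) := by
      rw [mul_add, hb, add_mul, mul_smul_comm, mul_one, smul_mul_assoc, one_mul, mul_assoc]
    have b2 : (r s + (q - q⁻¹) • 1) * (r (s + 1) * r s) =
        (r (s + 1) * r s) * (r (s + 1) + (q - q⁻¹) • 1) := by
      rw [add_mul, ← mul_assoc, hb, mul_add, mul_smul_comm, mul_one, smul_mul_assoc, one_mul]
    constructor
    · calc R * (r s * r (s + 1) * X * (r (s + 1) * r s))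
          = (R * (r s * r (s + 1))) * X * (r (s + 1) * r s) := by noncomm_ring
        _ = r s * r (s + 1) * (R * X) * (r (s + 1) * r s) := by rw [hR.eq]; noncomm_ring
        _ = (r s * r (s + 1) * (r s + (q - q⁻¹) • 1)) * X * (r (s + 1) * r s) := by
          rw [i1]; simp only [mul_assoc]
        _ = _ := by rw [b1]; simp only [mul_assoc]
    · calc r s * r (s + 1) * X * (r (s + 1) * r s) * R
          = r s * r (s + 1) * X * (r (s + 1) * r s * R) := by simp only [mul_assoc]
        _ = r s * r (s + 1) * (X * R) * (r (s + 1) * r s) := by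
          rw [← hR'.eq]; simp only [mul_assoc]
        _ = r s * r (s + 1) * X * ((r s + (q - q⁻¹) • 1) * (r (s + 1) * r s)) := by
          rw [i2]; simp only [mul_assoc]
        _ = _ := by rw [b2]; simp only [mul_assoc]

/-- The expression is the increment of SRS − S when the summand at level `s` is added to the partial
sum S. At level 0 it vanishes by L₀RL₀ = L₀. -/
theorem commute_reflection_defect (hr : IsHeckeFamily q⁻¹ K r) (hRr : ∀ i < K, Commute R (r i))
    (hL : ∀ j, 1 ≤ j → j < K → Commute (r j) L₀) (h0 : L₀ * R * L₀ = L₀)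
    (h1 : 0 < K → R * (L₀ * R * r 0 * L₀) = (r 0 + (q - q⁻¹) • 1) * (L₀ * R * r 0 * L₀))
    (h2 : 0 < K → (L₀ * R * r 0 * L₀) * R = (L₀ * R * r 0 * L₀) * (r 0 + (q - q⁻¹) • 1))
    {s : ℕ} (hs : s ≤ K) :
    Commute R (conjTower r L₀ s * R * conjTower r L₀ s - conjTower r L₀ s +
      (∑ t ∈ Finset.range s, conjTower r L₀ t) * R * conjTower r L₀ s +
      conjTower r L₀ s * R * ∑ t ∈ Finset.range s, conjTower r L₀ t) := by
  induction s with
  | zero => simp [conjTower, h0]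
  | succ s ih =>
    have ih := ih (by omega)
    obtain ⟨c1, c2⟩ := reflection_cross hr hRr hL h1 h2 (show s < K by omega)
    have hq := hr.quad s (by omega)
    rw [inv_inv] at hq
    have hinv : r s * (r s + (q - q⁻¹) • 1) = 1 := by
      rw [mul_add, hq, mul_smul_comm, mul_one]
      module
    have hW := commute_reflection_cross hinv (hRr s (by omega)) c1 c2
    have hR := hRr s (by omega)
    have hM : Commute (r s) (∑ t ∈ Finset.range s, conjTower r L₀ t) :=
      Commute.sum_right _ _ _ fun t ht =>
        hr.commute_conjTower_of_lt hL (Finset.mem_range.mp ht) (by omega)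
    rw [Finset.sum_range_succ, conjTower_succ]
    set L := conjTower r L₀ s
    set S := ∑ t ∈ Finset.range s, conjTower r L₀ t
    set ρ := r s
    -- The increment at level `s + 1` is the previous one conjugated by ρ, plus the interaction of
    -- the two adjacent levels. The last term comes from ρ² = 1 − (q − q⁻¹)ρ, and the interaction
    -- has the shape treated in `commute_reflection_cross`.
    have key : ρ * L * ρ * R * (ρ * L * ρ) - ρ * L * ρ + (S + L) * R * (ρ * L * ρ) +
        ρ * L * ρ * R * (S + L) =
        ρ * (L * R * L - L + S * R * L + L * R * S) * ρ +
          (L * R * ρ * L * ρ + ρ * (L * R * ρ * L) -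
            (q - q⁻¹) • (ρ * (L * R * ρ * L) * ρ)) := by
      have e1 : ρ * L * ρ * R * (ρ * L * ρ) = ρ * (L * R * L) * ρ -
          (q - q⁻¹) • (ρ * (L * R * ρ * L) * ρ) := by
        calc ρ * L * ρ * R * (ρ * L * ρ) = ρ * L * (ρ * R) * ρ * L * ρ := by noncomm_ring
          _ = ρ * L * R * (ρ * ρ) * L * ρ := by rw [← hR.eq]; noncomm_ring
          _ = _ := by
            rw [hq]
            simp only [mul_add, add_mul, smul_mul_assoc, mul_smul_comm, mul_one, mul_assoc]
            module
      have e2 : S * R * (ρ * L * ρ) = ρ * (S * R * L) * ρ := by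
        calc S * R * (ρ * L * ρ) = S * (R * ρ) * L * ρ := by noncomm_ring
          _ = (S * ρ) * R * L * ρ := by rw [hR.eq]; noncomm_ring
          _ = _ := by rw [← hM.eq]; noncomm_ring
      have e3 : ρ * L * ρ * R * S = ρ * (L * R * S) * ρ := by
        calc ρ * L * ρ * R * S = ρ * L * (ρ * R) * S := by noncomm_ring
          _ = ρ * L * R * (ρ * S) := by rw [← hR.eq]; noncomm_ring
          _ = _ := by rw [hM.eq]; noncomm_ring
      have e4 : ρ * L * ρ * R * L = ρ * (L * R * ρ * L) := by
        calc ρ * L * ρ * R * L = ρ * L * (ρ * R) * L := by noncomm_ring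
          _ = _ := by rw [← hR.eq]; noncomm_ring
      have e5 : L * R * (ρ * L * ρ) = L * R * ρ * L * ρ := by noncomm_ring
      rw [add_mul S L R, add_mul (S * R), mul_add (ρ * L * ρ * R), e1, e2, e3, e4, e5]
      simp only [mul_add, add_mul, mul_sub, sub_mul]
      abel
    rw [key]
    exact ((hR.mul_right ih).mul_right hR).add_right hW

/-- A braided sum of solutions of the reflection equation is again a solution. -/
theorem reflection_sum_conjTower (hr : IsHeckeFamily q⁻¹ K r) (hRr : ∀ i < K, Commute R (r i))
    (hL : ∀ j, 1 ≤ j → j < K → Commute (r j) L₀) (h0 : L₀ * R * L₀ = L₀)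
    (h1 : 0 < K → R * (L₀ * R * r 0 * L₀) = (r 0 + (q - q⁻¹) • 1) * (L₀ * R * r 0 * L₀))
    (h2 : 0 < K → (L₀ * R * r 0 * L₀) * R = (L₀ * R * r 0 * L₀) * (r 0 + (q - q⁻¹) • 1))
    {L : A} (hLdef : L = ∑ s ∈ Finset.range (K + 1), conjTower r L₀ s) :
    R * L * R * L - L * R * L * R = R * L - L * R := by
  have key : ∀ s ≤ K + 1, Commute R ((∑ t ∈ Finset.range s, conjTower r L₀ t) * R *
      (∑ t ∈ Finset.range s, conjTower r L₀ t) - ∑ t ∈ Finset.range s, conjTower r L₀ t) := by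
    intro s hs
    induction s with
    | zero => simp
    | succ s ih =>
      have hd := commute_reflection_defect hr hRr hL h0 h1 h2 (show s ≤ K by omega)
      convert (ih (by omega)).add_right hd using 1
      rw [Finset.sum_range_succ]
      noncomm_ring
  have h := (key (K + 1) le_rfl).eq
  rw [← hLdef, mul_sub, sub_mul] at h
  have e1 : R * L * R * L = R * (L * R * L) := by noncomm_ring
  rw [e1, sub_eq_sub_iff_sub_eq_sub, h]

end Reflection

variable {n : ℕ} {q : ℂ} {R Ψ : Matrix (Fin n × Fin n) (Fin n × Fin n) ℂ}

/-! ### Generators acting on tensor powers -/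

theorem onSite_eq_spread {k : ℕ} (X : Matrix (Fin n) (Fin n) ℂ) (a : Fin k) :
    onSite X a = spread ![a] (X.submatrix (fun f => f 0) fun f => f 0) := by
  ext f g
  simp only [onSite, spread, Matrix.of_apply, Matrix.submatrix_apply]
  refine if_congr (forall_congr' fun c => ?_) rfl rfl
  simp only [Fin.forall_fin_one, Matrix.cons_val_fin_one]
  exact ⟨fun h h1 => h (Ne.symm h1), fun h h1 => h (Ne.symm h1)⟩

theorem onSite_eq_sitesHom {k : ℕ} (X : Matrix (Fin n) (Fin n) ℂ) {a b : Fin k} (h : a ≠ b) :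
    onSite X a = sitesHom h (X ⊗ₖ 1) := by
  rw [sitesHom_apply]
  ext f g
  rw [onSites_apply, Matrix.kroneckerMap_apply, Matrix.one_apply, mul_ite, mul_one, mul_zero,
    ← ite_and]
  simp only [onSite, Matrix.of_apply]
  refine if_congr ⟨fun hf => ⟨fun c h1 _ => hf c h1, hf b h.symm⟩, fun hf c hc => ?_⟩ rfl rfl
  by_cases hcb : c = b
  · rw [hcb]; exact hf.2
  · exact hf.1 c hc hcb

theorem onSite_mul {k : ℕ} (X Y : Matrix (Fin n) (Fin n) ℂ) (a : Fin k) :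
    onSite X a * onSite Y a = onSite (X * Y) a := by
  rw [onSite_eq_spread, onSite_eq_spread, onSite_eq_spread,
    spread_mul (Function.injective_of_subsingleton _)]
  congr 1
  exact (Matrix.submatrix_mul_equiv X Y _ (Equiv.funUnique (Fin 1) (Fin n)) _)

theorem onSite_smul {k : ℕ} (c : ℂ) (X : Matrix (Fin n) (Fin n) ℂ) (a : Fin k) :
    onSite (c • X) a = c • onSite X a := by
  ext f g
  simp only [onSite, Matrix.of_apply, Matrix.smul_apply]
  split_ifs <;> simp

theorem onSite_zero_commute_neighbour {k : ℕ} [NeZero k] (X : Matrix (Fin n) (Fin n) ℂ)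
    (Y : Matrix (Fin n × Fin n) (Fin n × Fin n) ℂ) {j : ℕ} (hj : 1 ≤ j) (hj' : j < k - 1) :
    Commute (neighbour k Y j) (onSite X (0 : Fin k)) := by
  rw [neighbour, dif_pos hj', onSites_eq_spread, onSite_eq_spread]
  refine spread_comm (pair_injective (by simp)) (Function.injective_of_subsingleton _) ?_ _ _
  intro i i'
  fin_cases i <;> simp [Fin.ext_iff]
  omega

/-- Each of these matrices is a column of B times a unit row, so a product of two contracts to a
single entry of B. -/
theorem piT_mul_piT (Ψ : Matrix (Fin n × Fin n) (Fin n × Fin n) ℂ) (i j x y : Fin n) :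
    piT Ψ y j * piT Ψ i x = matB Ψ y x • piT Ψ i j := by
  ext k m
  simp only [piT, Matrix.mul_apply, Matrix.of_apply, Matrix.smul_apply, smul_eq_mul, ite_mul,
    zero_mul, Finset.sum_ite_eq', Finset.mem_univ, if_true]
  split_ifs <;> ring

theorem IsHeckeFamily.transpose {ι : Type*} [Fintype ι] [DecidableEq ι] {K : ℕ}
    {σ : ℕ → Matrix ι ι ℂ} (h : IsHeckeFamily q K σ) :
    IsHeckeFamily q K fun i => (σ i).transpose where
  quad i hi := by
    rw [← Matrix.transpose_mul, h.quad i hi, Matrix.transpose_add, Matrix.transpose_smul,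
      Matrix.transpose_one]
  braid i hi := by
    simp only [← Matrix.transpose_mul, ← mul_assoc, h.braid i hi]
  comm i j hij hj := by
    rw [Commute, SemiconjBy, ← Matrix.transpose_mul, ← Matrix.transpose_mul, (h.comm i j hij hj).eq]

theorem rhoTerm_transpose (R Ψ : Matrix (Fin n × Fin n) (Fin n × Fin n) ℂ) (k : ℕ) [NeZero k]
    (i j : Fin n) (s : ℕ) : (rhoTerm R Ψ k i j s).transpose =
      conjTower (fun s => (neighbour k R⁻¹ s).transpose)
        (onSite (piT Ψ i j) (0 : Fin k)).transpose s := by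
  induction s with
  | zero => rfl
  | succ s ih =>
    rw [rhoTerm, conjTower, ← ih, Matrix.transpose_mul, Matrix.transpose_mul, mul_assoc]

theorem rhoTerm_eq (R Ψ : Matrix (Fin n × Fin n) (Fin n × Fin n) ℂ) (k : ℕ) [NeZero k]
    (i j : Fin n) (s : ℕ) : rhoTerm R Ψ k i j s =
      conjTower (neighbour k R⁻¹) (onSite (piT Ψ i j) (0 : Fin k)) s := by
  induction s with
  | zero => rfl
  | succ s ih => rw [rhoTerm, conjTower, ← ih]

theorem sum_matB_mul (hΨ : IsSkewInverse R Ψ) (a b : Fin n) :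
    ∑ x, ∑ y, R (x, a) (y, b) * matB Ψ y x = if a = b then 1 else 0 := by
  rw [← trace_matC_mul_block hΨ.flip a b, matC_flip, Finset.sum_comm]
  exact Finset.sum_congr rfl fun _ _ => Finset.sum_congr rfl fun _ _ => mul_comm _ _

theorem sum_matB_mul_inv (hR : IsHeckeRMatrix q R) (hq0 : q ≠ 0) (hΨ : IsSkewInverse R Ψ)
    (a b c d : Fin n) :
    ∑ x, ∑ y, ∑ z, R (x, a) (y, b) * (R⁻¹ (y, c) (z, d) * matB Ψ z x) =
      if a = d then matB Ψ c b else 0 := by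
  have h := trace_matC_mul_inv hR.flip hq0 hΨ.flip a b c d
  rw [matC_flip, flip_inv hR hq0] at h
  rw [← h]
  simp only [Matrix.trace, Matrix.diag_apply, Matrix.mul_apply, Finset.mul_sum]
  have e : ∀ F : Fin n → Fin n → Fin n → ℂ,
      ∑ x, ∑ y, ∑ z, F x y z = ∑ z, ∑ x, ∑ y, F x y z := by
    intro F
    rw [Finset.sum_comm]
    conv_rhs => rw [Finset.sum_comm]
    rw [Finset.sum_comm]
    exact Finset.sum_congr rfl fun _ _ => Finset.sum_comm
  rw [e]
  refine Finset.sum_congr rfl fun _ _ => Finset.sum_congr rfl fun _ _ =>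
    Finset.sum_congr rfl fun _ _ => ?_
  simp only [block_apply, flip, Matrix.submatrix_apply, Prod.swap_prod_mk]
  ring

section Aux

variable {A : Type*} [Ring A]

theorem map_algebraMap_commute_scalar [Algebra ℂ A] (R : Matrix (Fin n × Fin n) (Fin n × Fin n) ℂ) (x : A) :
    Commute (R.map (algebraMap ℂ A)) (Matrix.scalar (Fin n × Fin n) x) := by
  rw [Commute, SemiconjBy]
  ext i j
  rw [Matrix.scalar_apply, Matrix.mul_diagonal, Matrix.diagonal_mul, Matrix.map_apply,
    Algebra.commutes]

theorem conjTower_scalar (r : ℕ → A) (L : Matrix (Fin n) (Fin n) A) (s : ℕ) :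
    conjTower (fun i => Matrix.scalar (Fin n × Fin n) (r i)) (L ⊗ₖ (1 : Matrix (Fin n) (Fin n) A))
      s = (Matrix.of fun i j => conjTower r (L i j) s) ⊗ₖ (1 : Matrix (Fin n) (Fin n) A) := by
  induction s with
  | zero => rfl
  | succ s ih =>
    rw [conjTower_succ, ih]
    ext ⟨i, a⟩ ⟨j, b⟩
    rw [Matrix.scalar_apply, Matrix.mul_diagonal, Matrix.diagonal_mul]
    simp only [Matrix.kroneckerMap_apply, Matrix.of_apply, conjTower_succ, Matrix.one_apply]
    split_ifs <;> simp

/-- Entries of `L₁ X L₁'`. -/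
theorem kronecker_one_mul_mul_apply (L L' : Matrix (Fin n) (Fin n) A)
    (X : Matrix (Fin n × Fin n) (Fin n × Fin n) A) (i a j b : Fin n) :
    (L ⊗ₖ (1 : Matrix (Fin n) (Fin n) A) * X * L' ⊗ₖ (1 : Matrix (Fin n) (Fin n) A)) (i, a) (j, b)
      = ∑ x, ∑ y, L i x * X (x, a) (y, b) * L' y j := by
  simp only [Matrix.mul_apply, Fintype.sum_prod_type, Matrix.kroneckerMap_apply, Matrix.one_apply,
    mul_ite, ite_mul, mul_one, mul_zero, zero_mul, Finset.sum_ite_eq, Finset.sum_ite_eq',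
    Finset.mem_univ, if_true, Finset.sum_mul]
  exact Finset.sum_comm

end Aux

end ReflectionEq

namespace ReflectionEq

variable {n : ℕ} {q : ℂ} {R Ψ : Matrix (Fin n × Fin n) (Fin n × Fin n) ℂ}

/-! ### The representation in the tensor powers -/

/-- The matrix of the operators by which the generators act in the first tensor factor. -/
noncomputable def firstL (Ψ : Matrix (Fin n × Fin n) (Fin n × Fin n) ℂ) (k : ℕ) [NeZero k] :
    Matrix (Fin n) (Fin n) (Matrix (Fin k → Fin n) (Fin k → Fin n) ℂ) :=
  Matrix.of fun i j => (onSite (piT Ψ i j) (0 : Fin k)).transpose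

theorem firstL_mul_firstL (Ψ : Matrix (Fin n × Fin n) (Fin n × Fin n) ℂ) (k : ℕ) [NeZero k]
    (i x y j : Fin n) : firstL Ψ k i x * firstL Ψ k y j = matB Ψ y x • firstL Ψ k i j := by
  simp only [firstL, Matrix.of_apply]
  rw [← Matrix.transpose_mul, onSite_mul, piT_mul_piT, onSite_smul, Matrix.transpose_smul]

/-- The products of generators on V contribute entries of B, which contract with R to the identity
by `sum_matB_mul`. This is stronger than the reflection equation: the difference L₁RL₁ − L₁ itself
vanishes. -/
theorem firstL_reflection (hΨ : IsSkewInverse R Ψ) (k : ℕ) [NeZero k] :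
    firstL Ψ k ⊗ₖ (1 : Matrix (Fin n) (Fin n) (Matrix (Fin k → Fin n) (Fin k → Fin n) ℂ)) *
        R.map (algebraMap ℂ _) * firstL Ψ k ⊗ₖ 1 = firstL Ψ k ⊗ₖ 1 := by
  ext1 ⟨i, a⟩ ⟨j, b⟩
  rw [kronecker_one_mul_mul_apply]
  have h : ∀ x y, firstL Ψ k i x * (R.map (algebraMap ℂ _)) (x, a) (y, b) * firstL Ψ k y j =
      (R (x, a) (y, b) * matB Ψ y x) • firstL Ψ k i j := by
    intro x y
    rw [Matrix.map_apply, ← Algebra.commutes, mul_assoc, firstL_mul_firstL, ← Algebra.smul_def,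
      smul_smul]
  simp only [h, ← Finset.sum_smul, sum_matB_mul hΨ]
  rw [Matrix.kroneckerMap_apply, Matrix.one_apply]
  split_ifs <;> simp

/-- The matrix units weighted by `B ⊗ B` that describe the braided square of the generators. -/
def crossUnit (Ψ : Matrix (Fin n × Fin n) (Fin n × Fin n) ℂ) (s t : Fin n × Fin n) :
    Matrix (Fin n × Fin n) (Fin n × Fin n) ℂ :=
  Matrix.of fun f g => if g = s then (matB Ψ ⊗ₖ matB Ψ) f t else 0

theorem sum_smul_crossUnit (R Ψ : Matrix (Fin n × Fin n) (Fin n × Fin n) ℂ)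
    (s t : Fin n × Fin n) : ∑ u, R s u • crossUnit Ψ u t = crossUnit Ψ s t * R := by
  ext f g
  simp only [Matrix.sum_apply, Matrix.smul_apply, crossUnit, Matrix.of_apply, smul_eq_mul,
    mul_ite, mul_zero, Finset.sum_ite_eq, Finset.mem_univ, if_true, Matrix.mul_apply, ite_mul,
    zero_mul, Finset.sum_ite_eq']
  ring

/-- Together with `sum_smul_crossUnit`, this turns the action of R on the auxiliary indices into
multiplication by R in V ⊗ V. On this side the exchange requires that B ⊗ B commutes with R. -/
theorem sum_crossUnit_smul (hR : IsHeckeRMatrix q R) (hq0 : q ≠ 0) (hΨ : IsSkewInverse R Ψ)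
    (s t : Fin n × Fin n) : ∑ u, R u t • crossUnit Ψ s u = R * crossUnit Ψ s t := by
  ext f g
  have h := congrFun (congrFun (matB_kronecker_commute hR hq0 hΨ).eq f) t
  rw [Matrix.mul_apply, Matrix.mul_apply] at h
  simp only [Matrix.sum_apply, Matrix.smul_apply, crossUnit, Matrix.of_apply, smul_eq_mul,
    mul_ite, mul_zero, Matrix.mul_apply]
  by_cases hg : g = s
  · simp only [hg, if_true]
    rw [← h]
    exact Finset.sum_congr rfl fun _ _ => mul_comm _ _
  · simp only [hg, if_false]

theorem sum_smul_piT_mul (hR : IsHeckeRMatrix q R) (hq0 : q ≠ 0) (hΨ : IsSkewInverse R Ψ)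
    (i a j b : Fin n) :
    ∑ x, ∑ y, R (x, a) (y, b) • (piT Ψ y j ⊗ₖ (1 : Matrix (Fin n) (Fin n) ℂ) * R⁻¹ *
      piT Ψ i x ⊗ₖ (1 : Matrix (Fin n) (Fin n) ℂ)) = crossUnit Ψ (i, a) (j, b) := by
  ext ⟨k, c⟩ ⟨m, d⟩
  have h := sum_matB_mul_inv hR hq0 hΨ a b c d
  simp only [Matrix.sum_apply, Matrix.smul_apply, kronecker_one_mul_mul_apply, piT, crossUnit,
    Matrix.of_apply, smul_eq_mul, ite_mul, mul_ite, zero_mul, mul_zero, Prod.mk.injEq,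
    Matrix.kroneckerMap_apply, Finset.sum_ite_irrel, Finset.sum_const_zero]
  by_cases hm : m = i
  · simp only [hm, if_true, true_and]
    have e : ∀ x y, R (x, a) (y, b) *
        ∑ u, (if u = y then ∑ v, matB Ψ k j * R⁻¹ (u, c) (v, d) * matB Ψ v x else 0) =
        matB Ψ k j * ∑ z, R (x, a) (y, b) * (R⁻¹ (y, c) (z, d) * matB Ψ z x) := by
      intro x y
      rw [Finset.sum_ite_eq', if_pos (Finset.mem_univ _), Finset.mul_sum, Finset.mul_sum]
      exact Finset.sum_congr rfl fun _ _ => by ring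
    have h' : ∑ x, ∑ y, matB Ψ k j * ∑ z, R (x, a) (y, b) * (R⁻¹ (y, c) (z, d) * matB Ψ z x) =
        matB Ψ k j * if a = d then matB Ψ c b else 0 := by
      rw [← h]
      simp only [Finset.mul_sum]
    simp only [e]
    rw [h', mul_ite, mul_zero]
    exact if_congr eq_comm rfl rfl
  · simp [hm]

theorem scalar_mul_apply {A ι : Type*} [Ring A] [Fintype ι] [DecidableEq ι] (x : A)
    (N : Matrix ι ι A) (s t : ι) : (Matrix.scalar ι x * N) s t = x * N s t := by
  rw [Matrix.scalar_apply, Matrix.diagonal_mul]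

theorem mul_scalar_apply {A ι : Type*} [Ring A] [Fintype ι] [DecidableEq ι] (x : A)
    (N : Matrix ι ι A) (s t : ι) : (N * Matrix.scalar ι x) s t = N s t * x := by
  rw [Matrix.scalar_apply, Matrix.mul_diagonal]

theorem scalar_neighbour_inv {k : ℕ} (hR : IsHeckeRMatrix q R) (hq0 : q ≠ 0) (hk : 0 < k - 1) :
    Matrix.scalar (Fin n × Fin n) (neighbour k R⁻¹ 0).transpose + (q - q⁻¹) • 1 =
      Matrix.scalar (Fin n × Fin n) (neighbourHom hk R).transpose := by
  rw [neighbour_inv hR hq0 hk, neighbourHom_apply, Matrix.transpose_sub, map_sub,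
    Matrix.transpose_smul, Matrix.transpose_one]
  have : Matrix.scalar (Fin n × Fin n)
      ((q - q⁻¹) • (1 : Matrix (Fin k → Fin n) (Fin k → Fin n) ℂ)) = (q - q⁻¹) • 1 := by
    ext1 s t
    rw [Matrix.scalar_apply, Matrix.diagonal_apply, Matrix.smul_apply, Matrix.one_apply]
    split_ifs <;> simp
  rw [this, sub_add_cancel]

section Cross

variable {k : ℕ} [NeZero k]

/-- The cross term of the first two tensor factors is computed entry by entry. Its auxiliary indices
become the indices of a weighted matrix unit, so that R on the auxiliary space acts as R₁₂ on
V^{⊗k}, which is the input required by `reflection_cross`. -/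
theorem firstL_cross (hR : IsHeckeRMatrix q R) (hq0 : q ≠ 0) (hΨ : IsSkewInverse R Ψ)
    (hk : 0 < k - 1) (s t : Fin n × Fin n) :
    (firstL Ψ k ⊗ₖ (1 : Matrix (Fin n) (Fin n) (Matrix (Fin k → Fin n) (Fin k → Fin n) ℂ)) *
        R.map (algebraMap ℂ (Matrix (Fin k → Fin n) (Fin k → Fin n) ℂ)) *
        Matrix.scalar (Fin n × Fin n) (neighbour k R⁻¹ 0).transpose *
        firstL Ψ k ⊗ₖ (1 : Matrix (Fin n) (Fin n) (Matrix (Fin k → Fin n) (Fin k → Fin n) ℂ)) :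
        Matrix (Fin n × Fin n) (Fin n × Fin n) (Matrix (Fin k → Fin n) (Fin k → Fin n) ℂ)) s t =
      (neighbourHom hk (crossUnit Ψ s t)).transpose := by
  obtain ⟨i, a⟩ := s
  obtain ⟨j, b⟩ := t
  rw [mul_assoc (firstL Ψ k ⊗ₖ _), kronecker_one_mul_mul_apply, ← sum_smul_piT_mul hR hq0 hΨ]
  simp only [map_sum, map_smul, map_mul, Matrix.transpose_sum, Matrix.transpose_smul,
    Matrix.transpose_mul]
  refine Finset.sum_congr rfl fun x _ => Finset.sum_congr rfl fun y _ => ?_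
  have h0 : (0 : Fin k) = ⟨0, by omega⟩ := Fin.ext (by simp)
  have e : ∀ X : Matrix (Fin n) (Fin n) ℂ, neighbourHom hk (X ⊗ₖ 1) = onSite X (0 : Fin k) := by
    intro X
    rw [h0]
    exact (onSite_eq_sitesHom X _).symm
  rw [e, e, neighbourHom_apply, mul_scalar_apply, Matrix.map_apply,
    ← mul_assoc, ← Algebra.commutes, mul_assoc, mul_assoc, ← Algebra.smul_def]
  rfl

/-- The reflection equation for the operators representing the generators in `V^{⊗k}`. -/
theorem rhoT_reflection (hR : IsHeckeRMatrix q R) (hq0 : q ≠ 0) (hΨ : IsSkewInverse R Ψ)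
    {L : Matrix (Fin n × Fin n) (Fin n × Fin n) (Matrix (Fin k → Fin n) (Fin k → Fin n) ℂ)}
    (hL : L = (Matrix.of fun i j => (rhoT R Ψ k i j).transpose) ⊗ₖ 1)
    {R' : Matrix (Fin n × Fin n) (Fin n × Fin n) (Matrix (Fin k → Fin n) (Fin k → Fin n) ℂ)}
    (hR' : R' = R.map (algebraMap ℂ _)) :
    R' * L * R' * L - L * R' * L * R' = R' * L - L * R' := by
  subst hR'
  have hfam := ((isHeckeFamily_inv hR hq0 k).transpose).map
    (Matrix.scalarAlgHom (Fin n × Fin n) ℂ)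
  refine reflection_sum_conjTower (q := q) (K := k - 1)
    (r := fun s => Matrix.scalar (Fin n × Fin n) (neighbour k R⁻¹ s).transpose)
    (L₀ := firstL Ψ k ⊗ₖ 1) hfam (fun i _ => map_algebraMap_commute_scalar R _) ?_
    (firstL_reflection hΨ k) ?_ ?_ ?_
  · intro j hj hj'
    rw [Commute, SemiconjBy]
    ext1 ⟨i, a⟩ ⟨i', b⟩
    rw [scalar_mul_apply, mul_scalar_apply, Matrix.kroneckerMap_apply,
      Matrix.one_apply]
    split_ifs
    · rw [mul_one, firstL, Matrix.of_apply, ← Matrix.transpose_mul, ← Matrix.transpose_mul,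
        (onSite_zero_commute_neighbour _ _ hj hj').eq]
    · simp
  · intro hk
    rw [scalar_neighbour_inv hR hq0 hk]
    ext1 s t
    rw [Matrix.mul_apply, scalar_mul_apply]
    simp only [firstL_cross hR hq0 hΨ hk, Matrix.map_apply, ← Algebra.smul_def]
    rw [← Matrix.transpose_mul, ← map_mul, ← sum_smul_crossUnit]
    simp only [map_sum, map_smul, Matrix.transpose_sum, Matrix.transpose_smul]
  · intro hk
    rw [scalar_neighbour_inv hR hq0 hk]
    ext1 s t
    rw [Matrix.mul_apply, mul_scalar_apply]
    simp only [firstL_cross hR hq0 hΨ hk, Matrix.map_apply, ← Algebra.commutes,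
      ← Algebra.smul_def]
    rw [← Matrix.transpose_mul, ← map_mul, ← sum_crossUnit_smul hR hq0 hΨ]
    simp only [map_sum, map_smul, Matrix.transpose_sum, Matrix.transpose_smul]
  · rw [hL, show k - 1 + 1 = k by have := NeZero.pos k; omega]
    ext1 ⟨i, a⟩ ⟨j, b⟩
    rw [Matrix.sum_apply]
    simp only [conjTower_scalar, Matrix.kroneckerMap_apply, Matrix.of_apply, rhoT,
      Matrix.transpose_sum, rhoTerm_transpose, firstL, Finset.sum_mul]

theorem lift_mreaRel (hR : IsHeckeRMatrix q R) (hq0 : q ≠ 0) (hΨ : IsSkewInverse R Ψ)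
    ⦃x y : FreeAlgebra ℂ (Fin n × Fin n)⦄ (h : MREARel R x y) :
    FreeAlgebra.lift ℂ (fun p : Fin n × Fin n => (rhoT R Ψ k p.1 p.2).transpose) x =
      FreeAlgebra.lift ℂ (fun p : Fin n × Fin n => (rhoT R Ψ k p.1 p.2).transpose) y := by
  obtain ⟨s, t⟩ := h
  set φ := FreeAlgebra.lift ℂ (fun p : Fin n × Fin n => (rhoT R Ψ k p.1 p.2).transpose) with hφ
  have hmap : ∀ X : Matrix (Fin n × Fin n) (Fin n × Fin n) (FreeAlgebra ℂ (Fin n × Fin n)),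
      φ (X s t) = φ.mapMatrix X s t := fun X => rfl
  have hL : φ.mapMatrix (freeL₁ n) =
      (Matrix.of fun i j => (rhoT R Ψ k i j).transpose) ⊗ₖ 1 := by
    ext1 ⟨i, a⟩ ⟨j, b⟩
    rw [AlgHom.mapMatrix_apply, Matrix.map_apply, freeL₁, Matrix.kroneckerMap_apply,
      Matrix.kroneckerMap_apply, map_mul, Matrix.one_apply, Matrix.one_apply, freeL,
      Matrix.of_apply, Matrix.of_apply, hφ, FreeAlgebra.lift_ι_apply]
    split_ifs <;> simp
  have hR' : φ.mapMatrix (freeR R) = R.map (algebraMap ℂ _) := by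
    ext1 s t
    rw [AlgHom.mapMatrix_apply, Matrix.map_apply, freeR, Matrix.map_apply, Matrix.map_apply,
      AlgHom.commutes]
  rw [hmap, hmap]
  simp only [map_sub, map_mul]
  rw [rhoT_reflection hR hq0 hΨ hL hR']

/-- The representation of the algebra in `V^{⊗k}`, by matrices of operators. -/
noncomputable def powerRep (hR : IsHeckeRMatrix q R) (hq0 : q ≠ 0) (hΨ : IsSkewInverse R Ψ)
    (k : ℕ) [NeZero k] : MREA R →ₐ[ℂ] Matrix (Fin k → Fin n) (Fin k → Fin n) ℂ :=
  RingQuot.liftAlgHom ℂ ⟨FreeAlgebra.lift ℂ _, lift_mreaRel (k := k) hR hq0 hΨ⟩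

theorem powerRep_genL (hR : IsHeckeRMatrix q R) (hq0 : q ≠ 0) (hΨ : IsSkewInverse R Ψ)
    (i j : Fin n) : powerRep hR hq0 hΨ k (genL R i j) = (rhoT R Ψ k i j).transpose := by
  rw [powerRep, genL, Matrix.of_apply, RingQuot.liftAlgHom_mkAlgHom_apply,
    FreeAlgebra.lift_ι_apply]

end Cross

theorem mem_of_genL_mem {S : Subalgebra ℂ (MREA R)} (h : ∀ i j, genL R i j ∈ S) (x : MREA R) :
    x ∈ S := by
  obtain ⟨y, rfl⟩ := RingQuot.mkAlgHom_surjective ℂ (MREARel R) x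
  induction y using FreeAlgebra.induction with
  | grade0 c => rw [AlgHom.commutes]; exact S.algebraMap_mem c
  | grade1 p => exact h p.1 p.2
  | mul a b ha hb => rw [map_mul]; exact S.mul_mem ha hb
  | add a b ha hb => rw [map_add]; exact S.add_mem ha hb

end ReflectionEq

namespace ReflectionEq

variable {n : ℕ} {q : ℂ} {R Ψ : Matrix (Fin n × Fin n) (Fin n × Fin n) ℂ}

/-! ### Centrality of the quantum trace -/

section SecondTrace

variable {A : Type*} [Ring A] [Algebra ℂ A]

/-- The trace over the second factor, weighted by the matrix `C`. -/
def secondTrace (C : Matrix (Fin n) (Fin n) ℂ) (M : Matrix (Fin n × Fin n) (Fin n × Fin n) A) :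
    Matrix (Fin n) (Fin n) A :=
  Matrix.of fun a l => ∑ i, ∑ d, C i d • M (a, d) (l, i)

variable (C : Matrix (Fin n) (Fin n) ℂ) (M : Matrix (Fin n × Fin n) (Fin n × Fin n) A)
  (L : Matrix (Fin n) (Fin n) A)

theorem secondTrace_sub (N : Matrix (Fin n × Fin n) (Fin n × Fin n) A) :
    secondTrace C (M - N) = secondTrace C M - secondTrace C N := by
  ext a l
  simp only [secondTrace, Matrix.of_apply, Matrix.sub_apply, smul_sub, Finset.sum_sub_distrib]

theorem secondTrace_kronecker_mul :
    secondTrace C (L ⊗ₖ (1 : Matrix (Fin n) (Fin n) A) * M) = L * secondTrace C M := by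
  ext a l
  have h : ∀ i d, (L ⊗ₖ (1 : Matrix (Fin n) (Fin n) A) * M) (a, d) (l, i) =
      ∑ x, L a x * M (x, d) (l, i) := by
    intro i d
    simp [Matrix.mul_apply, Fintype.sum_prod_type, Matrix.one_apply]
  simp only [secondTrace, Matrix.of_apply, h]
  simp only [Matrix.mul_apply, Matrix.of_apply, Finset.smul_sum, Finset.mul_sum,
    mul_smul_comm]
  exact (Finset.sum_congr rfl fun _ _ => Finset.sum_comm).trans Finset.sum_comm

theorem secondTrace_mul_kronecker :
    secondTrace C (M * L ⊗ₖ (1 : Matrix (Fin n) (Fin n) A)) = secondTrace C M * L := by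
  ext a l
  have h : ∀ i d, (M * L ⊗ₖ (1 : Matrix (Fin n) (Fin n) A)) (a, d) (l, i) =
      ∑ x, M (a, d) (x, i) * L x l := by
    intro i d
    simp [Matrix.mul_apply, Fintype.sum_prod_type, Matrix.one_apply]
  simp only [secondTrace, Matrix.of_apply, h]
  simp only [Matrix.mul_apply, Matrix.of_apply, Finset.smul_sum, Finset.sum_mul,
    smul_mul_assoc]
  exact (Finset.sum_congr rfl fun _ _ => Finset.sum_comm).trans Finset.sum_comm

theorem secondTrace_map (X : Matrix (Fin n × Fin n) (Fin n × Fin n) ℂ) (a l : Fin n) :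
    secondTrace C (X.map (algebraMap ℂ A)) a l = algebraMap ℂ A (C * block X a l).trace := by
  simp only [secondTrace, Matrix.of_apply, Matrix.map_apply, Matrix.trace, Matrix.diag_apply,
    Matrix.mul_apply, block_apply, map_sum, map_mul, Algebra.smul_def]

theorem secondTrace_map_mul_map (X Y : Matrix (Fin n × Fin n) (Fin n × Fin n) ℂ) (a l : Fin n) :
    secondTrace C (X.map (algebraMap ℂ A) * L ⊗ₖ (1 : Matrix (Fin n) (Fin n) A) *
        Y.map (algebraMap ℂ A)) a l =
      ∑ v, ∑ w, (C * (block X a v * block Y w l)).trace • L v w := by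
  have h : ∀ i d, (X.map (algebraMap ℂ A) * L ⊗ₖ (1 : Matrix (Fin n) (Fin n) A) *
      Y.map (algebraMap ℂ A)) (a, d) (l, i) =
      ∑ v, ∑ w, (block X a v * block Y w l) d i • L v w := by
    intro i d
    have h1 : ∀ w e, (X.map (algebraMap ℂ A) * L ⊗ₖ (1 : Matrix (Fin n) (Fin n) A)) (a, d) (w, e) =
        ∑ v, X (a, d) (v, e) • L v w := by
      intro w e
      simp [Matrix.mul_apply, Fintype.sum_prod_type, Matrix.one_apply, Algebra.smul_def]
    rw [Matrix.mul_apply, Fintype.sum_prod_type, Finset.sum_comm' (t' := Finset.univ)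
      (s' := fun _ => Finset.univ) (by simp)]
    simp only [h1, Matrix.map_apply, ← Algebra.commutes, ← Algebra.smul_def, Finset.smul_sum,
      smul_smul, Matrix.mul_apply, block_apply, Finset.sum_smul]
    rw [Finset.sum_comm]
    refine (Finset.sum_congr rfl fun _ _ => Finset.sum_comm).trans ?_
    rw [Finset.sum_comm]
    exact Finset.sum_congr rfl fun _ _ => Finset.sum_congr rfl fun _ _ =>
      Finset.sum_congr rfl fun _ _ => by rw [mul_comm]
  simp only [secondTrace, Matrix.of_apply, h, Finset.smul_sum, smul_smul, Matrix.trace,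
    Matrix.diag_apply, Matrix.mul_apply (M := C), Finset.sum_smul]
  refine (Finset.sum_congr rfl fun _ _ => Finset.sum_comm).trans ?_
  rw [Finset.sum_comm]
  refine Finset.sum_congr rfl fun _ _ => ?_
  refine (Finset.sum_congr rfl fun _ _ => Finset.sum_comm).trans ?_
  exact Finset.sum_comm

end SecondTrace

theorem genL_reflection (R : Matrix (Fin n × Fin n) (Fin n × Fin n) ℂ)
    {L R' : Matrix (Fin n × Fin n) (Fin n × Fin n) (MREA R)}
    (hL : L = genL R ⊗ₖ (1 : Matrix (Fin n) (Fin n) (MREA R)))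
    (hR' : R' = R.map (algebraMap ℂ (MREA R))) :
    R' * L * R' * L - L * R' * L * R' = R' * L - L * R' := by
  set φ := RingQuot.mkAlgHom ℂ (MREARel R) with hφ
  have hL' : φ.mapMatrix (freeL₁ n) = L := by
    rw [hL]
    ext1 ⟨i, a⟩ ⟨j, b⟩
    rw [AlgHom.mapMatrix_apply, Matrix.map_apply, freeL₁, Matrix.kroneckerMap_apply,
      Matrix.kroneckerMap_apply, map_mul, Matrix.one_apply, Matrix.one_apply, freeL,
      Matrix.of_apply, genL, Matrix.of_apply]
    split_ifs <;> simp [hφ]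
  have hR'' : φ.mapMatrix (freeR R) = R' := by
    rw [hR']
    ext1 s t
    rw [AlgHom.mapMatrix_apply, Matrix.map_apply, freeR, Matrix.map_apply, Matrix.map_apply,
      AlgHom.commutes]
  have hmap : ∀ X : Matrix (Fin n × Fin n) (Fin n × Fin n) (FreeAlgebra ℂ (Fin n × Fin n)),
      ∀ s t, φ (X s t) = φ.mapMatrix X s t := fun X s t => rfl
  ext1 s t
  have h := RingQuot.mkAlgHom_rel ℂ (MREARel.entry (R := R) s t)
  rw [← hφ, hmap, hmap] at h
  simpa only [map_sub, map_mul, hL', hR''] using h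

theorem qTrace_genL (R Ψ : Matrix (Fin n × Fin n) (Fin n × Fin n) ℂ) :
    qTrace R Ψ (genL R) = ∑ v, ∑ w, matC Ψ w v • genL R v w := by
  simp only [qTrace, Matrix.trace, Matrix.diag_apply, Matrix.mul_apply, Matrix.map_apply,
    ← Algebra.smul_def]
  exact Finset.sum_comm

/-- The quantum trace commutes with the generators. -/
theorem genL_commute_qTrace (hR : IsHeckeRMatrix q R) (hq0 : q ≠ 0) (hΨ : IsSkewInverse R Ψ)
    (i j : Fin n) : Commute (genL R i j) (qTrace R Ψ (genL R)) := by
  set L := genL R ⊗ₖ (1 : Matrix (Fin n) (Fin n) (MREA R)) with hL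
  set R' := R.map (algebraMap ℂ (MREA R)) with hR'
  set S := R⁻¹.map (algebraMap ℂ (MREA R)) with hS
  have hRS : R' * S = 1 := by
    rw [hR', hS, ← Matrix.map_mul, hR.mul_inv hq0, Matrix.map_one _ (map_zero _) (map_one _)]
  have hSR : S * R' = 1 := by
    rw [hR', hS, ← Matrix.map_mul, hR.inv_mul hq0, Matrix.map_one _ (map_zero _) (map_one _)]
  -- Two-sided multiplication by R⁻¹ isolates the conjugates R L₁ R⁻¹ and R⁻¹ L₁ R, whose C-traces
  -- are both Tr_q L times the identity.
  have h : L * (R' * L * S) - S * L * R' * L = L * S - S * L := by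
    have h0 := congrArg (fun X => S * X * S) (genL_reflection R hL hR')
    simp only [mul_sub, sub_mul] at h0
    calc _ = (S * R') * L * R' * L * S - S * L * R' * L * (R' * S) := by
          rw [hSR, hRS]; noncomm_ring
      _ = (S * R') * L * S - S * L * (R' * S) := by
          simpa only [mul_assoc] using h0
      _ = _ := by rw [hSR, hRS, one_mul, mul_one]
  have ht := congrArg (secondTrace (matC Ψ)) h
  rw [secondTrace_sub, secondTrace_sub, hL, secondTrace_kronecker_mul, secondTrace_mul_kronecker,
    secondTrace_kronecker_mul, secondTrace_mul_kronecker] at ht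
  have h1 : secondTrace (matC Ψ) (R' * genL R ⊗ₖ 1 * S) =
      Matrix.scalar (Fin n) (qTrace R Ψ (genL R)) := by
    ext1 a l
    rw [secondTrace_map_mul_map, Matrix.scalar_apply, Matrix.diagonal_apply, qTrace_genL]
    simp only [trace_matC_mul_inv hR hq0 hΨ]
    split_ifs <;> simp
  have h2 : secondTrace (matC Ψ) (S * genL R ⊗ₖ 1 * R') =
      Matrix.scalar (Fin n) (qTrace R Ψ (genL R)) := by
    ext1 a l
    rw [secondTrace_map_mul_map, Matrix.scalar_apply, Matrix.diagonal_apply, qTrace_genL]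
    simp only [trace_matC_inv_mul hR hq0 hΨ]
    split_ifs <;> simp
  have h3 : secondTrace (matC Ψ) S = Matrix.scalar (Fin n)
      (algebraMap ℂ (MREA R) (1 - (q - q⁻¹) * (matC Ψ).trace)) := by
    ext1 a l
    rw [secondTrace_map, trace_matC_inv hR hq0 hΨ, Matrix.scalar_apply, Matrix.diagonal_apply]
    split_ifs <;> simp
  rw [h1, h2, h3] at ht
  have hij := congrFun (congrFun ht i) j
  rw [Matrix.sub_apply, Matrix.sub_apply, mul_scalar_apply, mul_scalar_apply, scalar_mul_apply,
    scalar_mul_apply, Algebra.commutes, sub_self, sub_eq_zero] at hij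
  exact hij

theorem qTrace_genL_mem_center (hR : IsHeckeRMatrix q R) (hq0 : q ≠ 0) (hΨ : IsSkewInverse R Ψ) :
    qTrace R Ψ (genL R) ∈ Subalgebra.center ℂ (MREA R) := by
  rw [Subalgebra.mem_center_iff]
  intro x
  have : x ∈ Subalgebra.centralizer ℂ {qTrace R Ψ (genL R)} :=
    mem_of_genL_mem (fun i j => by
      rw [Subalgebra.mem_centralizer_iff]
      rintro _ rfl
      exact (genL_commute_qTrace hR hq0 hΨ i j).symm.eq) x
  rw [Subalgebra.mem_centralizer_iff] at this
  exact (this _ rfl).symm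

end ReflectionEq

namespace ReflectionEq

variable {n : ℕ} {q : ℂ} {R Ψ : Matrix (Fin n × Fin n) (Fin n × Fin n) ℂ}

/-! ### Young idempotents -/

section ListProd

variable {A : Type*} [Ring A] [Algebra ℂ A]

theorem mul_list_prod_of_mem {l : List A} {x y : A} {c : ℂ} (hy : y ∈ l)
    (hx : ∀ z ∈ l, Commute x z) (hxy : x * y = c • y) : x * l.prod = c • l.prod := by
  induction l with
  | nil => simp at hy
  | cons z l ih =>
    rw [List.prod_cons]
    rcases List.mem_cons.1 hy with rfl | hy
    · rw [← mul_assoc, hxy, smul_mul_assoc]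
    · rw [← mul_assoc, (hx z List.mem_cons_self).eq, mul_assoc,
        ih hy fun w hw => hx w (List.mem_cons_of_mem _ hw), mul_smul_comm]

theorem list_prod_mul_of_forall {A : Type*} [Ring A] {l : List A} {y : A} (h : ∀ z ∈ l, z * y = y) : l.prod * y = y := by
  induction l with
  | nil => simp
  | cons z l ih =>
    rw [List.prod_cons, mul_assoc, ih fun w hw => h w (List.mem_cons_of_mem _ hw),
      h z List.mem_cons_self]

theorem aeval_mul_of_eigen {x y : A} {c : ℂ} (h : x * y = c • y) (f : Polynomial ℂ) :
    Polynomial.aeval x f * y = f.eval c • y := by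
  rw [semiconj_aeval (b := algebraMap ℂ A c) (by rw [h, Algebra.smul_def, Algebra.commutes]) f,
    Polynomial.aeval_algebraMap_apply, ← Algebra.commutes, ← Algebra.smul_def,
    Polynomial.coe_aeval_eq_eval]

end ListProd

theorem StandardTableau.content_mem {ν : YoungDiagram} {k : ℕ} (T : StandardTableau ν k)
    (hν : ν.card = k) (i : Fin k) : T.content i ∈ Finset.Ioo (-(k : ℤ)) (k : ℤ) := by
  have hmem : ((T.box i).1.1, (T.box i).1.2) ∈ ν := (T.box i).2
  have h1 := YoungDiagram.mem_iff_lt_rowLen.1 hmem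
  have h2 := YoungDiagram.mem_iff_lt_colLen.1 hmem
  rw [YoungDiagram.rowLen_eq_card] at h1
  rw [YoungDiagram.colLen_eq_card] at h2
  have h3 := h1.trans_le (Finset.card_le_card (Finset.filter_subset _ _))
  have h4 := h2.trans_le (Finset.card_le_card (Finset.filter_subset _ _))
  change _ < ν.card at h3
  change _ < ν.card at h4
  rw [StandardTableau.content, Finset.mem_Ioo]
  omega

section Projector

variable {k : ℕ}

theorem aeval_conjTower_nodal (hR : IsHeckeRMatrix q R) (hq0 : q ≠ 0)
    (hq : ∀ m : ℕ, 0 < m → q ^ m ≠ 1) {i : ℕ} (hi : i < k) :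
    Polynomial.aeval (conjTower (neighbour k R) 1 i)
      (Lagrange.nodal (Finset.Ioo (-(k : ℤ)) (k : ℤ)) fun c : ℤ => q ^ (2 * c)) = 0 := by
  set φ := (Matrix.toLinAlgEquiv' : Matrix (Fin k → Fin n) (Fin k → Fin n) ℂ ≃ₐ[ℂ] _).toAlgHom
    with hφ
  have hinj : Function.Injective φ := Matrix.toLinAlgEquiv'.injective
  apply hinj
  rw [map_zero, ← Polynomial.aeval_algHom_apply]
  have h := conjTower_map φ.toRingHom (neighbour k R) 1 i
  rw [map_one] at h
  rw [show φ (conjTower (neighbour k R) 1 i) = _ from h]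
  refine aeval_jm_nodal hq0 hq ((hR.isHeckeFamily hq0 k).map φ) (by omega) fun c hc => ?_
  rw [Finset.mem_Icc] at hc
  rw [Finset.mem_Ioo]
  omega

variable {ν : YoungDiagram} (hR : IsHeckeRMatrix q R) (T : StandardTableau ν k)

theorem youngProjector_eq_prod : youngProjector hR T = (List.ofFn fun i : Fin k =>
    Polynomial.aeval (conjTower (neighbour k R) 1 i)
      (Lagrange.basis (Finset.Ioo (-(k : ℤ)) (k : ℤ)) (fun m : ℤ => q ^ (2 * m))
        (T.content i))).prod := by
  rw [youngProjector, youngIdempotent, map_list_prod, List.map_ofFn]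
  congr 2
  funext i
  rw [Function.comp_apply, ← Polynomial.aeval_algHom_apply, localRep_jucysMurphy]

variable {hR T}

theorem commute_youngProjector {X : Matrix (Fin k → Fin n) (Fin k → Fin n) ℂ}
    (hX : ∀ i : Fin k, Commute X (conjTower (neighbour k R) 1 i)) :
    Commute X (youngProjector hR T) := by
  rw [youngProjector_eq_prod]
  refine Commute.list_prod_right _ _ fun z hz => ?_
  obtain ⟨i, rfl⟩ := (List.mem_ofFn' _ _).1 hz
  exact (semiconj_aeval (hX i).eq.symm _).symm

/-- Multiplying the factor of `youngProjector` at `i` by J_i − q^{2c} gives a multiple of the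
annihilating nodal polynomial, hence zero. The remaining factors commute with J_i. -/
theorem conjTower_mul_youngProjector (hq0 : q ≠ 0) (hq : ∀ m : ℕ, 0 < m → q ^ m ≠ 1)
    (hν : ν.card = k) (i : Fin k) :
    conjTower (neighbour k R) 1 i * youngProjector hR T =
      q ^ (2 * T.content i) • youngProjector hR T := by
  rw [youngProjector_eq_prod]
  refine mul_list_prod_of_mem ((List.mem_ofFn' _ _).2 ⟨i, rfl⟩) ?_ ?_
  · intro z hz
    obtain ⟨j, rfl⟩ := (List.mem_ofFn' _ _).1 hz
    exact (semiconj_aeval ((hR.isHeckeFamily hq0 k).commute_jm (by omega) (by omega)).eq _).symm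
  · obtain ⟨t, ht⟩ := sub_mul_basis (β := fun m : ℤ => q ^ (2 * m)) (T.content_mem hν i)
    have h := congrArg (Polynomial.aeval (conjTower (neighbour k R) 1 i)) ht
    rw [map_mul, map_mul, aeval_conjTower_nodal hR hq0 hq i.2, mul_zero, map_sub,
      Polynomial.aeval_X, Polynomial.aeval_C, sub_mul, sub_eq_zero, ← Algebra.smul_def] at h
    exact h

/-- Each Lagrange factor acts on the product by its value at its own node, which is 1. -/
theorem youngProjector_mul_self (hq0 : q ≠ 0) (hq : ∀ m : ℕ, 0 < m → q ^ m ≠ 1)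
    (hν : ν.card = k) : youngProjector hR T * youngProjector hR T = youngProjector hR T := by
  nth_rewrite 1 [youngProjector_eq_prod hR T]
  refine list_prod_mul_of_forall fun z hz => ?_
  obtain ⟨i, rfl⟩ := (List.mem_ofFn' _ _).1 hz
  rw [aeval_mul_of_eigen (conjTower_mul_youngProjector hq0 hq hν i),
    Lagrange.eval_basis_self (zpow_two_mul_injective hq0 hq).injOn (T.content_mem hν i), one_smul]

/-- The sum runs over the whole tower of R⁻¹, so it commutes with every R_s⁻¹, hence with every R_s
and with the Jucys–Murphy elements built from them. -/
theorem rhoT_commute_youngProjector [NeZero k] (hq0 : q ≠ 0) (i j : Fin n) :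
    Commute (rhoT R Ψ k i j) (youngProjector hR T) := by
  have hk : k - 1 + 1 = k := by have := NeZero.pos k; omega
  have hnb : ∀ s < k - 1, Commute (rhoT R Ψ k i j) (neighbour k R s) := by
    intro s hs
    have h := (isHeckeFamily_inv hR hq0 k).commute_sum_conjTower
      (fun l hl hl' => onSite_zero_commute_neighbour (piT Ψ i j) R⁻¹ hl hl') hs
    simp only [hk, ← rhoTerm_eq] at h
    change Commute _ (rhoT R Ψ k i j) at h
    rw [neighbour_inv hR hq0 hs] at h
    have h' := h.add_left ((Commute.one_left (rhoT R Ψ k i j)).smul_left (q - q⁻¹))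
    rw [sub_add_cancel] at h'
    exact h'.symm
  refine commute_youngProjector fun s => ?_
  obtain ⟨s, hs⟩ := s
  change Commute _ (conjTower (neighbour k R) 1 s)
  induction s with
  | zero => exact Commute.one_right _
  | succ s ih =>
    have h := hnb s (by omega)
    exact (h.mul_right (ih (by omega))).mul_right h

end Projector

end ReflectionEq

namespace ReflectionEq

variable {n : ℕ} {q : ℂ} {R Ψ : Matrix (Fin n × Fin n) (Fin n × Fin n) ℂ}

/-! ### The value of the quantum trace -/

theorem conjTower_sum_smul {A ι : Type*} [Ring A] [Algebra ℂ A] (σ : ℕ → A) (t : Finset ι)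
    (c : ι → ℂ) (z : ι → A) (s : ℕ) :
    conjTower σ (∑ i ∈ t, c i • z i) s = ∑ i ∈ t, c i • conjTower σ (z i) s := by
  induction s with
  | zero => rfl
  | succ s ih =>
    simp only [conjTower_succ, ih, Finset.mul_sum, Finset.sum_mul, mul_smul_comm, smul_mul_assoc]

theorem conjTower_smul {A : Type*} [Ring A] [Algebra ℂ A] (σ : ℕ → A) (c : ℂ) (z : A) (s : ℕ) :
    conjTower σ (c • z) s = c • conjTower σ z s := by
  simpa using conjTower_sum_smul σ {()} (fun _ => c) (fun _ => z) s

/-- The tower built from the inverse generators is the inverse of the Jucys–Murphy element, so its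
eigenvalue on the image of Y is q^{-2c}. -/
theorem conjTower_one_mul_conjTower_one {A : Type*} [Ring A] {σ τ : ℕ → A} {K : ℕ}
    (h : ∀ i < K, τ i * σ i = 1) {s : ℕ} (hs : s ≤ K) :
    conjTower τ 1 s * conjTower σ 1 s = 1 := by
  induction s with
  | zero => exact one_mul 1
  | succ s ih =>
    rw [conjTower_succ, conjTower_succ]
    calc _ = τ s * conjTower τ 1 s * (τ s * σ s) * (conjTower σ 1 s * σ s) := by noncomm_ring
      _ = τ s * (conjTower τ 1 s * conjTower σ 1 s) * σ s := by
        rw [h s hs]; noncomm_ring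
      _ = 1 := by rw [ih (by omega), mul_one, h s hs]

theorem sum_matC_smul_onSite_piT (Ψ : Matrix (Fin n × Fin n) (Fin n × Fin n) ℂ) {k : ℕ}
    (a : Fin k) {c : ℂ} (h : matB Ψ * matC Ψ = c • 1) :
    ∑ v : Fin n × Fin n, matC Ψ v.2 v.1 • onSite (piT Ψ v.1 v.2) a = c • 1 := by
  ext f g
  have hfg := congrFun (congrFun h (f a)) (g a)
  rw [Matrix.mul_apply, Matrix.smul_apply, Matrix.one_apply] at hfg
  simp only [Matrix.sum_apply, Matrix.smul_apply, onSite, piT, Matrix.of_apply, smul_eq_mul,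
    mul_ite, mul_zero, Fintype.sum_prod_type]
  by_cases hc : ∀ b, b ≠ a → f b = g b
  · have e : (f a = g a) = (f = g) := propext ⟨fun h' => funext fun b => by
      by_cases hb : b = a
      · rw [hb, h']
      · exact hc b hb, fun h' => by rw [h']⟩
    simp only [if_pos hc, Finset.sum_ite_irrel, Finset.sum_const_zero, Finset.sum_ite_eq,
      Finset.mem_univ, if_true]
    rw [Matrix.one_apply, ← if_congr (iff_of_eq e) rfl rfl]
    simp only [smul_eq_mul] at hfg
    rw [← hfg]
    exact Finset.sum_congr rfl fun _ _ => mul_comm _ _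
  · have hne : f ≠ g := fun h' => hc fun b _ => by rw [h']
    simp [hc, hne]

/-- The C-weighted sum in the first factor is the scalar matrix BC. Pulling this scalar out of each
tower leaves the inverse Jucys–Murphy elements. -/
theorem sum_matC_smul_rhoT (Ψ : Matrix (Fin n × Fin n) (Fin n × Fin n) ℂ) (k : ℕ) [NeZero k]
    {c : ℂ} (h : matB Ψ * matC Ψ = c • 1) :
    ∑ v : Fin n × Fin n, matC Ψ v.2 v.1 • rhoT R Ψ k v.1 v.2 =
      c • ∑ s ∈ Finset.range k, conjTower (neighbour k R⁻¹) 1 s := by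
  simp only [rhoT, rhoTerm_eq, Finset.smul_sum]
  rw [Finset.sum_comm]
  refine Finset.sum_congr rfl fun s _ => ?_
  rw [← conjTower_smul, ← sum_matC_smul_onSite_piT Ψ (0 : Fin k) h, conjTower_sum_smul]

theorem conjTower_inv_mul_youngProjector (hR : IsHeckeRMatrix q R) (hq0 : q ≠ 0)
    (hq : ∀ m : ℕ, 0 < m → q ^ m ≠ 1) {ν : YoungDiagram} {k : ℕ} (hν : ν.card = k)
    (T : StandardTableau ν k) (i : Fin k) :
    conjTower (neighbour k R⁻¹) 1 i * youngProjector hR T =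
      q ^ (-(2 * T.content i)) • youngProjector hR T := by
  have h : conjTower (neighbour k R⁻¹) 1 i * conjTower (neighbour k R) 1 i = 1 :=
    conjTower_one_mul_conjTower_one (K := k - 1) (fun j hj => by
      rw [neighbour_inv hR hq0 hj]
      exact (hR.isHeckeFamily hq0 k).inv_mul hj) (by omega)
  have h' := congrArg (conjTower (neighbour k R⁻¹) 1 i * ·)
    (conjTower_mul_youngProjector (T := T) (hR := hR) hq0 hq hν i)
  simp only [← mul_assoc, h, one_mul, mul_smul_comm] at h'
  rw [zpow_neg, eq_inv_smul_iff₀ (zpow_ne_zero _ hq0), ← h']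

/-- A row is a geometric progression of ratio q^{-2}. The row index counts from zero, hence `r + 1`
in the exponent. -/
theorem sum_zpow_row (hq0 : q ≠ 0) (hq : ∀ m : ℕ, 0 < m → q ^ m ≠ 1) (r N : ℕ) :
    ∑ j ∈ Finset.range N, q ^ (-(2 * ((j : ℤ) - r))) =
      q ^ (2 * ((r : ℤ) + 1) - 1 - (N : ℤ)) * qNum q N := by
  have hd := sub_inv_ne_zero hq0 hq
  induction N with
  | zero => simp [qNum]
  | succ N ih =>
    rw [Finset.sum_range_succ, ih]
    have e1 : q ^ (-(2 * ((N : ℤ) - r))) =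
        q ^ (2 * ((r : ℤ) + 1) - 1 - (N : ℤ)) * (q⁻¹ * (q⁻¹) ^ N) := by
      rw [← pow_succ', inv_pow, ← zpow_natCast, ← zpow_neg, ← zpow_add₀ hq0]
      congr 1
      push_cast
      ring
    have e2 : q ^ (2 * ((r : ℤ) + 1) - 1 - ((N + 1 : ℕ) : ℤ)) =
        q ^ (2 * ((r : ℤ) + 1) - 1 - (N : ℤ)) * q⁻¹ := by
      rw [← zpow_sub_one₀ hq0]
      congr 1
      push_cast
      ring
    rw [e1, e2, ← mul_add, mul_assoc]
    congr 1
    rw [qNum, qNum, div_add' _ _ _ hd, mul_div_assoc']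
    congr 1
    linear_combination ((q⁻¹) ^ N - q ^ N) * inv_mul_cancel₀ hq0

theorem sum_zpow_content (hq0 : q ≠ 0) (hq : ∀ m : ℕ, 0 < m → q ^ m ≠ 1) {ν : YoungDiagram}
    {k : ℕ} (T : StandardTableau ν k) :
    ∑ i : Fin k, q ^ (-(2 * T.content i)) =
      ∑ r ∈ Finset.range (ν.colLen 0),
        q ^ (2 * ((r : ℤ) + 1) - 1 - (ν.rowLen r : ℤ)) * qNum q (ν.rowLen r) := by
  have h1 : ∑ i : Fin k, q ^ (-(2 * T.content i)) =
      ∑ x ∈ ν.cells, q ^ (-(2 * ((x.2 : ℤ) - x.1))) := by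
    rw [← Finset.sum_coe_sort ν.cells]
    exact T.box.sum_comp fun x : ν.cells => q ^ (-(2 * ((x.1.2 : ℤ) - x.1.1)))
  have h2 : ∀ x ∈ ν.cells, x.1 ∈ Finset.range (ν.colLen 0) := by
    rintro ⟨a, b⟩ hx
    have hab : (a, b) ∈ ν := hx
    rw [Finset.mem_range]
    exact YoungDiagram.mem_iff_lt_colLen.1 (ν.up_left_mem le_rfl (Nat.zero_le b) hab)
  rw [h1, ← Finset.sum_fiberwise_of_maps_to h2]
  refine Finset.sum_congr rfl fun r _ => ?_
  rw [← sum_zpow_row hq0 hq]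
  change ∑ x ∈ ν.row r, _ = _
  rw [YoungDiagram.row_eq_prod, Finset.sum_product, Finset.sum_singleton]

/-! ### The representation in the image of a Young idempotent -/

section TableauRep

theorem toLin'_youngProjector_coe {k : ℕ} {ν : YoungDiagram} {hR : IsHeckeRMatrix q R}
    {T : StandardTableau ν k} (hq0 : q ≠ 0) (hq : ∀ m : ℕ, 0 < m → q ^ m ≠ 1)
    (hν : ν.card = k) (v : youngSubspace hR T) :
    Matrix.toLin' (youngProjector hR T).transpose (v : (Fin k → Fin n) → ℂ) = v := by
  obtain ⟨_, w, rfl⟩ := v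
  rw [← Matrix.toLin'_mul_apply, ← Matrix.transpose_mul, youngProjector_mul_self hq0 hq hν]

variable {k : ℕ} [NeZero k] {ν : YoungDiagram} (hR : IsHeckeRMatrix q R) (hq0 : q ≠ 0)
  (hΨ : IsSkewInverse R Ψ) (T : StandardTableau ν k)

theorem commute_powerRep (x : MREA R) :
    Commute (youngProjector hR T).transpose (powerRep hR hq0 hΨ k x) := by
  have h : x ∈ (Subalgebra.centralizer ℂ {(youngProjector hR T).transpose}).comap
      (powerRep hR hq0 hΨ k) := mem_of_genL_mem (fun i j => by
    rw [Subalgebra.mem_comap, Subalgebra.mem_centralizer_iff]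
    rintro _ rfl
    rw [powerRep_genL, ← Matrix.transpose_mul, ← Matrix.transpose_mul,
      (rhoT_commute_youngProjector hq0 i j).eq]) x
  rw [Subalgebra.mem_comap, Subalgebra.mem_centralizer_iff] at h
  exact h _ rfl

theorem powerRep_mapsTo (x : MREA R) (v : (Fin k → Fin n) → ℂ) (hv : v ∈ youngSubspace hR T) :
    Matrix.toLin' (powerRep hR hq0 hΨ k x) v ∈ youngSubspace hR T := by
  obtain ⟨w, rfl⟩ := hv
  refine ⟨Matrix.toLin' (powerRep hR hq0 hΨ k x) w, ?_⟩
  rw [← Matrix.toLin'_mul_apply, ← Matrix.toLin'_mul_apply, (commute_powerRep hR hq0 hΨ T x).eq]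

/-- The representation in the image of a Young idempotent, as a restriction of the representation
in the tensor power. -/
noncomputable def tableauRep : MREA R →ₐ[ℂ] Module.End ℂ (youngSubspace hR T) :=
  AlgHom.ofLinearMap
    { toFun := fun x => (Matrix.toLin' (powerRep hR hq0 hΨ k x)).restrict
        (powerRep_mapsTo hR hq0 hΨ T x)
      map_add' := fun x y => by
        ext1 v
        apply Subtype.ext
        simp
      map_smul' := fun c x => by
        ext1 v
        apply Subtype.ext
        simp }
    (by
      ext1 v
      apply Subtype.ext
      simp)
    (fun x y => by
      ext1 v
      apply Subtype.ext
      simp)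

theorem coe_tableauRep_apply (x : MREA R) (v : youngSubspace hR T) :
    (tableauRep hR hq0 hΨ T x v : (Fin k → Fin n) → ℂ) =
      Matrix.toLin' (powerRep hR hq0 hΨ k x) v := rfl

variable {hR T}

theorem isTableauRep_tableauRep (hq : ∀ m : ℕ, 0 < m → q ^ m ≠ 1) (hν : ν.card = k) :
    IsTableauRep hR Ψ T (tableauRep hR hq0 hΨ T) := by
  intro i j v
  rw [coe_tableauRep_apply, powerRep_genL, mul_assoc,
    (rhoT_commute_youngProjector hq0 i j).eq, ← mul_assoc, youngProjector_mul_self hq0 hq hν,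
    Matrix.transpose_mul, Matrix.toLin'_mul_apply, toLin'_youngProjector_coe hq0 hq hν]

theorem tableauRep_qTrace {p : ℕ} (hp : HasSymmetryRank hR p) (hq : ∀ m : ℕ, 0 < m → q ^ m ≠ 1)
    (hν : ν.card = k) :
    tableauRep hR hq0 hΨ T (qTrace R Ψ (genL R)) =
      (q ^ (-2 * (p : ℤ)) * ∑ i : Fin k, q ^ (-(2 * T.content i))) • 1 := by
  have h1 : powerRep hR hq0 hΨ k (qTrace R Ψ (genL R)) =
      (q ^ (-2 * (p : ℤ)) • ∑ i : Fin k, conjTower (neighbour k R⁻¹) 1 i).transpose := by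
    rw [← Finset.sum_range (fun s => conjTower (neighbour k R⁻¹) 1 s),
      ← sum_matC_smul_rhoT Ψ k (hp.matB_mul_matC hq0 hq hΨ), qTrace_genL, Fintype.sum_prod_type]
    simp only [map_sum, map_smul, powerRep_genL, Matrix.transpose_sum, Matrix.transpose_smul]
  ext1 v
  apply Subtype.ext
  rw [coe_tableauRep_apply]
  -- Vectors of the subspace are fixed by Y. Inserting Y makes the eigenvalues of the inverse
  -- Jucys–Murphy elements available.
  conv_lhs => rw [← toLin'_youngProjector_coe hq0 hq hν v]
  rw [← Matrix.toLin'_mul_apply, ← (commute_powerRep hR hq0 hΨ T _).eq, h1,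
    ← Matrix.transpose_mul, smul_mul_assoc, Finset.sum_mul]
  simp only [conjTower_inv_mul_youngProjector hR hq0 hq hν]
  rw [← Finset.sum_smul, smul_smul, Matrix.transpose_smul, map_smul, LinearMap.smul_apply,
    toLin'_youngProjector_coe hq0 hq hν]
  rfl

end TableauRep

end ReflectionEq

/-! ### The main theorem. -/

theorem lemma1 {n p k : ℕ} [NeZero k] (q : ℂ) (hq0 : q ≠ 0) (hq : ∀ m : ℕ, 0 < m → q ^ m ≠ 1)
    (R Ψ : Matrix (Fin n × Fin n) (Fin n × Fin n) ℂ)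
    (hR : ReflectionEq.IsHeckeRMatrix q R) (hΨ : ReflectionEq.IsSkewInverse R Ψ)
    (hp : ReflectionEq.HasSymmetryRank hR p)
    (ν : YoungDiagram) (hν : ν.card = k) :
    ReflectionEq.qTrace R Ψ (ReflectionEq.genL R) ∈ Subalgebra.center ℂ (ReflectionEq.MREA R) ∧
    ∀ T : ReflectionEq.StandardTableau ν k,
      ∃ π : ReflectionEq.MREA R →ₐ[ℂ] Module.End ℂ (ReflectionEq.youngSubspace hR T),
        ReflectionEq.IsTableauRep hR Ψ T π ∧
        π (ReflectionEq.qTrace R Ψ (ReflectionEq.genL R)) =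
          (q ^ (-2 * (p : ℤ)) *
            ∑ r ∈ Finset.range (ν.colLen 0),
              q ^ (2 * ((r : ℤ) + 1) - 1 - (ν.rowLen r : ℤ)) *
                ReflectionEq.qNum q (ν.rowLen r)) • 1 := by
  refine ⟨ReflectionEq.qTrace_genL_mem_center hR hq0 hΨ, fun T =>
    ⟨ReflectionEq.tableauRep hR hq0 hΨ T,
      ReflectionEq.isTableauRep_tableauRep hq0 hΨ hq hν, ?_⟩⟩
  rw [ReflectionEq.tableauRep_qTrace hq0 hΨ hp hq hν, ReflectionEq.sum_zpow_content hq0 hq T]
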